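/- Fix a prime $p$. For a $p$-adic formal scheme $X$ and $n\ge 0$ let $X_n$ denote the closed subscheme of $X$ defined by $p^n$, and for a morphism $f$ of $p$-adic formal schemes let $f_n$ be the induced morphism modulo $p^n$. A \emph{formal $\phi$-scheme} is a $p$-torsion free $p$-adic formal scheme $X$ endowed with an endomorphism $\phi_X$ lifting the absolute Frobenius endomorphism of $X_1$; a morphism of formal $\phi$-schemes is a morphism of formal schemes compatible with the endomorphisms $\phi$. A morphism $f\colon X\to X'$ of formal $\phi$-schemes is called \emph{$p$-completely smooth} (resp. \emph{$p$-completely faithfully flat}, resp. a \emph{closed immersion}) if $f_n\colon X_n\to X'_n$ is smooth (resp. flat and surjective, resp. a closed immersion) for every $n$. \textbf{Theorem.} Let $Y\to S$ and $T\to S$ be morphisms of formal $\phi$-schemes, where $Y\to S$ is $p$-completely smooth. Let $n>0$ and let $f_n\colon T_n\to Y$ be an $S$-morphism (equivalently, an $S_n$-morphism $T_n\to Y_n$) compatible with the Frobenius liftings. (1) There exist a $p$-completely faithfully flat morphism of formal $\phi$-schemes $u\colon\widetilde T\to T$ and a morphism of formal $\phi$-schemes over $S$, $\tilde f\colon\widetilde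 T\to Y$, such that $\tilde f_n=f_n\circ u_n$. (2) Suppose in addition that $i\colon Z\to T$ is a morphism of formal $\phi$-schemes which is a closed immersion, and that $g\colon Z\to Y$ is a morphism of formal $\phi$-schemes over $S$ (where $Z$ is viewed over $S$ via $i$) such that $f_n\circ i_n=g_n$. Then there exist formal $\phi$-schemes $\widetilde T$ and $\widetilde Z$, $p$-completely faithfully flat morphisms of formal $\phi$-schemes $u\colon\widetilde T\to T$ and $v\colon\widetilde Z\to Z$, a morphism of formal $\phi$-schemes $\tilde\imath\colon\widetilde Z\to\widetilde T$, and a morphism of formal $\phi$-schemes over $S$, $\tilde f\colon\widetilde T\to Y$, such that $$u\circ\tilde\imath=i\circ v,\qquad \tilde f\circ\tilde\imath=g\circ v,\qquad \tilde f_n=f_n\circ u_n .$$ -/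

import Mathlib

open CategoryTheory AlgebraicGeometry

universe u

/-- A `p`-adic formal scheme `X`, given by its system of reductions `X_n`, the closed subscheme of
`X` defined by `p ^ n`: an inductive system of schemes `X_0 → X_1 → X_2 → ⋯` in which, for
`m ≤ n`, the transition map `X_m → X_n` is a closed immersion whose ideal is `p ^ m 𝒪_{X_n}`.
For `m = n` this says that `p ^ n = 0` on `X_n`; in particular `X_0` is empty. The formal scheme is
the colimit of the system; its structure sheaf is the limit of the structure sheaves `𝒪_{X_n}`. -/
structure PadicFormalScheme (p : ℕ) where
  /-- The system of reductions. -/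
  system : ℕ ⥤ Scheme.{u}
  isClosedImmersion : ∀ {m n : ℕ} (h : m ⟶ n), IsClosedImmersion (system.map h)
  ker_eq : ∀ {m n : ℕ} (h : m ⟶ n) (U : (system.obj n).Opens), IsAffineOpen U →
    RingHom.ker ((system.map h).app U).hom = Ideal.span {(p : Γ(system.obj n, U)) ^ m}

namespace PadicFormalScheme

variable {p : ℕ}

/-- A morphism of `p`-adic formal schemes is a compatible family of morphisms `X_n ⟶ Y_n`. -/
instance : Category (PadicFormalScheme.{u} p) :=
  inferInstanceAs (Category (InducedCategory (ℕ ⥤ Scheme.{u}) PadicFormalScheme.system))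

/-- The closed subscheme `X_n` of `X` defined by `p ^ n`. -/
abbrev red (X : PadicFormalScheme.{u} p) (n : ℕ) : Scheme.{u} := X.system.obj n

/-- The morphism `X_n ⟶ Y_n` induced by a morphism `X ⟶ Y`. -/
abbrev redMap {X Y : PadicFormalScheme.{u} p} (f : X ⟶ Y) (n : ℕ) : X.red n ⟶ Y.red n :=
  (InducedCategory.Hom.hom f).app n

/-- An open subset of the formal scheme `X`, as the family of the corresponding open subsets of the
reductions `X_n`. -/
structure Opens (X : PadicFormalScheme.{u} p) where
  /-- The corresponding open subset of `X_n`. -/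
  toOpens : ∀ n : ℕ, (X.red n).Opens
  preimage_eq : ∀ {m n : ℕ} (h : m ⟶ n), X.system.map h ⁻¹ᵁ toOpens n = toOpens m

/-- The ring `Γ(U, 𝒪_X) = lim_n Γ(U_n, 𝒪_{X_n})` of sections of the structure sheaf. -/
def sections (X : PadicFormalScheme.{u} p) (U : X.Opens) :
    Subring (∀ n : ℕ, Γ(X.red n, U.toOpens n)) where
  carrier := {s | ∀ (m n : ℕ) (h : m ⟶ n),
    (X.system.map h).appLE (U.toOpens n) (U.toOpens m) (U.preimage_eq h).ge (s n) = s m}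
  mul_mem' ha hb m n h := by simp [ha m n h, hb m n h]
  one_mem' m n h := by simp
  add_mem' ha hb m n h := by simp [ha m n h, hb m n h]
  zero_mem' m n h := by simp
  neg_mem' ha m n h := by simp [ha m n h]

/-- `X` is `p`-torsion free if multiplication by `p` is injective on the structure sheaf. -/
def IsTorsionFree (X : PadicFormalScheme.{u} p) : Prop :=
  ∀ (U : X.Opens) (s : X.sections U), (p : X.sections U) * s = 0 → s = 0

end PadicFormalScheme

/-- `F` is the absolute Frobenius endomorphism of `X` (a scheme on which `p = 0`): the identity on
the underlying space and the map `s ↦ s ^ p` on sections. -/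
structure IsAbsoluteFrobenius (p : ℕ) {X : Scheme.{u}} (F : X ⟶ X) : Prop where
  apply_eq : ∀ x : X, F x = x
  appLE_eq : ∀ (U : X.Opens) (h : U ≤ F ⁻¹ᵁ U) (s : Γ(X, U)), F.appLE U U h s = s ^ p

/-- A formal `φ`-scheme: a `p`-torsion free `p`-adic formal scheme with an endomorphism `φ` lifting
the absolute Frobenius endomorphism of `X_1`. -/
structure FormalPhiScheme (p : ℕ) where
  /-- The underlying `p`-adic formal scheme. -/
  toFormal : PadicFormalScheme.{u} p
  torsionFree : toFormal.IsTorsionFree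
  /-- The Frobenius lifting. -/
  phi : toFormal ⟶ toFormal
  isAbsoluteFrobenius : IsAbsoluteFrobenius p (PadicFormalScheme.redMap phi 1)

namespace FormalPhiScheme

variable {p : ℕ}

/-- A morphism of formal `φ`-schemes: a morphism of formal schemes compatible with the Frobenius
liftings. -/
@[ext]
structure Hom (X Y : FormalPhiScheme.{u} p) where
  /-- The underlying morphism of formal schemes. -/
  toFormal : X.toFormal ⟶ Y.toFormal
  comm : X.phi ≫ toFormal = toFormal ≫ Y.phi

instance : Category (FormalPhiScheme.{u} p) where
  Hom := Hom
  id X := ⟨𝟙 _, by simp⟩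
  comp f g := ⟨f.toFormal ≫ g.toFormal, by
    rw [← Category.assoc, f.comm, Category.assoc, g.comm, Category.assoc]⟩
  id_comp f := Hom.ext (Category.id_comp f.toFormal)
  comp_id f := Hom.ext (Category.comp_id f.toFormal)
  assoc f g h := Hom.ext (Category.assoc f.toFormal g.toFormal h.toFormal)

/-- The closed subscheme `X_n` of `X` defined by `p ^ n`. -/
abbrev red (X : FormalPhiScheme.{u} p) (n : ℕ) : Scheme.{u} := X.toFormal.red n

/-- The restriction `X_n ⟶ X_n` of the Frobenius lifting. -/
abbrev phiRed (X : FormalPhiScheme.{u} p) (n : ℕ) : X.red n ⟶ X.red n :=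
  PadicFormalScheme.redMap X.phi n

/-- The morphism `X_n ⟶ Y_n` induced by a morphism `X ⟶ Y`. -/
abbrev redMap {X Y : FormalPhiScheme.{u} p} (f : X ⟶ Y) (n : ℕ) : X.red n ⟶ Y.red n :=
  PadicFormalScheme.redMap (Hom.toFormal f) n

variable {X Y : FormalPhiScheme.{u} p}

/-- A morphism is a closed immersion if it is so modulo every power of `p`. -/
def IsClosedImm (f : X ⟶ Y) : Prop := ∀ n : ℕ, IsClosedImmersion (redMap f n)

/-- A morphism (of `p`-torsion free formal schemes) is `p`-completely smooth if it is smooth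
modulo every power of `p`. -/
def IsPCompletelySmooth (f : X ⟶ Y) : Prop := ∀ n : ℕ, Smooth (redMap f n)

/-- A morphism (of `p`-torsion free formal schemes) is `p`-completely faithfully flat if it is
flat and surjective modulo every power of `p`. -/
def IsPCompletelyFaithfullyFlat (f : X ⟶ Y) : Prop :=
  ∀ n : ℕ, Flat (redMap f n) ∧ Surjective (redMap f n)

end FormalPhiScheme

/-! Locally, let `A`, `B`, `R`, `C` be the rings of sections of `T`, `Y`, `S`, `Z`, each with its
Frobenius lift `φ`, and let `c : A → C` be the surjection given by `Z`. Suppose a compatible map `B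
→ A / p ^ N` with `N > 0` is to be lifted to `A / p ^ (N + 1)`, with prescribed image in `C / p ^ (N
+ 1)`. Smoothness gives a lift `h₀`, but `h₀` need not commute with `φ`. Any two lifts differ by
elements of the ideal `K` of classes `p ^ N * x` with `c x ∈ p C`, which has square zero and is
killed by `p`. If `φ` maps `K` onto `K`, smoothness also gives a lift `h` with `φ ∘ h = h₀ ∘ φ`.
Since `φ b = b ^ p + p b'`, and two lifts agree on `p`-th powers and on multiples of `p`, we have
`h₀ ∘ φ = h ∘ φ`. So `h` commutes with `φ`. This is `exists_frob_compatible_lift`;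
`IsCompatibleMod.exists_succ` applies it, and induction on `N` does the rest.

Surjectivity of `φ` on `K` is obtained by a cover. Let `P` be the free `δ`-ring on the set `A` and
`P_∞` its colimit along Frobenius, and replace `A` by `A' = A ⊗_P P_∞`, where every element is a
Frobenius image. `C` is covered in the same way, but with variables only for those `a` with `c a ≠
0`. Modulo `p`, the kernel of `A' → C'` is then generated by the iterated roots of elements of `ker
c`, and these have roots of the same kind (`FrobCover.exists_root`). The cover is flat modulo `p ^
j`: modulo `p` the Frobenius of the polynomial ring `P` raises variables to the `p`-th power, so the
monomials with exponents below `p ^ m` form a basis over its `m`-th iterate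
(`FreeDelta.flat_perfection`). It is surjective on primes containing `p` because Frobenius is
invertible on an algebraically closed field of characteristic `p`.

Globally, the covers are disjoint unions of the `Spf A'` over an affine cover, so the local lifts
need not be glued. The rings `A'` need not be complete, but only their quotients by powers of `p`
matter, hence the weak torsion condition `TorsionFreeMod`. Affine opens of one reduction extend to
all reductions by `IsSmallThickening.isAffine`. The absolute statement is the relative one with `Z`
empty. -/

/-! ### Reduction of rings modulo an integer -/

/-- The quotient of a ring by an integer. -/
abbrev Quo (c : ℕ) (A : Type*) [CommRing A] := A ⧸ Ideal.span {(c : A)}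

section Quo

variable {A B C : Type*} [CommRing A] [CommRing B] [CommRing C]

lemma mem_span_natCast {c : ℕ} {a : A} : a ∈ Ideal.span {(c : A)} ↔ ∃ b, a = c * b := by
  rw [Ideal.mem_span_singleton]; rfl

lemma map_mem_span_natCast {c d : ℕ} (h : d ∣ c) (f : A →+* B) {a : A}
    (ha : a ∈ Ideal.span {(c : A)}) : f a ∈ Ideal.span {(d : B)} := by
  obtain ⟨e, rfl⟩ := h
  obtain ⟨b, rfl⟩ := mem_span_natCast.1 ha
  exact mem_span_natCast.2 ⟨e * f b, by push_cast [map_mul, map_natCast]; ring⟩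

/-- The homomorphism `A / c → B / d` induced by a homomorphism `A → B`, for `d ∣ c`. -/
def Quo.map {c d : ℕ} (h : d ∣ c) (f : A →+* B) : Quo c A →+* Quo d B :=
  Ideal.quotientMap _ f fun _ ha ↦ map_mem_span_natCast h f ha

@[simp] lemma Quo.map_mk {c d : ℕ} (h : d ∣ c) (f : A →+* B) (a : A) :
    Quo.map h f (Ideal.Quotient.mk _ a) = Ideal.Quotient.mk _ (f a) := rfl

lemma Quo.map_comp {c d e : ℕ} (h : d ∣ c) (h' : e ∣ d) (f : A →+* B) (g : B →+* C) :
    (Quo.map h' g).comp (Quo.map h f) = Quo.map (h'.trans h) (g.comp f) := by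
  ext; rfl

lemma Quo.map_id (c : ℕ) : Quo.map (dvd_refl c) (RingHom.id A) = RingHom.id (Quo c A) := by
  ext; rfl

lemma Quo.mk_eq_zero {c : ℕ} {a : A} :
    (Ideal.Quotient.mk (Ideal.span {(c : A)})) a = 0 ↔ ∃ b, a = c * b := by
  rw [Ideal.Quotient.eq_zero_iff_mem, mem_span_natCast]

lemma Quo.mk_eq_mk {c : ℕ} {a a' : A} :
    (Ideal.Quotient.mk (Ideal.span {(c : A)})) a = Ideal.Quotient.mk _ a' ↔
      ∃ b, a = a' + c * b := by
  rw [← sub_eq_zero, ← map_sub, Quo.mk_eq_zero]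
  simp only [sub_eq_iff_eq_add']

end Quo

/-! ### Lifts of the Frobenius endomorphism -/

/-- An endomorphism `φ` lifts the Frobenius endomorphism modulo `p`. -/
def IsFrobLift (p : ℕ) {A : Type*} [CommRing A] (φ : A →+* A) : Prop :=
  ∀ a, ∃ b, φ a = a ^ p + p * b

section FrobLift

variable {p : ℕ} {A B : Type*} [CommRing A] [CommRing B]

lemma exists_add_pow_prime (hp : p.Prime) (a b : A) :
    ∃ r, (a + b) ^ p = a ^ p + b ^ p + p * r := by
  obtain ⟨r, hr⟩ := exists_add_pow_prime_eq hp a b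
  exact ⟨a * b * r, by rw [hr]; ring⟩

/-- The elements at which `φ` is congruent to the `p`-th power. -/
def frobLiftSubring (hp : p.Prime) (φ : A →+* A) : Subring A where
  carrier := {a | ∃ b, φ a = a ^ p + p * b}
  mul_mem' := by
    rintro a a' ⟨b, hb⟩ ⟨b', hb'⟩
    exact ⟨a ^ p * b' + b * a' ^ p + p * b * b', by rw [map_mul, hb, hb']; ring⟩
  one_mem' := ⟨0, by simp⟩
  add_mem' := by
    rintro a a' ⟨b, hb⟩ ⟨b', hb'⟩
    obtain ⟨r, hr⟩ := exists_add_pow_prime hp a a'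
    exact ⟨b + b' - r, by rw [map_add, hb, hb', hr]; ring⟩
  zero_mem' := ⟨0, by simp [hp.ne_zero]⟩
  neg_mem' := by
    rintro a ⟨b, hb⟩
    obtain ⟨r, hr⟩ := exists_add_pow_prime hp a (-a)
    rw [add_neg_cancel, zero_pow hp.ne_zero] at hr
    refine ⟨r - b, ?_⟩
    rw [map_neg, hb]
    linear_combination hr

lemma mem_frobLiftSubring (hp : p.Prime) (φ : A →+* A) (a : A) :
    a ∈ frobLiftSubring hp φ ↔ ∃ b, φ a = a ^ p + p * b := Iff.rfl

end FrobLift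

/-! ### The colimit along an endomorphism -/

section EndoColim

variable {P P' : Type*} [CommRing P] [CommRing P']

/-- The colimit of `P → P → P → ⋯` along an endomorphism `ψ`. -/
abbrev EndoColim (ψ : P →+* P) : Type _ :=
  Ring.DirectLimit (fun _ : ℕ ↦ P) (fun i j (_ : i ≤ j) ↦ ((ψ ^ (j - i) : P →+* P) : P → P))

instance (ψ : P →+* P) : DirectedSystem (fun _ : ℕ ↦ P)
    (fun i j (_ : i ≤ j) ↦ ((ψ ^ (j - i) : P →+* P) : P → P)) where
  map_self := by simp
  map_map := by
    intro k j i hij hjk x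
    simp only [RingHom.coe_pow]
    rw [← Function.iterate_add_apply]
    congr 1; omega

namespace EndoColim

noncomputable section

variable (ψ : P →+* P)

/-- The map from the `m`-th term to the colimit. -/
def of (m : ℕ) : P →+* EndoColim ψ :=
  Ring.DirectLimit.of (fun _ : ℕ ↦ P)
    (fun i j (_ : i ≤ j) ↦ ((ψ ^ (j - i) : P →+* P) : P → P)) m

lemma of_add (m k : ℕ) (x : P) : of ψ (m + k) ((ψ ^ k) x) = of ψ m x := by
  have := Ring.DirectLimit.of_f (G := fun _ : ℕ ↦ P)
    (f := fun i j (_ : i ≤ j) ↦ ((ψ ^ (j - i) : P →+* P) : P → P)) (Nat.le_add_right m k) x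
  rw [Nat.add_sub_cancel_left] at this
  exact this

lemma of_succ (m : ℕ) (x : P) : of ψ (m + 1) (ψ x) = of ψ m x := by
  simpa using of_add ψ m 1 x

lemma exists_of (z : EndoColim ψ) : ∃ m x, of ψ m x = z := Ring.DirectLimit.exists_of z

lemma exists_of_le (z : EndoColim ψ) : ∃ m, ∀ n, m ≤ n → ∃ x, of ψ n x = z := by
  obtain ⟨m, x, rfl⟩ := exists_of ψ z
  refine ⟨m, fun n hn ↦ ⟨(ψ ^ (n - m)) x, ?_⟩⟩
  obtain ⟨k, rfl⟩ := Nat.exists_eq_add_of_le hn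
  simpa using of_add ψ m k x

lemma of_eq_zero {m : ℕ} {x : P} (h : of ψ m x = 0) : ∃ k, (ψ ^ k) x = 0 := by
  obtain ⟨j, hj, h⟩ := Ring.DirectLimit.of.zero_exact
    (G := fun _ : ℕ ↦ P) (f' := fun i j (_ : i ≤ j) ↦ (ψ ^ (j - i) : P →+* P)) h
  exact ⟨_, h⟩

variable {ψ} in
lemma hom_ext {f g : EndoColim ψ →+* P'} (h : ∀ m x, f (of ψ m x) = g (of ψ m x)) : f = g :=
  Ring.DirectLimit.hom_ext (P := P') fun m ↦ RingHom.ext (h m)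

/-- The universal property of the colimit. -/
def lift (g : ℕ → P →+* P') (h : ∀ m x, g (m + 1) (ψ x) = g m x) : EndoColim ψ →+* P' :=
  Ring.DirectLimit.lift _ _ _ g (by
    intro i j hij x
    obtain ⟨k, rfl⟩ := Nat.exists_eq_add_of_le hij
    rw [Nat.add_sub_cancel_left]
    clear hij
    induction k generalizing x with
    | zero => simp
    | succ k ih =>
      rw [RingHom.coe_pow, Function.iterate_succ_apply', ← add_assoc, h, ← RingHom.coe_pow]
      exact ih x)

@[simp] lemma lift_of (g : ℕ → P →+* P') (h : ∀ m x, g (m + 1) (ψ x) = g m x) (m : ℕ) (x : P) :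
    lift ψ g h (of ψ m x) = g m x :=
  Ring.DirectLimit.lift_of ..

/-- The automorphism of the colimit induced by `ψ`. -/
def shift : EndoColim ψ →+* EndoColim ψ :=
  lift ψ (fun m ↦ (of ψ m).comp ψ) fun m x ↦ by simp [of_succ]

@[simp] lemma shift_of (m : ℕ) (x : P) : shift ψ (of ψ m x) = of ψ m (ψ x) := by
  exact lift_of ..

lemma shift_of_succ (m : ℕ) (x : P) : shift ψ (of ψ (m + 1) x) = of ψ m x := by
  rw [shift_of, of_succ]

variable {ψ} in
/-- Functoriality of the colimit. -/
def map {ψ' : P' →+* P'} (κ : P →+* P') (h : ∀ x, κ (ψ x) = ψ' (κ x)) :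
    EndoColim ψ →+* EndoColim ψ' :=
  lift ψ (fun m ↦ (of ψ' m).comp κ) fun m x ↦ by simp [of_succ, h]

@[simp] lemma map_of {ψ' : P' →+* P'} (κ : P →+* P') (h : ∀ x, κ (ψ x) = ψ' (κ x)) (m : ℕ)
    (x : P) : map κ h (of ψ m x) = of ψ' m (κ x) := by
  exact lift_of ..

lemma isFrobLift_shift {p : ℕ} {ψ : P →+* P} (hψ : IsFrobLift p ψ) : IsFrobLift p (shift ψ) := by
  intro z
  obtain ⟨m, x, rfl⟩ := exists_of ψ z
  obtain ⟨y, hy⟩ := hψ x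
  exact ⟨of ψ m y, by rw [shift_of, hy]; simp⟩

end

end EndoColim

end EndoColim

/-! ### Flatness of Frobenius lifts of polynomial rings -/

section Polynomial

variable {σ : Type*} {p : ℕ}

/-- The linear combinations of the monomials with exponents below `q`, with coefficients taken
along an endomorphism `θ`. -/
noncomputable def monomialComb (q : ℕ) (θ : MvPolynomial σ ℤ →+* MvPolynomial σ ℤ) :
    ({e : σ →₀ ℕ // ∀ i, e i < q} →₀ MvPolynomial σ ℤ) →+ MvPolynomial σ ℤ :=
  Finsupp.liftAddHom fun e ↦
    (AddMonoidHom.mulRight (MvPolynomial.monomial e.1 (1 : ℤ))).comp θ.toAddMonoidHom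

lemma monomialComb_single (q : ℕ) (θ : MvPolynomial σ ℤ →+* MvPolynomial σ ℤ) (e) (c : MvPolynomial σ ℤ) :
    monomialComb q θ (Finsupp.single e c) = θ c * MvPolynomial.monomial e.1 (1 : ℤ) := by
  simp [monomialComb]

lemma monomialComb_apply (q : ℕ) (θ : MvPolynomial σ ℤ →+* MvPolynomial σ ℤ) (c) :
    monomialComb q θ c = c.sum fun e x ↦ θ x * MvPolynomial.monomial e.1 (1 : ℤ) := by
  rfl

lemma monomialComb_smul (q : ℕ) (θ : MvPolynomial σ ℤ →+* MvPolynomial σ ℤ) (f : MvPolynomial σ ℤ) (c) :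
    monomialComb q θ (f • c) = θ f * monomialComb q θ c := by
  induction c using Finsupp.induction_linear with
  | zero => simp
  | add a b ha hb => simp [smul_add, ha, hb, mul_add]
  | single e x => rw [Finsupp.smul_single, monomialComb_single, monomialComb_single]; simp [mul_assoc]

/-- Division with remainder by `q` in every exponent: a monomial is the `q`-expansion of its
quotient part times its remainder part. -/
lemma exists_monomialComb_expand {q : ℕ} (hq : 0 < q) (x : MvPolynomial σ ℤ) :
    ∃ c, monomialComb q (MvPolynomial.expand q : MvPolynomial σ ℤ →ₐ[ℤ] MvPolynomial σ ℤ).toRingHom c = x := by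
  induction x using MvPolynomial.induction_on' with
  | monomial u a =>
    refine ⟨Finsupp.single ⟨u.mapRange (· % q) (by simp), fun i ↦
      Nat.mod_lt (u i) hq⟩ (MvPolynomial.monomial (u.mapRange (· / q) (by simp)) a), ?_⟩
    rw [monomialComb_single]
    simp only [AlgHom.toRingHom_eq_coe, RingHom.coe_coe, MvPolynomial.expand_monomial,
      MvPolynomial.monomial_mul, mul_one]
    refine congrArg (fun w ↦ MvPolynomial.monomial w a) (Finsupp.ext fun i ↦ ?_)
    exact Nat.div_add_mod (u i) q
  | add f g hf hg =>
    obtain ⟨c, hc⟩ := hf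
    obtain ⟨d, hd⟩ := hg
    exact ⟨c + d, by rw [map_add, hc, hd]⟩

/-- Every exponent is uniquely of the form `q • u + e` with `e` below `q`, so contributions of
different `e` never meet. This is the linear independence of the monomials over `expand q`. -/
lemma coeff_monomialComb_expand {q : ℕ} (hq : 0 < q) (c)
    (e : {e : σ →₀ ℕ // ∀ i, e i < q}) (u : σ →₀ ℕ) :
    (monomialComb q (MvPolynomial.expand q : MvPolynomial σ ℤ →ₐ[ℤ] MvPolynomial σ ℤ).toRingHom c).coeff (q • u + e.1) =
      (c e).coeff u := by
  classical
  induction c using Finsupp.induction_linear with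
  | zero => simp
  | add a b ha hb => rw [map_add, MvPolynomial.coeff_add, ha, hb]; rfl
  | single e' x =>
    rw [monomialComb_single, MvPolynomial.coeff_mul_monomial', mul_one]
    by_cases h : e' = e
    · subst h
      simp [MvPolynomial.coeff_expand_smul _ hq.ne']
    · rw [Finsupp.single_eq_of_ne (Ne.symm h), MvPolynomial.coeff_zero]
      split_ifs with hle
      · obtain ⟨i, hi⟩ : ∃ i, e'.1 i ≠ e.1 i := by
          by_contra! hall
          exact h (Subtype.ext (Finsupp.ext hall))
        refine MvPolynomial.coeff_expand_of_not_dvd (i := i) _ fun hd ↦ hi ?_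
        have h1 := hle i
        have h2 := e'.2 i
        have h3 := e.2 i
        simp only [Finsupp.coe_tsub, Finsupp.coe_add, Finsupp.coe_smul, Pi.sub_apply, Pi.add_apply,
          Pi.smul_apply, smul_eq_mul] at hd h1
        obtain ⟨k, hk⟩ := hd
        have h4 : q * u i + e.1 i = q * k + e'.1 i := by omega
        have h5 := congrArg (· % q) h4
        simpa [Nat.mod_eq_of_lt h2, Nat.mod_eq_of_lt h3] using h5.symm
      · rfl

variable {q : ℕ} {θ : MvPolynomial σ ℤ →+* MvPolynomial σ ℤ}

lemma monomialComb_congr (hθ : ∀ f, ∃ g, θ f = MvPolynomial.expand q f + p * g) (c) :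
    ∃ g, monomialComb q θ c =
      monomialComb q (MvPolynomial.expand q : MvPolynomial σ ℤ →ₐ[ℤ] MvPolynomial σ ℤ).toRingHom c + p * g := by
  induction c using Finsupp.induction_linear with
  | zero => exact ⟨0, by simp only [map_zero, mul_zero, add_zero]⟩
  | add a b ha hb =>
    obtain ⟨g, hg⟩ := ha
    obtain ⟨h, hh⟩ := hb
    exact ⟨g + h, by rw [map_add, map_add, hg, hh]; ring⟩
  | single e x =>
    obtain ⟨g, hg⟩ := hθ x
    refine ⟨g * MvPolynomial.monomial e.1 1, ?_⟩
    rw [monomialComb_single, monomialComb_single, hg]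
    simp only [AlgHom.toRingHom_eq_coe, RingHom.coe_coe]
    ring

/-- Successive approximation: the error `p ^ j * g` is expanded again along `expand q`, and the
integer `p ^ j`, fixed by `θ`, is absorbed in the coefficients. The new error is divisible by `p ^
(j + 1)` since `θ` and `expand q` agree modulo `p`. -/
lemma exists_monomialComb_sub (hq : 0 < q)
    (hθ : ∀ f, ∃ g, θ f = MvPolynomial.expand q f + p * g) (j : ℕ) (x : MvPolynomial σ ℤ) :
    ∃ c g, x = monomialComb q θ c + (p ^ j : ℕ) * g := by
  induction j with
  | zero => exact ⟨0, x, by simp only [map_zero, pow_zero, Nat.cast_one, one_mul, zero_add]⟩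
  | succ j ih =>
    obtain ⟨c, g, hg⟩ := ih
    obtain ⟨d, hd⟩ := exists_monomialComb_expand hq g
    obtain ⟨h, hh⟩ := monomialComb_congr hθ d
    refine ⟨c + ((p ^ j : ℕ) : MvPolynomial σ ℤ) • d, -h, ?_⟩
    rw [map_add, monomialComb_smul, hh, hd, hg, map_natCast]
    push_cast
    ring

/-- Linear independence modulo `p ^ j` of the small monomials over `θ`. Modulo `p` one compares
coefficients with `expand q`; then the relation is divided by `p`, which is injective on integral
polynomials, and the argument repeats. -/
lemma dvd_of_dvd_monomialComb (hp : p.Prime) (hq : 0 < q)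
    (hθ : ∀ f, ∃ g, θ f = MvPolynomial.expand q f + p * g) (j : ℕ) (c)
    (h : ((p ^ j : ℕ) : MvPolynomial σ ℤ) ∣ monomialComb q θ c) (e) : ((p ^ j : ℕ) : MvPolynomial σ ℤ) ∣ c e := by
  classical
  have base (c) (h : (p : MvPolynomial σ ℤ) ∣ monomialComb q θ c) (e) : (p : MvPolynomial σ ℤ) ∣ c e := by
    obtain ⟨g, hg⟩ := monomialComb_congr hθ c
    rw [hg, dvd_add_left (Dvd.intro _ rfl)] at h
    have hC : (p : MvPolynomial σ ℤ) = MvPolynomial.C (p : ℤ) := by simp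
    rw [hC, MvPolynomial.C_dvd_iff_dvd_coeff] at h ⊢
    intro u
    rw [← coeff_monomialComb_expand hq]
    exact h _
  induction j generalizing c with
  | zero => simp
  | succ j ih =>
    have h1 : ∀ e, (p : MvPolynomial σ ℤ) ∣ c e := base c ((Dvd.intro _ (by push_cast; rw [pow_succ'])).trans h)
    choose d hd using h1
    have h0 : (p : MvPolynomial σ ℤ) ≠ 0 := by exact_mod_cast hp.ne_zero
    -- The quotient of `c` by `p` must be finitely supported, so division is a function on
    -- coefficients, with value `0` off the multiples of `p`. It sends `0` to `0` because `p ≠ 0`.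
    let d' := c.mapRange (fun x : MvPolynomial σ ℤ ↦ if h : ∃ y, x = p * y then h.choose else 0) (by
      have hex : ∃ y : MvPolynomial σ ℤ, (0 : MvPolynomial σ ℤ) = p * y := ⟨0, by simp⟩
      rw [dif_pos hex]
      have := hex.choose_spec
      exact (mul_eq_zero.1 this.symm).resolve_left h0)
    have hcd : c = (p : MvPolynomial σ ℤ) • d' := by
      ext1 e
      have hex : ∃ y : MvPolynomial σ ℤ, c e = p * y := ⟨_, hd e⟩
      simp only [Finsupp.smul_apply, smul_eq_mul, d', Finsupp.mapRange_apply, dif_pos hex]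
      exact hex.choose_spec
    rw [hcd] at h ⊢
    rw [monomialComb_smul, map_natCast, pow_succ', Nat.cast_mul] at h
    rw [pow_succ', Nat.cast_mul, Finsupp.smul_apply, smul_eq_mul]
    exact mul_dvd_mul_left _ (ih d' ((mul_dvd_mul_iff_left h0).1 h))

end Polynomial

/-! ### Flatness of the perfection of a free `δ`-ring -/

section FreeDelta

lemma EndoColim.of_pow {P : Type*} [CommRing P] (ψ : P →+* P) (m : ℕ) (x : P) :
    EndoColim.of ψ m ((ψ ^ m) x) = EndoColim.of ψ 0 x := by
  have h (k) (hk : k = m) : EndoColim.of ψ k ((ψ ^ m) x) = EndoColim.of ψ 0 x := by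
    subst hk
    have := EndoColim.of_add ψ 0 k x
    rwa [zero_add] at this
  exact h m rfl

/-- The free `δ`-ring on a set `Λ`, a polynomial ring in variables `δ ^ k x_l`. -/
abbrev FreeDelta (Λ : Type u) : Type u := MvPolynomial (Λ × ℕ) ℤ

namespace FreeDelta

noncomputable section

variable (p : ℕ) (Λ : Type u)

/-- The Frobenius lift of the free `δ`-ring. -/
def frob : FreeDelta Λ →+* FreeDelta Λ :=
  (MvPolynomial.aeval fun i : Λ × ℕ ↦
    (MvPolynomial.X i ^ p + (p : FreeDelta Λ) * MvPolynomial.X (i.1, i.2 + 1))).toRingHom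

@[simp] lemma frob_X (l : Λ) (k : ℕ) : frob p Λ (MvPolynomial.X (l, k)) =
    MvPolynomial.X (l, k) ^ p + (p : FreeDelta Λ) * MvPolynomial.X (l, k + 1) := by
  simp [frob]

variable {p Λ}

lemma isFrobLift_frob (hp : p.Prime) : IsFrobLift p (frob p Λ) := by
  intro f
  rw [← mem_frobLiftSubring hp]
  induction f using MvPolynomial.induction_on with
  | C a => exact intCast_mem _ a
  | add f g hf hg => exact add_mem hf hg
  | mul_X f i hf => exact mul_mem hf ⟨_, frob_X p Λ i.1 i.2⟩

/-- Modulo `p` both sides are ring homomorphisms sending each variable to its `p`-th power. -/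
lemma exists_frob_eq_expand (f : FreeDelta Λ) :
    ∃ g, frob p Λ f = MvPolynomial.expand p f + p * g := by
  rw [← Quo.mk_eq_mk]
  refine RingHom.congr_fun (f := (Ideal.Quotient.mk _).comp (frob p Λ))
    (g := (Ideal.Quotient.mk (Ideal.span {(p : FreeDelta Λ)})).comp
      (MvPolynomial.expand p : FreeDelta Λ →ₐ[ℤ] FreeDelta Λ).toRingHom) ?_ f
  refine MvPolynomial.ringHom_ext (fun r ↦ by simp [frob]) fun i ↦ ?_
  exact Quo.mk_eq_mk.2 ⟨MvPolynomial.X (i.1, i.2 + 1), by simp [frob]⟩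

lemma exists_frob_pow_eq_expand (m : ℕ) (f : FreeDelta Λ) :
    ∃ g, (frob p Λ ^ m) f = MvPolynomial.expand (p ^ m) f + p * g := by
  induction m with
  | zero => exact ⟨0, by simp⟩
  | succ m ih =>
    obtain ⟨g, hg⟩ := ih
    obtain ⟨h, hh⟩ := exists_frob_eq_expand (p := p) (MvPolynomial.expand (p ^ m) f)
    refine ⟨h + frob p Λ g, ?_⟩
    rw [RingHom.coe_pow, Function.iterate_succ_apply', ← RingHom.coe_pow, hg, map_add, hh, map_mul,
      map_natCast, pow_succ', MvPolynomial.expand_mul_eq_comp, AlgHom.comp_apply]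
    ring

/-- An element of the kernel gives a relation with the single monomial `1`, which is divisible by
every `p ^ i`. By independence the element itself is divisible by every `p ^ i`, so its integer
coefficients vanish. -/
lemma frob_pow_injective (hp : p.Prime) (k : ℕ) : Function.Injective (frob p Λ ^ k) := by
  rw [injective_iff_map_eq_zero]
  intro g hg
  have hg' : ∀ i, ((p ^ i : ℕ) : FreeDelta Λ) ∣ g := by
    intro i
    have := dvd_of_dvd_monomialComb hp (pow_pos hp.pos k) (exists_frob_pow_eq_expand k) i
      (Finsupp.single ⟨0, fun i ↦ pow_pos hp.pos k⟩ g)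
      (by rw [monomialComb_single, hg]; simp) ⟨0, fun i ↦ pow_pos hp.pos k⟩
    simpa using this
  ext u
  rw [MvPolynomial.coeff_zero]
  have hd : ∀ i, (p : ℤ) ^ i ∣ g.coeff u := by
    intro i
    have hC : ((p ^ i : ℕ) : FreeDelta Λ) = MvPolynomial.C ((p : ℤ) ^ i) := by simp
    have := hg' i
    rw [hC, MvPolynomial.C_dvd_iff_dvd_coeff] at this
    exact this u
  by_contra hne
  -- The exponent is taken to be the absolute value of the coefficient, which is already smaller
  -- than the corresponding power of `p`.
  have := Int.le_of_dvd (abs_pos.2 hne) ((dvd_abs _ _).2 (hd (g.coeff u).natAbs))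
  have h2 := Nat.lt_pow_self hp.one_lt (n := (g.coeff u).natAbs)
  rw [Int.abs_eq_natAbs] at this
  norm_cast at this
  omega

/-- By the equational criterion. A relation involves finitely many elements, hence lives at a finite
stage `M`, where the base acts through the `M`-th iterate of Frobenius. There the ring is free
modulo `p ^ j` on the monomials with exponents below `p ^ M`, and expanding along them trivializes
the relation. -/
lemma flat_perfection (hp : p.Prime) (j : ℕ) :
    (Quo.map (dvd_refl (p ^ j)) (EndoColim.of (frob p Λ) 0)).Flat := by
  let α := EndoColim.of (frob p Λ)
  algebraize [Quo.map (dvd_refl (p ^ j)) (α 0)]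
  change Module.Flat _ _
  refine Module.Flat.of_forall_isTrivialRelation fun {l f x} h ↦ ?_
  choose f' hf' using fun i ↦ Ideal.Quotient.mk_surjective (f i)
  choose x' hx' using fun i ↦ Ideal.Quotient.mk_surjective (x i)
  choose n hn using fun i ↦ EndoColim.exists_of_le _ (x' i)
  obtain ⟨w, hw⟩ : ∃ w, ∑ i, α 0 (f' i) * x' i = (p ^ j : ℕ) * w := by
    rw [← Quo.mk_eq_zero, ← h, map_sum]
    refine Finset.sum_congr rfl fun i _ ↦ ?_
    rw [map_mul, hx', Algebra.smul_def, ← hf']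
    rfl
  obtain ⟨n', hn'⟩ := EndoColim.exists_of_le _ w
  let M := max n' (Finset.univ.sup n)
  choose y hy using fun i ↦ hn i M ((Finset.le_sup (Finset.mem_univ i)).trans (le_max_right _ _))
  obtain ⟨w', rfl⟩ := hn' M (le_max_left _ _)
  have h1 : α M (∑ i, (frob p Λ ^ M) (f' i) * y i - (p ^ j : ℕ) * w') = 0 := by
    rw [map_sub, map_mul, map_natCast, sub_eq_zero, ← hw, map_sum]
    refine Finset.sum_congr rfl fun i _ ↦ ?_
    rw [map_mul, ← hy]
    exact congrArg₂ (· * ·) (EndoColim.of_pow (frob p Λ) M (f' i)) rfl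
  -- Vanishing in the colimit only means vanishing after further Frobenius iterates; injectivity of
  -- these brings the relation back to stage `M`.
  obtain ⟨k, hk⟩ := EndoColim.of_eq_zero _ h1
  have h2 := frob_pow_injective hp k (hk.trans (map_zero _).symm)
  have hq := pow_pos hp.pos M
  have hθ := exists_frob_pow_eq_expand (p := p) (Λ := Λ) M
  choose c g hcg using fun i ↦ exists_monomialComb_sub hq hθ j (y i)
  have h3 : ((p ^ j : ℕ) : FreeDelta Λ) ∣
      monomialComb (p ^ M) (frob p Λ ^ M) (∑ i, f' i • c i) := by
    rw [map_sum]
    refine ⟨w' - ∑ i, (frob p Λ ^ M) (f' i) * g i, ?_⟩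
    rw [mul_sub, Finset.mul_sum, ← sub_eq_zero.1 h2, ← Finset.sum_sub_distrib]
    refine Finset.sum_congr rfl fun i _ ↦ ?_
    rw [monomialComb_smul]
    conv_rhs => rw [hcg i]
    ring
  have h4 := dvd_of_dvd_monomialComb hp hq hθ j _ h3
  classical
  -- All monomials occurring in any of the expansions. They are the new elements of the trivialized
  -- relation, and the `c i` supply its coefficient matrix.
  let s := Finset.univ.biUnion fun i ↦ (c i).support
  let e := s.equivFin
  refine ⟨s.card, fun i t ↦ Ideal.Quotient.mk _ (c i (e.symm t)),
    fun t ↦ Ideal.Quotient.mk _ (α M (MvPolynomial.monomial (e.symm t).1.1 1)), fun i ↦ ?_,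
    fun t ↦ ?_⟩
  · have h5 : y i = ∑ t : s, (frob p Λ ^ M) (c i t) * MvPolynomial.monomial t.1.1 1 +
        (p ^ j : ℕ) * g i := by
      rw [hcg i, monomialComb_apply, Finsupp.sum_of_support_subset (s := s)]
      · rw [← Finset.sum_coe_sort s
          fun t ↦ (frob p Λ ^ M) (c i t) * MvPolynomial.monomial t.1 (1 : ℤ)]
      · exact Finset.subset_biUnion_of_mem (fun i ↦ (c i).support) (Finset.mem_univ i)
      · simp
    rw [← hx', ← hy, h5, map_add, map_add, map_sum, map_sum,
      (Quo.mk_eq_zero (c := p ^ j)).2 ⟨α M (g i), by rw [map_mul, map_natCast]⟩, add_zero, ← e.symm.sum_comp]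
    refine Finset.sum_congr rfl fun t _ ↦ ?_
    rw [map_mul, map_mul, Algebra.smul_def]
    exact congrArg₂ (· * ·) (congrArg _ (EndoColim.of_pow (frob p Λ) M (c i (e.symm t)))) rfl
  · have h5 := h4 (e.symm t)
    simp only [Finsupp.coe_finsetSum, Finset.sum_apply, Finsupp.smul_apply, smul_eq_mul] at h5
    simp only [← hf', ← map_mul, ← map_sum]
    exact Quo.mk_eq_zero.2 h5

end

end FreeDelta

end FreeDelta

/-! ### Base change and flatness modulo powers of `p` -/

section BaseChange

/-- A map out of `B` which agrees on `A` with a map out of `A / c` kills `c`, because `c` comes from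
`A`. -/
lemma isPushout_quo {A B : Type u} [CommRing A] [CommRing B] (c : ℕ) (f : A →+* B) :
    IsPushout (CommRingCat.ofHom f) (CommRingCat.ofHom (Ideal.Quotient.mk (Ideal.span {(c : A)})))
      (CommRingCat.ofHom (Ideal.Quotient.mk (Ideal.span {(c : B)})))
      (CommRingCat.ofHom (Quo.map (dvd_refl c) f)) := by
  refine IsPushout.of_isColimit' ⟨rfl⟩ (Limits.PushoutCocone.IsColimit.mk _
    (fun s ↦ CommRingCat.ofHom (Ideal.Quotient.lift _ s.inl.hom fun b hb ↦ ?_))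
    (fun s ↦ ?_) (fun s ↦ ?_) (fun s m h₁ _ ↦ ?_))
  · obtain ⟨b, rfl⟩ := mem_span_natCast.1 hb
    have h := congrArg (fun g ↦ g.hom (c : A)) s.condition
    have h0 : (Ideal.Quotient.mk (Ideal.span {(c : A)})) c = 0 := Quo.mk_eq_zero.2 ⟨1, by simp⟩
    simp only [CommRingCat.hom_comp, RingHom.comp_apply, CommRingCat.hom_ofHom, h0, map_zero] at h
    rw [map_mul, ← map_natCast f, h, zero_mul]
  · ext; rfl
  · ext x
    exact congrArg (fun g ↦ g.hom x) s.condition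
  · ext x
    exact congrArg (fun g ↦ g.hom x) h₁

lemma RingHom.Flat.of_isPushout {P A Q W : CommRingCat.{u}} {f : P ⟶ A} {g : P ⟶ Q} {l : A ⟶ W}
    {r : Q ⟶ W} (h : IsPushout f g l r) (hg : g.hom.Flat) : l.hom.Flat := by
  algebraize [f.hom, g.hom, l.hom, r.hom, l.hom.comp f.hom]
  have : IsScalarTower P Q W := .of_algebraMap_eq fun x ↦ congrArg (fun g ↦ g.hom x) h.w
  have : Algebra.IsPushout P Q A W := CommRingCat.isPushout_iff_isPushout.1 h.flip
  exact RingHom.Flat.isStableUnderBaseChange P Q A W hg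

/-- Pasting with the reduction square of `l` and cancelling that of `g` exhibits `l` modulo `c` as a
base change of `g` modulo `c`. -/
lemma flat_quo_of_isPushout {P A Q W : CommRingCat.{u}} {f : P ⟶ A} {g : P ⟶ Q} {l : A ⟶ W}
    {r : Q ⟶ W} (h : IsPushout f g l r) (c : ℕ) (hg : (Quo.map (dvd_refl c) g.hom).Flat) :
    (Quo.map (dvd_refl c) l.hom).Flat := by
  have h1 := h.flip.paste_vert (isPushout_quo c l.hom)
  have h2 := IsPushout.of_top (v₂₁ := CommRingCat.ofHom (Quo.map (dvd_refl c) f.hom))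
    (v₂₂ := CommRingCat.ofHom (Quo.map (dvd_refl c) r.hom))
    (h₃₁ := CommRingCat.ofHom (Quo.map (dvd_refl c) l.hom)) ?_ ?_ (isPushout_quo c g.hom)
  · exact RingHom.Flat.of_isPushout h2.flip hg
  · exact h1
  · ext x
    exact congrArg (fun g ↦ Ideal.Quotient.mk (Ideal.span {(c : W)}) (g.hom x)) h.w.symm

lemma RingHom.Flat.exists_of_mul_eq_zero {R N : Type*} [CommRing R] [CommRing N] {f : R →+* N}
    (hf : f.Flat) {r : R} {x : N} (h : f r * x = 0) :
    ∃ (k : ℕ) (a : Fin k → R) (z : Fin k → N), x = ∑ j, f (a j) * z j ∧ ∀ j, r * a j = 0 := by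
  let _ := f.toAlgebra
  have _ : Module.Flat R N := hf
  have hrel : ∑ i : Fin 1, (fun _ ↦ r) i • (fun _ ↦ x) i = 0 := by
    rw [Fin.sum_univ_one, Algebra.smul_def]
    exact h
  obtain ⟨k, a, z, h1, h2⟩ :=
    Module.Flat.isTrivialRelation_of_sum_smul_eq_zero (ι := Fin 1) (f := fun _ ↦ r) hrel
  refine ⟨k, a 0, z, ?_, fun j ↦ ?_⟩
  · exact (h1 0).trans (Finset.sum_congr rfl fun j _ ↦ Algebra.smul_def _ _)
  · have := h2 j
    rwa [Fin.sum_univ_one] at this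

/-- A form of `p`-torsion freeness which only depends on the quotients by the powers of `p`. -/
def TorsionFreeMod (p : ℕ) (A : Type*) [CommRing A] : Prop :=
  ∀ (m : ℕ) (x y : A), p * x = p ^ (m + 1) * y → ∃ z, x = p ^ m * z

/-- The relation `p * x = 0` in `B / p ^ (m + 1)` is trivial by flatness: `x` is a combination of
images of elements of `A / p ^ (m + 1)` killed by `p`, and these are multiples of `p ^ m`. Lifting
to `B` adds a multiple of `p ^ (m + 1)`, which is harmless. -/
lemma TorsionFreeMod.of_flat {p : ℕ} {A B : Type*} [CommRing A] [CommRing B] (f : A →+* B)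
    (hf : ∀ j, (Quo.map (dvd_refl (p ^ j)) f).Flat) (hA : TorsionFreeMod p A) :
    TorsionFreeMod p B := by
  intro m x y h
  have h0 : Quo.map (dvd_refl (p ^ (m + 1))) f (Ideal.Quotient.mk _ (p : A)) *
      Ideal.Quotient.mk _ x = 0 := by
    rw [Quo.map_mk, ← map_mul, Quo.mk_eq_zero]
    exact ⟨y, by rw [map_natCast, h]; push_cast; rfl⟩
  obtain ⟨k, a, z, h4, h2⟩ := (hf (m + 1)).exists_of_mul_eq_zero h0
  choose a' ha' using fun j ↦ Ideal.Quotient.mk_surjective (a j)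
  choose z' hz' using fun j ↦ Ideal.Quotient.mk_surjective (z j)
  have h3 : ∀ j, ∃ b, a' j = p ^ m * b := by
    intro j
    have := h2 j
    rw [← ha', ← map_mul, Quo.mk_eq_zero] at this
    obtain ⟨b, hb⟩ := this
    exact hA m _ b (by rw [hb]; push_cast; rfl)
  choose b hb using h3
  have h5 : (∑ j, Quo.map (dvd_refl (p ^ (m + 1))) f (a j) * z j) =
      Ideal.Quotient.mk _ (∑ j, f (a' j) * z' j) := by
    rw [map_sum]
    refine Finset.sum_congr rfl fun j _ ↦ ?_
    rw [← ha', ← hz', map_mul, Quo.map_mk]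
  rw [h5, Quo.mk_eq_mk] at h4
  obtain ⟨w, hw⟩ := h4
  refine ⟨∑ j, f (b j) * z' j + p * w, ?_⟩
  rw [hw, mul_add, Finset.mul_sum]
  congr 1
  · refine Finset.sum_congr rfl fun j _ ↦ ?_
    rw [hb, map_mul, map_pow, map_natCast, mul_assoc]
  · push_cast; ring

end BaseChange

/-! ### Adjoining Frobenius roots -/

section Delta

variable {p : ℕ} {A : Type*} [CommRing A] {φ : A →+* A}

/-- The `p`-derivation associated with a Frobenius lift. -/
noncomputable def IsFrobLift.delta (hφ : IsFrobLift p φ) (a : A) : A := (hφ a).choose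

lemma IsFrobLift.frob_eq (hφ : IsFrobLift p φ) (a : A) : φ a = a ^ p + p * hφ.delta a :=
  (hφ a).choose_spec

/-- When `p` is a nonzerodivisor in the target, `p * δ x = φ x - x ^ p` determines `δ x` there, so
the arbitrary choices in `delta` cannot disagree. -/
lemma IsFrobLift.map_delta {C : Type*} [CommRing C] {φ' : C →+* C} (hφ : IsFrobLift p φ)
    (hφ' : IsFrobLift p φ') (hC : ∀ x : C, p * x = 0 → x = 0) (c : A →+* C)
    (hc : ∀ a, c (φ a) = φ' (c a)) (a : A) : c (hφ.delta a) = hφ'.delta (c a) := by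
  rw [← sub_eq_zero]
  refine hC _ ?_
  have h := hc a
  rw [hφ.frob_eq, hφ'.frob_eq, map_add, map_mul, map_pow, map_natCast] at h
  linear_combination h

lemma IsFrobLift.map_iterate_delta {C : Type*} [CommRing C] {φ' : C →+* C} (hφ : IsFrobLift p φ)
    (hφ' : IsFrobLift p φ') (hC : ∀ x : C, p * x = 0 → x = 0) (c : A →+* C)
    (hc : ∀ a, c (φ a) = φ' (c a)) (k : ℕ) (a : A) :
    c (hφ.delta^[k] a) = hφ'.delta^[k] (c a) := by
  induction k generalizing a with
  | zero => rfl
  | succ k ih =>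
    rw [Function.iterate_succ_apply, Function.iterate_succ_apply, ih,
      hφ.map_delta hφ' hC c hc]

lemma IsFrobLift.iterate_delta_zero (hp : p.Prime) (hφ : IsFrobLift p φ)
    (hA : ∀ x : A, p * x = 0 → x = 0) (k : ℕ) : hφ.delta^[k] 0 = 0 := by
  have h0 : hφ.delta 0 = 0 := by
    refine hA _ ?_
    have := hφ.frob_eq 0
    rw [map_zero, zero_pow hp.ne_zero, zero_add] at this
    exact this.symm
  induction k with
  | zero => rfl
  | succ k ih => rw [Function.iterate_succ_apply, h0, ih]

/-- The map from the free `δ`-ring determined by a family of elements. -/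
noncomputable def IsFrobLift.eval (hφ : IsFrobLift p φ) {Λ : Type*} (a : Λ → A) :
    MvPolynomial (Λ × ℕ) ℤ →+* A :=
  (MvPolynomial.aeval fun i : Λ × ℕ ↦ hφ.delta^[i.2] (a i.1)).toRingHom

@[simp] lemma IsFrobLift.eval_X (hφ : IsFrobLift p φ) {Λ : Type*} (a : Λ → A) (i : Λ × ℕ) :
    hφ.eval a (MvPolynomial.X i) = hφ.delta^[i.2] (a i.1) := by
  simp [eval]

lemma IsFrobLift.eval_frob (hφ : IsFrobLift p φ) {Λ : Type u} (a : Λ → A) (x : FreeDelta Λ) :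
    hφ.eval a (FreeDelta.frob p Λ x) = φ (hφ.eval a x) := by
  refine RingHom.congr_fun (f := (hφ.eval a).comp (FreeDelta.frob p Λ))
    (g := φ.comp (hφ.eval a)) ?_ x
  refine MvPolynomial.ringHom_ext (fun r ↦ by simp) fun ⟨l, k⟩ ↦ ?_
  rw [RingHom.comp_apply, FreeDelta.frob_X, RingHom.comp_apply, map_add, map_mul, map_pow,
    map_natCast, hφ.eval_X, hφ.eval_X, hφ.frob_eq, Function.iterate_succ_apply']

end Delta

namespace FrobCover

noncomputable section

variable {p : ℕ} {A : Type u} [CommRing A] {φ : A →+* A} (hφ : IsFrobLift p φ) {Λ : Type u}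
  (a : Λ → A)

/-- The ring obtained from `A` by adjoining iterated preimages under the Frobenius lift of the
elements `a l`. -/
def ring : CommRingCat.{u} :=
  Limits.pushout (CommRingCat.ofHom (hφ.eval a))
    (CommRingCat.ofHom (EndoColim.of (FreeDelta.frob p Λ) 0))

/-- The structure map. -/
def inl : A →+* ring hφ a :=
  (Limits.pushout.inl (CommRingCat.ofHom (hφ.eval a))
    (CommRingCat.ofHom (EndoColim.of (FreeDelta.frob p Λ) 0))).hom

/-- The map from the perfection of the free `δ`-ring. -/
def inr : EndoColim (FreeDelta.frob p Λ) →+* ring hφ a :=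
  (Limits.pushout.inr (CommRingCat.ofHom (hφ.eval a))
    (CommRingCat.ofHom (EndoColim.of (FreeDelta.frob p Λ) 0))).hom

lemma isPushout : IsPushout (CommRingCat.ofHom (hφ.eval a))
    (CommRingCat.ofHom (EndoColim.of (FreeDelta.frob p Λ) 0))
    (CommRingCat.ofHom (inl hφ a)) (CommRingCat.ofHom (inr hφ a)) :=
  IsPushout.of_hasPushout _ _

lemma inl_eval (x) : inl hφ a (hφ.eval a x) = inr hφ a (EndoColim.of _ 0 x) :=
  congrArg (fun g ↦ g.hom x) (isPushout hφ a).w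

variable {K : Type u} [CommRing K]

/-- The universal property. -/
def lift (f : A →+* K) (g : EndoColim (FreeDelta.frob p Λ) →+* K)
    (h : ∀ x, f (hφ.eval a x) = g (EndoColim.of _ 0 x)) : ring hφ a →+* K :=
  ((isPushout hφ a).desc (CommRingCat.ofHom f) (CommRingCat.ofHom g) (by ext1; exact RingHom.ext h)).hom

@[simp] lemma lift_inl (f : A →+* K) (g : EndoColim (FreeDelta.frob p Λ) →+* K) (h) (x : A) :
    lift hφ a f g h (inl hφ a x) = f x :=
  congrArg (fun g ↦ g.hom x) ((isPushout hφ a).inl_desc (CommRingCat.ofHom f) (CommRingCat.ofHom g)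
    (by ext1; exact RingHom.ext h))

@[simp] lemma lift_inr (f : A →+* K) (g : EndoColim (FreeDelta.frob p Λ) →+* K) (h) (x) :
    lift hφ a f g h (inr hφ a x) = g x :=
  congrArg (fun g ↦ g.hom x) ((isPushout hφ a).inr_desc (CommRingCat.ofHom f) (CommRingCat.ofHom g)
    (by ext1; exact RingHom.ext h))

variable {hφ a} in
lemma hom_ext {f g : ring hφ a →+* K} (h₁ : ∀ x, f (inl hφ a x) = g (inl hφ a x))
    (h₂ : ∀ m x, f (inr hφ a (EndoColim.of _ m x)) = g (inr hφ a (EndoColim.of _ m x))) :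
    f = g := by
  have : CommRingCat.ofHom f = CommRingCat.ofHom g := by
    refine (isPushout hφ a).hom_ext (by ext x; exact h₁ x) ?_
    ext1
    exact EndoColim.hom_ext h₂
  exact congrArg CommRingCat.Hom.hom this

/-- The universal property gives a map to `S` whose composite with the inclusion is the identity.
This serves as an induction principle: subring properties are checked on the two kinds of
generators. -/
lemma eq_top_of_mem (S : Subring (ring hφ a)) (h₁ : ∀ x, inl hφ a x ∈ S)
    (h₂ : ∀ m x, inr hφ a (EndoColim.of _ m x) ∈ S) : S = ⊤ := by
  have h₃ : ∀ z, inr hφ a z ∈ S := by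
    intro z
    obtain ⟨m, x, rfl⟩ := EndoColim.exists_of _ z
    exact h₂ m x
  let d : ring hφ a →+* S := lift hφ a ((inl hφ a).codRestrict S h₁) ((inr hφ a).codRestrict S h₃)
    fun x ↦ Subtype.ext (inl_eval hφ a x)
  have hd : S.subtype.comp d = RingHom.id _ := hom_ext
    (fun x ↦ by simp only [RingHom.comp_apply, d, lift_inl]; rfl)
    (fun m x ↦ by simp only [RingHom.comp_apply, d, lift_inr]; rfl)
  rw [eq_top_iff]
  intro x _
  have := RingHom.congr_fun hd x
  rw [RingHom.id_apply] at this
  rw [← this]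
  exact (d x).2

/-- The Frobenius lift. -/
def frob : ring hφ a →+* ring hφ a :=
  lift hφ a ((inl hφ a).comp φ) ((inr hφ a).comp (EndoColim.shift _)) fun x ↦ by
    rw [RingHom.comp_apply, RingHom.comp_apply, ← hφ.eval_frob, inl_eval, EndoColim.shift_of]

@[simp] lemma frob_inl (x : A) : frob hφ a (inl hφ a x) = inl hφ a (φ x) := lift_inl ..

@[simp] lemma frob_inr (x) : frob hφ a (inr hφ a x) = inr hφ a (EndoColim.shift _ x) := lift_inr ..

lemma isFrobLift_frob (hp : p.Prime) : IsFrobLift p (frob hφ a) := by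
  have := eq_top_of_mem hφ a (frobLiftSubring hp (frob hφ a)) (fun x ↦ ?_) fun m x ↦ ?_
  · intro x
    rw [← mem_frobLiftSubring hp, this]
    trivial
  · obtain ⟨y, hy⟩ := hφ x
    exact ⟨inl hφ a y, by rw [frob_inl, hy]; simp⟩
  · obtain ⟨y, hy⟩ := EndoColim.isFrobLift_shift (FreeDelta.isFrobLift_frob hp) (.of _ m x)
    exact ⟨inr hφ a y, by rw [frob_inr, hy]; simp⟩

lemma flat (hp : p.Prime) (j : ℕ) : (Quo.map (dvd_refl (p ^ j)) (inl hφ a)).Flat :=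
  flat_quo_of_isPushout (isPushout hφ a) _ (FreeDelta.flat_perfection hp j)

/-- The map from `A` to an algebraic closure `K` of the residue field of `q` turns `φ` into the
`p`-th power. Since `K` is perfect, the map extends to the cover by sending formal Frobenius roots
to actual `p`-power roots, and the kernel of the extension lies over `q`. -/
lemma exists_comap_eq (hp : p.Prime) (q : Ideal A) [q.IsPrime] (hq : (p : A) ∈ q) :
    ∃ q' : Ideal (ring hφ a), q'.IsPrime ∧ q'.comap (inl hφ a) = q := by
  have : Fact p.Prime := ⟨hp⟩
  let K := AlgebraicClosure (FractionRing (A ⧸ q))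
  let f : A →+* K := (algebraMap (A ⧸ q) K).comp (Ideal.Quotient.mk q)
  have hf : RingHom.ker f = q := by
    rw [RingHom.ker_comp_of_injective, Ideal.mk_ker]
    rw [IsScalarTower.algebraMap_eq (A ⧸ q) (FractionRing (A ⧸ q)) K]
    exact (algebraMap (FractionRing (A ⧸ q)) K).injective.comp (IsFractionRing.injective _ _)
  have hpK : (p : K) = 0 := by
    rw [← map_natCast f, ← RingHom.mem_ker, hf]
    exact hq
  have : CharP K p := (CharP.charP_iff_prime_eq_zero hp).2 hpK
  have hφf (x) : f (φ x) = f x ^ p := by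
    obtain ⟨y, hy⟩ := hφ x
    rw [hy, map_add, map_mul, map_natCast, hpK, zero_mul, add_zero, map_pow]
  let e := (frobeniusEquiv K p).symm.toRingHom
  have he (x : K) : e (x ^ p) = x := (frobeniusEquiv K p).symm_apply_apply x
  -- The `m`-th stage consists of formal `m`-fold Frobenius roots, hence the factor `e ^ m`, where
  -- `e` extracts `p`-th roots in `K`.
  let g : EndoColim (FreeDelta.frob p Λ) →+* K :=
    EndoColim.lift _ (fun m ↦ (e ^ m).comp (f.comp (hφ.eval a))) fun m x ↦ by
      simp only [RingHom.comp_apply]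
      rw [hφ.eval_frob, hφf, RingHom.coe_pow, Function.iterate_succ_apply, he, RingHom.coe_pow]
  let d := lift hφ a f g fun x ↦ by simp [g]
  refine ⟨RingHom.ker d, RingHom.ker_isPrime d, ?_⟩
  ext x
  rw [Ideal.mem_comap, RingHom.mem_ker, lift_inl]
  exact SetLike.ext_iff.1 hf x

end

end FrobCover

/-! ### Frobenius covers of a surjection -/

namespace FrobCover

noncomputable section

variable {p : ℕ} {A C : Type u} [CommRing A] [CommRing C] {φ : A →+* A} {φ' : C →+* C}
  (hφ : IsFrobLift p φ) (hφ' : IsFrobLift p φ') (c : A →+* C)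

/-- The family in the target of a homomorphism used to cover it compatibly with the source. -/
abbrev family (x : {a : A // c a ≠ 0}) : C := c x.1

open Classical in
/-- The map of free `δ`-rings which kills the variables indexed by the kernel of `c`. -/
def kill : FreeDelta A →+* FreeDelta {a : A // c a ≠ 0} :=
  (MvPolynomial.aeval fun i : A × ℕ ↦ if h : c i.1 ≠ 0 then
    (MvPolynomial.X (⟨i.1, h⟩, i.2) : FreeDelta {a : A // c a ≠ 0}) else 0).toRingHom

lemma kill_X_of_ne {a : A} (h : c a ≠ 0) (k : ℕ) :
    kill c (MvPolynomial.X (a, k)) = MvPolynomial.X (⟨a, h⟩, k) := by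
  simp [kill, h]

lemma kill_X_of_eq {a : A} (h : c a = 0) (k : ℕ) : kill c (MvPolynomial.X (a, k)) = 0 := by
  simp [kill, h]

/-- The section of `kill`. -/
def keep : FreeDelta {a : A // c a ≠ 0} →+* FreeDelta A :=
  (MvPolynomial.rename fun i : {a : A // c a ≠ 0} × ℕ ↦ (i.1.1, i.2)).toRingHom

@[simp] lemma keep_X (i) : keep c (MvPolynomial.X i) = MvPolynomial.X (i.1.1, i.2) := by
  simp [keep]

lemma kill_keep (x) : kill c (keep c x) = x := by
  refine RingHom.congr_fun (f := (kill c).comp (keep c)) (g := RingHom.id _) ?_ x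
  refine MvPolynomial.ringHom_ext (fun r ↦ by simp) fun i ↦ ?_
  rw [RingHom.comp_apply, keep_X, kill_X_of_ne c i.1.2]
  rfl

lemma kill_frob (hp : p.Prime) (x) :
    kill c (FreeDelta.frob p _ x) = FreeDelta.frob p _ (kill c x) := by
  refine RingHom.congr_fun (f := (kill c).comp (FreeDelta.frob p _))
    (g := (FreeDelta.frob p _).comp (kill c)) ?_ x
  refine MvPolynomial.ringHom_ext (fun r ↦ by simp) fun ⟨a, k⟩ ↦ ?_
  simp only [RingHom.comp_apply, FreeDelta.frob_X, map_add, map_mul, map_pow, map_natCast]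
  by_cases h : c a = 0
  · simp only [kill_X_of_eq c h, map_zero, mul_zero, add_zero, zero_pow hp.ne_zero]
  · simp only [kill_X_of_ne c h, FreeDelta.frob_X]

lemma keep_frob (x) : keep c (FreeDelta.frob p _ x) = FreeDelta.frob p _ (keep c x) := by
  refine RingHom.congr_fun (f := (keep c).comp (FreeDelta.frob p _))
    (g := (FreeDelta.frob p _).comp (keep c)) ?_ x
  refine MvPolynomial.ringHom_ext (fun r ↦ by simp) fun ⟨a, k⟩ ↦ ?_
  simp only [RingHom.comp_apply, FreeDelta.frob_X, map_add, map_mul, map_pow, map_natCast, keep_X]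

variable (hp : p.Prime) (hC : ∀ x : C, p * x = 0 → x = 0) (hc : ∀ a, c (φ a) = φ' (c a))

-- Killing the variables indexed by `ker c` is legitimate because `c` commutes with `δ` and all
-- iterates of `δ` vanish at `0`. It forces the roots of elements of `ker c` to vanish in the cover
-- of `C`.
include hp hC hc in
lemma map_eval (x) : c (hφ.eval id x) = hφ'.eval (family c) (kill c x) := by
  refine RingHom.congr_fun (f := c.comp (hφ.eval id)) (g := (hφ'.eval (family c)).comp (kill c)) ?_ x
  refine MvPolynomial.ringHom_ext (fun r ↦ by simp) fun ⟨a, k⟩ ↦ ?_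
  rw [RingHom.comp_apply, hφ.eval_X, RingHom.comp_apply, hφ.map_iterate_delta hφ' hC c hc]
  by_cases h : c a = 0
  · rw [kill_X_of_eq c h, map_zero, id, h, hφ'.iterate_delta_zero hp hC]
  · rw [kill_X_of_ne c h, hφ'.eval_X]
    rfl

/-- The map of covers induced by a homomorphism. -/
def map : ring hφ (id : A → A) →+* ring hφ' (family c) :=
  lift hφ id ((inl hφ' (family c)).comp c)
    ((inr hφ' (family c)).comp (EndoColim.map (kill c) (kill_frob c hp))) fun x ↦ by
      rw [RingHom.comp_apply, RingHom.comp_apply, map_eval hφ hφ' c hp hC hc, inl_eval,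
        EndoColim.map_of]

@[simp] lemma map_inl (x : A) :
    map hφ hφ' c hp hC hc (inl hφ id x) = inl hφ' (family c) (c x) := lift_inl ..

@[simp] lemma map_inr (m : ℕ) (x) : map hφ hφ' c hp hC hc (inr hφ id (EndoColim.of _ m x)) =
    inr hφ' (family c) (EndoColim.of _ m (kill c x)) := by
  rw [map, lift_inr, RingHom.comp_apply, EndoColim.map_of]

lemma map_frob (x) : map hφ hφ' c hp hC hc (frob hφ id x) =
    frob hφ' (family c) (map hφ hφ' c hp hC hc x) := by
  refine RingHom.congr_fun (f := (map hφ hφ' c hp hC hc).comp (frob hφ id))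
    (g := (frob hφ' (family c)).comp (map hφ hφ' c hp hC hc)) (hom_ext (fun x ↦ ?_) fun m x ↦ ?_) x
  · simp [hc]
  · simp [kill_frob c hp]

lemma map_surjective (hs : Function.Surjective c) :
    Function.Surjective (map hφ hφ' c hp hC hc) := by
  rw [← RingHom.range_eq_top]
  refine eq_top_of_mem _ _ _ (fun x ↦ ?_) fun m x ↦ ?_
  · obtain ⟨a, rfl⟩ := hs x
    exact ⟨inl hφ id a, map_inl ..⟩
  · exact ⟨inr hφ id (EndoColim.of _ m (keep c x)), by rw [map_inr, kill_keep]⟩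

/-- Each `x` in `A` is identified with a variable of the free `δ`-ring, and an element of stage `m`
of the perfection is the Frobenius image of the same element at stage `m + 1`. This is why roots of
all elements of `A` are adjoined. -/
lemma frob_surjective : Function.Surjective (frob hφ (id : A → A)) := by
  rw [← RingHom.range_eq_top]
  have h (m x) : inr hφ (id : A → A) (EndoColim.of _ m x) ∈ (frob hφ (id : A → A)).range :=
    ⟨inr hφ id (EndoColim.of _ (m + 1) x), by rw [frob_inr, EndoColim.shift_of_succ]⟩
  refine eq_top_of_mem _ _ _ (fun x ↦ ?_) h
  have := inl_eval hφ id (MvPolynomial.X (x, 0))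
  rw [hφ.eval_X] at this
  exact this ▸ h 0 _

/-- The elements congruent modulo `p` to the image under Frobenius of an element which vanishes
modulo `p` in the target. -/
def rootIdeal : Ideal (ring hφ (id : A → A)) where
  carrier := {x | ∃ y z, x = frob hφ id y + p * z ∧ ∃ w, map hφ hφ' c hp hC hc y = p * w}
  add_mem' := by
    rintro x x' ⟨y, z, rfl, w, hw⟩ ⟨y', z', rfl, w', hw'⟩
    exact ⟨y + y', z + z', by rw [map_add]; ring, w + w', by rw [map_add, hw, hw', mul_add]⟩
  zero_mem' := ⟨0, 0, by simp, 0, by simp⟩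
  smul_mem' := by
    rintro r x ⟨y, z, rfl, w, hw⟩
    -- A scalar can be absorbed under Frobenius because it is itself a Frobenius image.
    obtain ⟨s, rfl⟩ := frob_surjective hφ r
    exact ⟨s * y, frob hφ id s * z, by rw [map_mul, smul_eq_mul]; ring,
      map hφ hφ' c hp hC hc s * w, by rw [map_mul, hw]; ring⟩

/-- The claim is that `N = rootIdeal` contains everything that vanishes modulo `p` in the cover of
`C`. `N` contains `p` and all roots of variables indexed by `ker c`, so the quotient map by `N`
factors through a map `d` from the cover of `C`. Multiples of `p` there go to `0`. -/
lemma exists_root (hs : Function.Surjective c) (x : ring hφ (id : A → A))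
    (hx : ∃ w, map hφ hφ' c hp hC hc x = p * w) :
    ∃ y z, x = frob hφ id y + p * z ∧ ∃ w, map hφ hφ' c hp hC hc y = p * w := by
  let N := rootIdeal hφ hφ' c hp hC hc
  let π := Ideal.Quotient.mk N
  have hpN : (p : ring hφ (id : A → A)) ∈ N := ⟨0, 1, by simp, 0, by simp⟩
  have hN (a : A) (ha : c a = 0) (m k : ℕ) :
      inr hφ id (EndoColim.of _ m (MvPolynomial.X (a, k))) ∈ N :=
    ⟨inr hφ id (EndoColim.of _ (m + 1) (MvPolynomial.X (a, k))), 0,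
      by rw [frob_inr, EndoColim.shift_of_succ, mul_zero, add_zero], 0,
      by rw [map_inr, kill_X_of_eq c ha]; simp⟩
  have hker : RingHom.ker c ≤ RingHom.ker (π.comp (inl hφ id)) := by
    intro a ha
    rw [RingHom.mem_ker, RingHom.comp_apply, Ideal.Quotient.eq_zero_iff_mem]
    have := inl_eval hφ id (MvPolynomial.X (a, 0))
    rw [hφ.eval_X] at this
    exact this ▸ hN a ha 0 0
  -- An element of `ker c` equals its own variable at stage `0`, which lies in `N`; hence `A → ring
  -- / N` descends to `C`.
  let f := c.liftOfSurjective hs ⟨π.comp (inl hφ id), hker⟩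
  have hf (a : A) : f (c a) = π (inl hφ id a) := c.liftOfRightInverse_comp_apply _ _ ⟨_, hker⟩ a
  let d : ring hφ' (family c) →+* ring hφ (id : A → A) ⧸ N :=
    lift hφ' (family c) f (π.comp ((inr hφ id).comp (EndoColim.map (keep c) (keep_frob c))))
      fun x ↦ by
        rw [RingHom.comp_apply, RingHom.comp_apply, EndoColim.map_of, ← inl_eval, ← hf,
          map_eval hφ hφ' c hp hC hc, kill_keep]
  have hd : d.comp (map hφ hφ' c hp hC hc) = π := by
    refine hom_ext (fun x ↦ ?_) fun m x ↦ ?_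
    · rw [RingHom.comp_apply, map_inl, lift_inl, hf]
    · rw [RingHom.comp_apply, map_inr, lift_inr, RingHom.comp_apply, RingHom.comp_apply,
        EndoColim.map_of]
      refine RingHom.congr_fun (f := (π.comp ((inr hφ id).comp (EndoColim.of _ m))).comp
        ((keep c).comp (kill c))) (g := π.comp ((inr hφ id).comp (EndoColim.of _ m))) ?_ x
      refine MvPolynomial.ringHom_ext (fun r ↦ by simp) fun ⟨a, k⟩ ↦ ?_
      by_cases h : c a = 0
      · simp only [RingHom.comp_apply, kill_X_of_eq c h, map_zero]
        exact (Ideal.Quotient.eq_zero_iff_mem.2 (hN a h m k)).symm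
      · simp only [RingHom.comp_apply, kill_X_of_ne c h, keep_X]
  obtain ⟨w, hw⟩ := hx
  have : π x = 0 := by
    rw [← hd, RingHom.comp_apply, hw, map_mul, map_natCast, ← map_natCast π,
      Ideal.Quotient.eq_zero_iff_mem.2 hpN, zero_mul]
  exact Ideal.Quotient.eq_zero_iff_mem.1 this

end

end FrobCover

/-! ### Faithful flatness and torsion freeness of the Frobenius cover -/

lemma torsionFreeMod_of_mul_eq_zero {p : ℕ} {A : Type*} [CommRing A]
    (hA : ∀ x : A, p * x = 0 → x = 0) : TorsionFreeMod p A := fun m x y h ↦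
  ⟨y, sub_eq_zero.1 (hA _ (by rw [mul_sub, h]; ring))⟩

/-- A homomorphism which is faithfully flat modulo every power of `p`. -/
structure IsFaithfullyFlatMod (p : ℕ) {A B : Type*} [CommRing A] [CommRing B] (f : A →+* B) :
    Prop where
  flat (j : ℕ) : (Quo.map (dvd_refl (p ^ j)) f).Flat
  exists_comap_eq (q : Ideal A) [q.IsPrime] (hq : (p : A) ∈ q) :
    ∃ q' : Ideal B, q'.IsPrime ∧ q'.comap f = q

lemma FrobCover.isFaithfullyFlatMod {p : ℕ} (hp : p.Prime) {A : Type u} [CommRing A] {φ : A →+* A}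
    (hφ : IsFrobLift p φ) {Λ : Type u} (a : Λ → A) : IsFaithfullyFlatMod p (inl hφ a) :=
  ⟨flat hφ a hp, fun q _ hq ↦ exists_comap_eq hφ a hp q hq⟩

lemma FrobCover.torsionFreeMod {p : ℕ} (hp : p.Prime) {A : Type u} [CommRing A] {φ : A →+* A}
    (hφ : IsFrobLift p φ) {Λ : Type u} (a : Λ → A) (hA : ∀ x : A, p * x = 0 → x = 0) :
    TorsionFreeMod p (ring hφ a) :=
  .of_flat (inl hφ a) (flat hφ a hp) (torsionFreeMod_of_mul_eq_zero hA)

/-! ### Lifting homomorphisms compatibly with Frobenius lifts -/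

section Lifting

/-- Here `π` need not be surjective. The infinitesimal lifting property is applied to `A → π.range`,
in which `f` takes its values; this allows products as targets `D`. -/
lemma RingHom.FormallySmooth.exists_lift {R B A D : Type*} [CommRing R] [CommRing B] [CommRing A]
    [CommRing D] {ρ : R →+* B} (hρ : ρ.FormallySmooth) (s : R →+* A) (π : A →+* D) (f : B →+* D)
    (hf : ∀ r, f (ρ r) = π (s r)) (hrange : ∀ b, ∃ a, π a = f b)
    (hker : ∀ k k', π k = 0 → π k' = 0 → k * k' = 0) :
    ∃ h : B →+* A, (∀ r, h (ρ r) = s r) ∧ ∀ b, π (h b) = f b := by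
  let _ := ρ.toAlgebra
  let _ := s.toAlgebra
  let _ := (π.rangeRestrict.comp s).toAlgebra
  have _ : Algebra.FormallySmooth R B := hρ
  let f' : B →ₐ[R] π.range := ⟨f.codRestrict π.range hrange, fun r ↦ Subtype.ext (hf r)⟩
  let π' : A →ₐ[R] π.range := ⟨π.rangeRestrict, fun r ↦ rfl⟩
  have hnil : IsNilpotent (RingHom.ker (π' : A →+* π.range)) := by
    refine ⟨2, ?_⟩
    rw [pow_two, Ideal.zero_eq_bot, eq_bot_iff, Ideal.mul_le]
    intro k hk k' hk'
    exact hker k k' (congrArg Subtype.val hk) (congrArg Subtype.val hk')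
  let h := Algebra.FormallySmooth.liftOfSurjective f' π' π.rangeRestrict_surjective hnil
  exact ⟨h, fun r ↦ h.commutes r, fun b ↦ congrArg Subtype.val
    (Algebra.FormallySmooth.liftOfSurjective_apply f' π' π.rangeRestrict_surjective hnil b)⟩

variable {p : ℕ}

/-- Choose a lift `h₀`, then a lift `h` with `φA ∘ h = h₀ ∘ φB`, which is possible since `φA` is
surjective on `ker π`. Two lifts agree after composition with `φB`, because `φB b` is a `p`-th power
plus a multiple of `p`, and `ker π` has square zero and is killed by `p`. Hence `φA ∘ h = h ∘ φB`.
-/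
lemma exists_frob_compatible_lift (hp : p.Prime) {R B A D : Type*} [CommRing R] [CommRing B]
    [CommRing A] [CommRing D] {ρ : R →+* B} (hρ : ρ.FormallySmooth) {φR : R →+* R} {φB : B →+* B}
    {φA : A →+* A} {φD : D →+* D} (hφB : IsFrobLift p φB) (hρφ : ∀ r, ρ (φR r) = φB (ρ r))
    (s : R →+* A) (hs : ∀ r, s (φR r) = φA (s r)) (π : A →+* D)
    (hπ : ∀ a, π (φA a) = φD (π a)) (f : B →+* D) (hfρ : ∀ r, f (ρ r) = π (s r))
    (hfφ : ∀ b, f (φB b) = φD (f b)) (hrange : ∀ b, ∃ a, π a = f b)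
    (hker : ∀ k k', π k = 0 → π k' = 0 → k * k' = 0) (hpker : ∀ k, π k = 0 → p * k = 0)
    (hroot : ∀ k, π k = 0 → ∃ k', π k' = 0 ∧ φA k' = k) :
    ∃ h : B →+* A, (∀ r, h (ρ r) = s r) ∧ (∀ b, π (h b) = f b) ∧ ∀ b, h (φB b) = φA (h b) := by
  obtain ⟨h₀, hs₀, hπ₀⟩ := hρ.exists_lift s π f hfρ hrange hker
  -- The equation `φA ∘ h = h₀ ∘ φB` is built into the lifting problem by lifting along `(π, φA)`. A
  -- pointwise solution is `h₀ b - k`, with `k` a root of the defect `φA (h₀ b) - h₀ (φB b)`.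
  obtain ⟨h, hs₁, hh⟩ := hρ.exists_lift s (π.prod φA) (f.prod (h₀.comp φB))
    (fun r ↦ Prod.ext (hfρ r) (by simp [← hρφ, hs₀, hs])) (fun b ↦ by
      obtain ⟨k, hk, hk'⟩ := hroot (φA (h₀ b) - h₀ (φB b)) (by
        rw [map_sub, hπ, hπ₀, hπ₀, hfφ, sub_self])
      refine ⟨h₀ b - k, Prod.ext ?_ ?_⟩
      · simp [hk, hπ₀]
      · simp [hk'])
    (fun k k' hk hk' ↦ hker k k' (congrArg Prod.fst hk) (congrArg Prod.fst hk'))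
  have hπ₁ (b) : π (h b) = f b := congrArg Prod.fst (hh b)
  have hφ₁ (b) : φA (h b) = h₀ (φB b) := congrArg Prod.snd (hh b)
  refine ⟨h, hs₁, hπ₁, fun b ↦ ?_⟩
  have hk (b) : π (h b - h₀ b) = 0 := by rw [map_sub, hπ₁, hπ₀, sub_self]
  obtain ⟨b', hb'⟩ := hφB b
  obtain ⟨r, hr⟩ := exists_add_pow_prime_eq hp (h₀ b) (h b - h₀ b)
  have h1 : (h b - h₀ b) ^ p = 0 := by
    obtain ⟨m, hm⟩ := Nat.exists_eq_add_of_le hp.two_le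
    rw [hm, pow_add, pow_two, hker _ _ (hk b) (hk b), zero_mul]
  have h2 := hpker _ (hk b)
  have h3 := hpker _ (hk b')
  rw [add_sub_cancel, h1] at hr
  rw [hφ₁, hb', map_add, map_mul, map_pow, map_natCast, map_add, map_mul, map_pow, map_natCast, hr]
  linear_combination (h₀ b * r) * h2 + h3

lemma IsFrobLift.quo {A : Type*} [CommRing A] {φ : A →+* A} (hφ : IsFrobLift p φ) (c : ℕ) :
    IsFrobLift p (Quo.map (dvd_refl c) φ) := by
  intro a
  obtain ⟨a, rfl⟩ := Ideal.Quotient.mk_surjective a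
  obtain ⟨b, hb⟩ := hφ a
  exact ⟨Ideal.Quotient.mk _ b, by rw [Quo.map_mk, hb]; simp⟩

/-- Each use of the weak torsion condition cancels one factor `p` from both sides. -/
lemma TorsionFreeMod.exists_eq_mul {A : Type*} [CommRing A] (hA : TorsionFreeMod p A) (N : ℕ)
    {x y : A} (h : p ^ N * x = p ^ (N + 1) * y) : ∃ z, x = p * z := by
  induction N generalizing y with
  | zero => exact ⟨y, by simpa using h⟩
  | succ N ih =>
    obtain ⟨z, hz⟩ := hA (N + 1) (p ^ N * x) y (by rw [← h]; ring)
    exact ih hz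

variable {A C R B : Type*} [CommRing A] [CommRing C] [CommRing R] [CommRing B]

/-- A homomorphism modulo `p ^ N`, compatible with given data over `R` and `C`. -/
structure IsCompatibleMod (p N : ℕ) (φA : A →+* A) (c : A →+* C) (ρ : R →+* B)
    (φB : B →+* B) (s : R →+* A) (g : B →+* C) (f : B →+* Quo (p ^ N) A) : Prop where
  apply_base (r) : f (ρ r) = Ideal.Quotient.mk _ (s r)
  apply_frob (b) : f (φB b) = Quo.map (dvd_refl _) φA (f b)
  map_apply (b) : Quo.map (dvd_refl _) c (f b) = Ideal.Quotient.mk _ (g b)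

variable {φA : A →+* A} {φC : C →+* C} {c : A →+* C} {ρ : R →+* B} {φR : R →+* R} {φB : B →+* B}
  {s : R →+* A} {g : B →+* C}

lemma IsCompatibleMod.of_dvd {N M : ℕ} {f : B →+* Quo (p ^ N) A}
    (hf : IsCompatibleMod p N φA c ρ φB s g f) (h : p ^ M ∣ p ^ N) :
    IsCompatibleMod p M φA c ρ φB s g ((Quo.map h (RingHom.id A)).comp f) where
  apply_base r := by rw [RingHom.comp_apply, hf.apply_base]; rfl
  apply_frob b := by
    rw [RingHom.comp_apply, RingHom.comp_apply, hf.apply_frob]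
    obtain ⟨a, ha⟩ := Ideal.Quotient.mk_surjective (f b)
    rw [← ha]; rfl
  map_apply b := by
    have := congrArg (Quo.map h (RingHom.id C)) (hf.map_apply b)
    rw [RingHom.comp_apply]
    obtain ⟨a, ha⟩ := Ideal.Quotient.mk_surjective (f b)
    rw [← ha] at this ⊢
    exact this

/-- Lifting takes place along `A / p ^ (N + 1) → A / p ^ N × C / p ^ (N + 1)`, so that `f` and `g`
are respected simultaneously. The kernel consists of the classes of `p ^ N * x` with `c x ∈ p C`,
and `hroot` makes `φA` surjective on it. -/
lemma IsCompatibleMod.exists_succ (hp : p.Prime) (hc : Function.Surjective c)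
    (hcφ : ∀ a, c (φA a) = φC (c a)) (hC : TorsionFreeMod p C)
    (hroot : ∀ x : A, (∃ w, c x = p * w) → ∃ y z, x = φA y + p * z ∧ ∃ w, c y = p * w)
    (hsmooth : ∀ m, (Quo.map (dvd_refl (p ^ m)) ρ).FormallySmooth)
    (hφB : IsFrobLift p φB) (hρφ : ∀ r, ρ (φR r) = φB (ρ r)) (hs : ∀ r, s (φR r) = φA (s r))
    (hgρ : ∀ r, g (ρ r) = c (s r)) (hgφ : ∀ b, g (φB b) = φC (g b)) {N : ℕ} (hN : 0 < N)
    {f : B →+* Quo (p ^ N) A} (hf : IsCompatibleMod p N φA c ρ φB s g f) :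
    ∃ f' : B →+* Quo (p ^ (N + 1)) A, IsCompatibleMod p (N + 1) φA c ρ φB s g f' ∧
      (Quo.map (pow_dvd_pow p N.le_succ) (RingHom.id A)).comp f' = f := by
  have hd : p ^ N ∣ p ^ (N + 1) := pow_dvd_pow p N.le_succ
  let π : Quo (p ^ (N + 1)) A →+* Quo (p ^ N) A × Quo (p ^ (N + 1)) C :=
    (Quo.map hd (RingHom.id A)).prod (Quo.map (dvd_refl _) c)
  let φD := ((Quo.map (dvd_refl (p ^ N)) φA).prodMap (Quo.map (dvd_refl (p ^ (N + 1))) φC))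
  let q : Quo (p ^ (N + 1)) B →+* Quo (p ^ N) A × Quo (p ^ (N + 1)) C :=
    Ideal.Quotient.lift _ (f.prod ((Ideal.Quotient.mk _).comp g)) fun b hb ↦ by
      obtain ⟨b, rfl⟩ := mem_span_natCast.1 hb
      have h1 : ((p ^ (N + 1) : ℕ) : Quo (p ^ N) A) = 0 := by
        rw [← map_natCast (Ideal.Quotient.mk _), Quo.mk_eq_zero]
        exact ⟨p, by push_cast; ring⟩
      refine Prod.ext ?_ ?_
      · change f _ = 0
        rw [map_mul, map_natCast, h1, zero_mul]
      · exact Quo.mk_eq_zero.2 ⟨g b, by rw [map_mul, map_natCast]⟩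
  have hker (k : Quo (p ^ (N + 1)) A) (hk : π k = 0) : ∃ (x : A) (w : C),
      k = Ideal.Quotient.mk _ (p ^ N * x) ∧ c x = p * w := by
    obtain ⟨k, rfl⟩ := Ideal.Quotient.mk_surjective k
    obtain ⟨x, hx⟩ : ∃ x, k = (p ^ N : ℕ) * x := Quo.mk_eq_zero.1 (congrArg Prod.fst hk)
    subst hx
    obtain ⟨y, hy⟩ := Quo.mk_eq_zero.1 (congrArg Prod.snd hk)
    rw [map_mul, map_natCast] at hy
    obtain ⟨w, hw⟩ := hC.exists_eq_mul N (x := c x) (y := y) (by rw [← Nat.cast_pow, hy]; push_cast; rfl)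
    exact ⟨x, w, by push_cast; rfl, hw⟩
  obtain ⟨h, h1, h2, h3⟩ := exists_frob_compatible_lift hp (hsmooth (N + 1))
    (φR := Quo.map (dvd_refl _) φR) (φA := Quo.map (dvd_refl _) φA) (φD := φD) (hφB.quo (p ^ (N + 1)))
    (fun r ↦ by
      obtain ⟨r, rfl⟩ := Ideal.Quotient.mk_surjective r
      simp [hρφ])
    (Quo.map (dvd_refl _) s) (fun r ↦ by
      obtain ⟨r, rfl⟩ := Ideal.Quotient.mk_surjective r
      simp [hs])
    π (fun a ↦ by
      obtain ⟨a, rfl⟩ := Ideal.Quotient.mk_surjective a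
      simp [π, φD, hcφ])
    q (fun r ↦ by
      obtain ⟨r, rfl⟩ := Ideal.Quotient.mk_surjective r
      simp [π, q, hf.apply_base, hgρ])
    (fun b ↦ by
      obtain ⟨b, rfl⟩ := Ideal.Quotient.mk_surjective b
      simp [φD, q, hf.apply_frob, hgφ])
    (fun b ↦ by
      obtain ⟨b, rfl⟩ := Ideal.Quotient.mk_surjective b
      obtain ⟨a, ha⟩ := Ideal.Quotient.mk_surjective (f b)
      have := hf.map_apply b
      rw [← ha, Quo.map_mk, Quo.mk_eq_mk] at this
      obtain ⟨w, hw⟩ := this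
      obtain ⟨v, rfl⟩ := hc w
      -- A representative of `f b` has the right image in `C` only modulo `p ^ N`; surjectivity of
      -- `c` corrects it without changing it modulo `p ^ N`.
      refine ⟨Ideal.Quotient.mk _ (a - (p ^ N : ℕ) * v), Prod.ext ?_ ?_⟩
      · refine Eq.trans ?_ ha
        exact Quo.mk_eq_mk.2 ⟨-v, by simp only [RingHom.id_apply]; ring⟩
      · change Ideal.Quotient.mk _ (c _) = Ideal.Quotient.mk _ (g b)
        rw [map_sub, map_mul, map_natCast, hw, add_sub_cancel_right])
    (fun k k' hk hk' ↦ by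
      obtain ⟨x, w, rfl, -⟩ := hker k hk
      obtain ⟨x', w', rfl, -⟩ := hker k' hk'
      rw [← map_mul, Quo.mk_eq_zero]
      -- The kernel has square zero because `2 * N ≥ N + 1`, that is, because `N > 0`.
      obtain ⟨M, rfl⟩ := Nat.exists_eq_add_of_lt hN
      exact ⟨p ^ M * x * x', by push_cast; ring⟩)
    (fun k hk ↦ by
      obtain ⟨x, w, rfl, -⟩ := hker k hk
      rw [← map_natCast (Ideal.Quotient.mk _), ← map_mul, Quo.mk_eq_zero]
      exact ⟨x, by push_cast; ring⟩)
    (fun k hk ↦ by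
      obtain ⟨x, w, rfl, hw⟩ := hker k hk
      -- A root of `x` modulo `p` is enough: after multiplication by `p ^ N` the error dies modulo
      -- `p ^ (N + 1)`.
      obtain ⟨y, z, rfl, w', hw'⟩ := hroot x ⟨w, hw⟩
      refine ⟨Ideal.Quotient.mk _ (p ^ N * y), Prod.ext ?_ ?_, ?_⟩
      · exact Quo.mk_eq_zero.2 ⟨y, by push_cast; rfl⟩
      · exact Quo.mk_eq_zero.2 ⟨w', by rw [map_mul, hw']; push_cast; simp; ring⟩
      · exact Quo.mk_eq_mk.2 ⟨-z, by push_cast; simp; ring⟩)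
  refine ⟨h.comp (Ideal.Quotient.mk _), ⟨fun r ↦ h1 (Ideal.Quotient.mk _ r),
    fun b ↦ h3 (Ideal.Quotient.mk _ b), fun b ↦ ?_⟩, RingHom.ext fun b ↦ ?_⟩
  · exact congrArg Prod.snd (h2 (Ideal.Quotient.mk _ b))
  · exact congrArg Prod.fst (h2 (Ideal.Quotient.mk _ b))

lemma IsCompatibleMod.exists_system (hp : p.Prime) (hc : Function.Surjective c)
    (hcφ : ∀ a, c (φA a) = φC (c a)) (hC : TorsionFreeMod p C)
    (hroot : ∀ x : A, (∃ w, c x = p * w) → ∃ y z, x = φA y + p * z ∧ ∃ w, c y = p * w)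
    (hsmooth : ∀ m, (Quo.map (dvd_refl (p ^ m)) ρ).FormallySmooth)
    (hφB : IsFrobLift p φB) (hρφ : ∀ r, ρ (φR r) = φB (ρ r)) (hs : ∀ r, s (φR r) = φA (s r))
    (hgρ : ∀ r, g (ρ r) = c (s r)) (hgφ : ∀ b, g (φB b) = φC (g b)) {N : ℕ} (hN : 0 < N)
    {f : B →+* Quo (p ^ N) A} (hf : IsCompatibleMod p N φA c ρ φB s g f) :
    ∃ F : ∀ m, B →+* Quo (p ^ m) A, (∀ m, IsCompatibleMod p m φA c ρ φB s g (F m)) ∧ F N = f ∧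
      ∀ m n (h : m ≤ n), (Quo.map (pow_dvd_pow p h) (RingHom.id A)).comp (F n) = F m := by
  have step (j : ℕ) (f : {f : B →+* Quo (p ^ (N + j)) A //
      IsCompatibleMod p (N + j) φA c ρ φB s g f}) :=
    f.2.exists_succ hp hc hcφ hC hroot hsmooth hφB hρφ hs hgρ hgφ (Nat.add_pos_left hN j)
  choose next hnext using step
  let G' : ∀ j, {f : B →+* Quo (p ^ (N + j)) A // IsCompatibleMod p (N + j) φA c ρ φB s g f} :=
    fun j ↦ Nat.rec ⟨f, hf⟩ (fun j f ↦ ⟨next j f, (hnext j f).1⟩) j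
  let G := fun j ↦ (G' j).1
  have hG := fun j ↦ (G' j).2
  have hG' : ∀ i j (h : i ≤ j), (Quo.map (pow_dvd_pow p (Nat.add_le_add_left h N))
      (RingHom.id A)).comp (G j) = G i := by
    intro i j h
    induction j, h using Nat.le_induction with
    | base => rw [Quo.map_id]; rfl
    | succ j h ih =>
      have h1 : G j = (Quo.map _ (RingHom.id A)).comp (G (j + 1)) := (hnext j (G' j)).2.symm
      rw [← ih, h1, ← RingHom.comp_assoc, Quo.map_comp]
      rfl
  -- The map at level `m` is reduced from level `N + m`, so the levels below `N` need no separate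
  -- definition.
  refine ⟨fun m ↦ (Quo.map (pow_dvd_pow p (Nat.le_add_left m N)) (RingHom.id A)).comp (G m),
    fun m ↦ (hG m).of_dvd _, hG' 0 N N.zero_le, fun m n h ↦ ?_⟩
  have h1 := hG' m n h
  dsimp only
  rw [← h1, ← RingHom.comp_assoc, Quo.map_comp, ← RingHom.comp_assoc, Quo.map_comp]

end Lifting

/-! ### Thickenings of affine schemes -/

section Thickening

/-- A surjective closed immersion whose ideal has square zero and is annihilated by `p`. -/
structure IsSmallThickening (p : ℕ) {X Y : Scheme.{u}} (j : X ⟶ Y) : Prop where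
  isClosedImmersion : IsClosedImmersion j
  surjective : Function.Surjective j
  mul_eq_zero (U : Y.Opens) (a b : Γ(Y, U)) : j.app U a = 0 → j.app U b = 0 → a * b = 0
  natCast_mul_eq_zero (U : Y.Opens) (a : Γ(Y, U)) : j.app U a = 0 → p * a = 0

namespace IsSmallThickening

variable {p : ℕ} {X Y : Scheme.{u}} {j : X ⟶ Y} (hj : IsSmallThickening p j)

include hj

/-- In the binomial expansion the mixed terms are multiples of `p * (a - b)`, and `(a - b) ^ p`
contains the square of a kernel element. -/
lemma pow_eq_pow (hp : p.Prime) {U : Y.Opens} {a b : Γ(Y, U)} (h : j.app U a = j.app U b) :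
    a ^ p = b ^ p := by
  have hk : j.app U (a - b) = 0 := by rw [map_sub, h, sub_self]
  obtain ⟨r, hr⟩ := exists_add_pow_prime_eq hp b (a - b)
  have h1 : (a - b) ^ p = 0 := by
    obtain ⟨m, hm⟩ := Nat.exists_eq_add_of_le hp.two_le
    rw [hm, pow_add, pow_two, hj.mul_eq_zero U _ _ hk hk, zero_mul]
  have h2 := hj.natCast_mul_eq_zero U _ hk
  rw [add_sub_cancel, h1] at hr
  linear_combination hr + (b * r) * h2

/-- Lifts of `f` exist on affine opens and differ by kernel elements on overlaps. Their `p`-th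
powers therefore agree there and glue, with no cohomological argument. -/
lemma exists_appTop_eq_pow (hp : p.Prime) (f : Γ(X, ⊤)) : ∃ F : Γ(Y, ⊤), j.appTop F = f ^ p := by
  have := hj.isClosedImmersion
  choose U hU hyU _ using fun y : Y ↦ exists_isAffineOpen_mem_and_subset (TopologicalSpace.Opens.mem_top y)
  choose g hg using fun y ↦ j.app_surjective (U y) (hU y) (X.presheaf.map (homOfLE le_top).op f)
  have hcomp : TopCat.Presheaf.IsCompatible Y.presheaf U fun y ↦ g y ^ p := by
    intro y z
    rw [map_pow, map_pow]
    refine hj.pow_eq_pow hp ?_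
    rw [← CommRingCat.comp_apply, ← CommRingCat.comp_apply, j.naturality, j.naturality,
      CommRingCat.comp_apply, CommRingCat.comp_apply, hg, hg, ← CommRingCat.comp_apply,
      ← CommRingCat.comp_apply, ← Functor.map_comp, ← Functor.map_comp]
    rfl
  obtain ⟨F, hF, -⟩ := Y.sheaf.existsUnique_gluing' U ⊤ (fun y ↦ homOfLE le_top)
    (fun y _ ↦ TopologicalSpace.Opens.mem_iSup.2 ⟨y, hyU y⟩) _ hcomp
  refine ⟨F, X.sheaf.eq_of_locally_eq' (fun y ↦ j ⁻¹ᵁ U y) ⊤ (fun y ↦ homOfLE le_top)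
    (fun x _ ↦ TopologicalSpace.Opens.mem_iSup.2 ⟨j x, hyU _⟩) _ _ fun y ↦ ?_⟩
  have h1 := congrArg (j.app (U y)) (hF y)
  rw [map_pow, hg] at h1
  change X.presheaf.map _ _ = X.presheaf.map _ _
  rw [map_pow]
  refine Eq.trans ?_ h1
  exact (congrArg (fun m ↦ m.hom F) (j.naturality (homOfLE (le_top : U y ≤ ⊤)).op)).symm

/-- The lift `G f` of `f ^ p` has the same basic open as `f`, as `j` is bijective on points. Hence
enough of these basic opens are affine to cover `Y`, and it remains to see that the corresponding
sections generate the unit ideal. -/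
lemma isAffine (hp : p.Prime) (N : ℕ) (hN : (p : Γ(X, ⊤)) ^ N = 0) [IsAffine X] : IsAffine Y := by
  have := hj.isClosedImmersion
  choose G hG using hj.exists_appTop_eq_pow hp
  let s : Set Γ(Y, ⊤) := {F | IsAffineOpen (Y.basicOpen F)}
  have hbasic (f : Γ(X, ⊤)) : j ⁻¹ᵁ Y.basicOpen (G f) = X.basicOpen f := by
    rw [Scheme.preimage_basicOpen]
    exact (congrArg X.basicOpen (hG f)).trans (X.basicOpen_pow f hp.pos)
  have hcover (x : X) : ∃ f : Γ(X, ⊤), x ∈ X.basicOpen f ∧ G f ∈ s := by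
    obtain ⟨U, hU, hxU, -⟩ :=
      exists_isAffineOpen_mem_and_subset (TopologicalSpace.Opens.mem_top (j x))
    obtain ⟨f, hf, hxf⟩ := (isAffineOpen_top X).exists_basicOpen_le (V := j ⁻¹ᵁ U) ⟨x, hxU⟩ trivial
    refine ⟨f, hxf, ?_⟩
    have hle : Y.basicOpen (G f) ≤ U := fun y hy ↦ by
      obtain ⟨x, rfl⟩ := hj.surjective y
      exact hf ((hbasic f).le hy)
    have h := hU.basicOpen (Y.presheaf.map (homOfLE le_top).op (G f))
    rwa [Scheme.basicOpen_res, inf_eq_right.2 hle] at h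
  have ht : Ideal.span {f | G f ∈ s} = ⊤ := by
    rw [← (isAffineOpen_top X).self_le_iSup_basicOpen_iff]
    intro x _
    obtain ⟨f, hxf, hf⟩ := hcover x
    exact TopologicalSpace.Opens.mem_iSup.2 ⟨⟨f, hf⟩, hxf⟩
  -- The map `G` is not additive, but its image on `X` is the `p`-th power, which is additive modulo
  -- `p`.
  have hone (x : Γ(X, ⊤)) (hx : x ∈ Ideal.span {f | G f ∈ s}) :
      ∃ y ∈ Ideal.span s, ∃ c, j.appTop y = x ^ p + p * c := by
    induction hx using Submodule.span_induction with
    | mem x hx => exact ⟨G x, Ideal.subset_span hx, 0, by rw [hG, mul_zero, add_zero]⟩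
    | zero => exact ⟨0, zero_mem _, 0, by rw [map_zero, zero_pow hp.ne_zero, mul_zero, add_zero]⟩
    | add a b _ _ ha hb =>
      obtain ⟨y, hy, c, hc⟩ := ha
      obtain ⟨z, hz, d, hd⟩ := hb
      obtain ⟨r, hr⟩ := exists_add_pow_prime_eq hp a b
      exact ⟨y + z, add_mem hy hz, c + d - a * b * r, by rw [map_add, hc, hd, hr]; ring⟩
    | smul a b _ hb =>
      obtain ⟨y, hy, c, hc⟩ := hb
      exact ⟨G a * y, Ideal.mul_mem_left _ _ hy, a ^ p * c, by
        rw [map_mul, hG, hc, smul_eq_mul]; ring⟩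
  have hs : Ideal.span s = ⊤ := by
    obtain ⟨y, hy, c, hc⟩ := hone 1 (ht ▸ trivial)
    -- For `x = 1` the image is `1 + p * c`, a unit because `p` is nilpotent. Units are detected at
    -- points, so `y` is a unit too.
    have hu : IsUnit (j.appTop y) := by
      rw [hc, one_pow]
      exact IsNilpotent.isUnit_one_add ⟨N, by rw [mul_pow, hN, zero_mul]⟩
    refine Ideal.eq_top_of_isUnit_mem _ hy ?_
    refine Y.toRingedSpace.isUnit_of_isUnit_germ _ _ fun z _ ↦ ?_
    obtain ⟨x, rfl⟩ := hj.surjective z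
    rw [← Scheme.mem_basicOpen]
    change x ∈ j ⁻¹ᵁ Y.basicOpen y
    rw [Scheme.preimage_basicOpen]
    exact (X.basicOpen_of_isUnit hu).ge trivial
  exact isAffine_of_isAffineOpen_basicOpen s hs fun _ h ↦ h

end IsSmallThickening

end Thickening

/-! ### Reductions and open subsets of `p`-adic formal schemes -/

lemma AlgebraicGeometry.Scheme.eq_zero_of_affine {X : Scheme.{u}} {U : X.Opens} (a : Γ(X, U))
    (h : ∀ (V : X.Opens) (hV : V ≤ U), IsAffineOpen V → X.presheaf.map (homOfLE hV).op a = 0) :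
    a = 0 := by
  choose V hV hxV hVU using fun x : U ↦ exists_isAffineOpen_mem_and_subset x.2
  refine X.sheaf.eq_of_locally_eq' V U (fun x ↦ homOfLE (hVU x))
    (fun x hx ↦ TopologicalSpace.Opens.mem_iSup.2 ⟨⟨x, hx⟩, hxV _⟩) _ _ fun x ↦ ?_
  exact (h _ (hVU x) (hV x)).trans (map_zero _).symm

lemma AlgebraicGeometry.Scheme.Hom.app_map {X Y : Scheme.{u}} (f : X ⟶ Y) {U V : Y.Opens}
    (h : V ≤ U) (a : Γ(Y, U)) :
    f.app V (Y.presheaf.map (homOfLE h).op a) =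
      X.presheaf.map (homOfLE (f.preimage_mono h)).op (f.app U a) :=
  congrArg (fun m ↦ m.hom a) (f.naturality (homOfLE h).op)

lemma app_image_eq_zero_of_morphismRestrict_app_eq_zero {X Y : Scheme.{u}} (j : X ⟶ Y) (U : Y.Opens)
    (V : U.toScheme.Opens) (a : Γ(U, V)) (h : (j ∣_ U).app V a = 0) :
    j.app (U.ι ''ᵁ V) a = 0 := by
  rw [morphismRestrict_app] at h
  exact (ConcreteCategory.bijective_of_isIso
    (X.presheaf.map (eqToHom (image_morphismRestrict_preimage j U V)).op)).1
    (h.trans (map_zero (X.presheaf.map _).hom).symm)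

lemma IsSmallThickening.morphismRestrict {p : ℕ} {X Y : Scheme.{u}} {j : X ⟶ Y}
    (hj : IsSmallThickening p j) (U : Y.Opens) : IsSmallThickening p (j ∣_ U) where
  isClosedImmersion := by
    have := hj.isClosedImmersion
    exact MorphismProperty.of_isPullback (isPullback_morphismRestrict j U).flip this
  surjective z := by
    obtain ⟨x, hx⟩ := hj.surjective z.1
    refine ⟨⟨x, show j x ∈ U from hx ▸ z.2⟩, Subtype.ext ?_⟩
    exact (congrArg (fun m : (j ⁻¹ᵁ U).toScheme ⟶ Y ↦ m ⟨x, _⟩) (morphismRestrict_ι j U)).trans hx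
  mul_eq_zero V a b ha hb := hj.mul_eq_zero (U.ι ''ᵁ V) a b
    (app_image_eq_zero_of_morphismRestrict_app_eq_zero j U V a ha)
    (app_image_eq_zero_of_morphismRestrict_app_eq_zero j U V b hb)
  natCast_mul_eq_zero V a ha := hj.natCast_mul_eq_zero (U.ι ''ᵁ V) a
    (app_image_eq_zero_of_morphismRestrict_app_eq_zero j U V a ha)

lemma IsSmallThickening.isAffineOpen {p : ℕ} {X Y : Scheme.{u}} {j : X ⟶ Y}
    (hj : IsSmallThickening p j) (hp : p.Prime) (N : ℕ) {U : Y.Opens}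
    (hN : (p : Γ(X, j ⁻¹ᵁ U)) ^ N = 0) (hU : IsAffineOpen (j ⁻¹ᵁ U)) : IsAffineOpen U := by
  have : IsAffine (j ⁻¹ᵁ U) := hU
  refine (hj.morphismRestrict U).isAffine hp N ?_
  have h := congrArg (j ⁻¹ᵁ U).topIso.inv hN
  rwa [map_pow, map_natCast, map_zero] at h

namespace PadicFormalScheme

variable {p : ℕ} (X : PadicFormalScheme.{u} p)

lemma exists_eq_mul_of_app_eq_zero {m n : ℕ} (h : m ⟶ n) {U V : (X.red n).Opens} (hVU : V ≤ U)
    (hV : IsAffineOpen V) {a : Γ(X.red n, U)} (ha : (X.system.map h).app U a = 0) :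
    ∃ b, (X.red n).presheaf.map (homOfLE hVU).op a = p ^ m * b := by
  have : (X.red n).presheaf.map (homOfLE hVU).op a ∈ RingHom.ker ((X.system.map h).app V).hom := by
    rw [RingHom.mem_ker]
    erw [Scheme.Hom.app_map]
    rw [ha, map_zero]
  rw [X.ker_eq h V hV, Ideal.mem_span_singleton] at this
  exact this

lemma natCast_pow_eq_zero (n : ℕ) (U : (X.red n).Opens) : (p : Γ(X.red n, U)) ^ n = 0 := by
  refine Scheme.eq_zero_of_affine _ fun V hV hVa ↦ ?_
  rw [map_pow, map_natCast]
  have : (p : Γ(X.red n, V)) ^ n ∈ RingHom.ker ((X.system.map (𝟙 n)).app V).hom := by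
    rw [X.ker_eq _ V hVa]
    exact Ideal.mem_span_singleton_self _
  rw [X.system.map_id] at this
  exact this

instance isEmpty_red_zero : IsEmpty (X.red 0) := by
  refine ⟨fun x ↦ ?_⟩
  have h := X.natCast_pow_eq_zero 0 ⊤
  rw [pow_zero] at h
  have h1 : (X.red 0).basicOpen (1 : Γ(X.red 0, ⊤)) = ⊥ := by
    rw [h]; exact Scheme.basicOpen_zero ..
  rw [Scheme.basicOpen_of_isUnit _ isUnit_one] at h1
  exact h1.le (TopologicalSpace.Opens.mem_top x)

lemma system_map_injective {m n : ℕ} (h : m ⟶ n) : Function.Injective (X.system.map h) := 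
  (X.isClosedImmersion h).isClosedEmbedding.injective

/-- The ideal is nilpotent. Around a point outside the closed image, `1` restricts to `0` and so
equals `p ^ m * b`; its `n`-th power is then `0`. -/
lemma system_map_surjective {m n : ℕ} (hm : 0 < m) (h : m ⟶ n) :
    Function.Surjective (X.system.map h) := by
  have := X.isClosedImmersion h
  intro x
  by_contra hx
  have hcl := (X.system.map h).isClosedEmbedding.isClosed_range
  obtain ⟨U, hU, hxU, hUr⟩ := exists_isAffineOpen_mem_and_subset
    (U := ⟨_, hcl.isOpen_compl⟩) (x := x) hx
  have hbot : X.system.map h ⁻¹ᵁ U = ⊥ := by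
    refine le_bot_iff.1 fun z hz ↦ hUr hz ⟨z, rfl⟩
  have h0 : (X.system.map h).app U 1 = 0 := by
    have : Subsingleton Γ(X.red m, X.system.map h ⁻¹ᵁ U) := by
      rw [hbot]; infer_instance
    exact Subsingleton.elim _ _
  obtain ⟨b, hb⟩ := X.exists_eq_mul_of_app_eq_zero h le_rfl hU h0
  rw [map_one] at hb
  have h1 : (1 : Γ(X.red n, U)) = 0 := by
    rw [← one_pow n, hb, mul_pow, pow_right_comm, X.natCast_pow_eq_zero, zero_pow hm.ne', zero_mul]
  have h2 : (X.red n).basicOpen (1 : Γ(X.red n, U)) = ⊥ := by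
    rw [h1]; exact Scheme.basicOpen_zero ..
  rw [Scheme.basicOpen_of_isUnit _ isUnit_one] at h2
  exact h2.le hxU

lemma isOpenMap_system_map {m n : ℕ} (hm : 0 < m) (h : m ⟶ n) : IsOpenMap (X.system.map h) := by
  have := X.isClosedImmersion h
  exact ((X.system.map h).isClosedEmbedding.isEmbedding.toHomeomorphOfSurjective
    (X.system_map_surjective hm h)).isOpenMap

lemma isSmallThickening_system_map {m : ℕ} (hm : 0 < m) (h : m ⟶ m + 1) :
    IsSmallThickening p (X.system.map h) where
  isClosedImmersion := X.isClosedImmersion h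
  surjective := X.system_map_surjective hm h
  mul_eq_zero U a b ha hb := Scheme.eq_zero_of_affine _ fun V hV hVa ↦ by
    obtain ⟨a', ha'⟩ := X.exists_eq_mul_of_app_eq_zero h hV hVa ha
    obtain ⟨b', hb'⟩ := X.exists_eq_mul_of_app_eq_zero h hV hVa hb
    have h0 := X.natCast_pow_eq_zero (m + 1) V
    obtain ⟨k, rfl⟩ := Nat.exists_eq_add_of_le hm
    rw [map_mul, ha', hb']
    linear_combination (a' * b' * p ^ k) * h0
  natCast_mul_eq_zero U a ha := Scheme.eq_zero_of_affine _ fun V hV hVa ↦ by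
    obtain ⟨a', ha'⟩ := X.exists_eq_mul_of_app_eq_zero h hV hVa ha
    have h0 := X.natCast_pow_eq_zero (m + 1) V
    rw [map_mul, map_natCast, ha']
    linear_combination a' * h0

variable {X}

/-- An open subset of a formal scheme is affine if all its reductions are. -/
def Opens.IsAffine (U : X.Opens) : Prop := ∀ n, IsAffineOpen (U.toOpens n)

/-- Affineness descends from level `n` to level `1` along a closed immersion, then climbs to every
level through the small thickenings. -/
lemma Opens.isAffine_of_isAffineOpen (hp : p.Prime) (U : X.Opens) {n : ℕ} (hn : 0 < n)
    (h : IsAffineOpen (U.toOpens n)) : U.IsAffine := by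
  intro m
  induction m with
  | zero =>
    rw [show U.toOpens 0 = ⊥ from le_bot_iff.1 fun x ↦ isEmptyElim x]
    exact isAffineOpen_bot _
  | succ m ih =>
    rcases m.eq_zero_or_pos with rfl | hm
    · have := X.isClosedImmersion (homOfLE hn : 1 ⟶ n)
      rw [← U.preimage_eq (homOfLE hn : 1 ⟶ n)]
      exact h.preimage _
    · refine (X.isSmallThickening_system_map hm (homOfLE m.le_succ)).isAffineOpen hp m
        (X.natCast_pow_eq_zero m _) ?_
      rwa [U.preimage_eq]

/-- At level `m`, take the image of `O` in level `max m n` and pull it back; this treats `m ≤ n` and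
`n ≤ m` uniformly. -/
lemma exists_opens {n : ℕ} (hn : 0 < n) (O : (X.red n).Opens) :
    ∃ U : X.Opens, U.toOpens n = O := by
  have hO (k : ℕ) (h : n ≤ k) := X.isOpenMap_system_map hn (homOfLE h) _ O.isOpen
  have hU : ∀ {m k : ℕ} (h : m ⟶ k), X.system.map h ⁻¹ᵁ (X.system.map (homOfLE (le_max_left k n)) ⁻¹ᵁ
      ⟨_, hO (max k n) (le_max_right k n)⟩) = X.system.map (homOfLE (le_max_left m n)) ⁻¹ᵁ
      ⟨_, hO (max m n) (le_max_right m n)⟩ := by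
    intro m k h
    have hmk : max m n ≤ max k n := max_le_max_right n (leOfHom h)
    have key (a b c : ℕ) (h₁ : a ⟶ b) (h₂ : b ⟶ c) (x : X.red a) :
        X.system.map h₂ (X.system.map h₁ x) = X.system.map (h₁ ≫ h₂) x := by
      rw [Functor.map_comp]; rfl
    ext x
    refine exists_congr fun z ↦ and_congr_right fun _ ↦ ?_
    rw [key, ← (X.system_map_injective (homOfLE hmk)).eq_iff, key, key]
    rfl
  refine ⟨⟨fun m ↦ X.system.map (homOfLE (le_max_left m n)) ⁻¹ᵁ
      ⟨_, hO (max m n) (le_max_right m n)⟩, hU⟩, ?_⟩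
  ext x
  constructor
  · rintro ⟨z, hz, hzx⟩
    rwa [← X.system_map_injective _ hzx]
  · intro hx
    exact ⟨x, hx, rfl⟩

lemma exists_isAffine_mem (hp : p.Prime) {n : ℕ} (hn : 0 < n) {O : (X.red n).Opens} {x : X.red n}
    (hx : x ∈ O) : ∃ U : X.Opens, U.IsAffine ∧ x ∈ U.toOpens n ∧ U.toOpens n ≤ O := by
  obtain ⟨V, hV, hxV, hVO⟩ := exists_isAffineOpen_mem_and_subset hx
  obtain ⟨U, rfl⟩ := exists_opens hn V
  exact ⟨U, U.isAffine_of_isAffineOpen hp hn hV, hxV, hVO⟩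

/-- The preimage of an open subset under a morphism of formal schemes. -/
def preimage {Y : PadicFormalScheme.{u} p} (f : X ⟶ Y) (V : Y.Opens) : X.Opens where
  toOpens n := redMap f n ⁻¹ᵁ V.toOpens n
  preimage_eq {m n} h := by
    rw [← V.preimage_eq h, ← Scheme.Hom.comp_preimage, ← Scheme.Hom.comp_preimage]
    exact congrArg (· ⁻¹ᵁ _) ((InducedCategory.Hom.hom f).naturality h)

/-- Inclusions of open subsets can be checked modulo any positive power of `p`. -/
lemma Opens.le_of_le {U V : X.Opens} {n : ℕ} (hn : 0 < n) (h : U.toOpens n ≤ V.toOpens n)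
    (m : ℕ) : U.toOpens m ≤ V.toOpens m := by
  intro x hx
  rw [← U.preimage_eq (homOfLE (le_max_left m n))] at hx
  rw [← V.preimage_eq (homOfLE (le_max_left m n))]
  obtain ⟨z, hz⟩ := X.system_map_surjective hn (homOfLE (le_max_right m n))
    (X.system.map (homOfLE (le_max_left m n)) x)
  replace hx : X.system.map _ x ∈ U.toOpens (max m n) := hx
  change X.system.map _ x ∈ V.toOpens (max m n)
  rw [← hz] at hx ⊢
  exact (V.preimage_eq (homOfLE (le_max_right m n))).ge (h ((U.preimage_eq _).le hx))

end PadicFormalScheme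

/-- For `n > 0` every point comes from `X_1`, where the absolute Frobenius fixes all points. -/
lemma FormalPhiScheme.phiRed_apply {p : ℕ} (X : FormalPhiScheme.{u} p) (n : ℕ) (x : X.red n) :
    X.phiRed n x = x := by
  rcases n.eq_zero_or_pos with rfl | hn
  · exact isEmptyElim x
  · obtain ⟨z, rfl⟩ := X.toFormal.system_map_surjective one_pos (homOfLE hn : 1 ⟶ n) x
    have h := congrArg (fun m ↦ m z)
      ((InducedCategory.Hom.hom X.phi).naturality (homOfLE hn : 1 ⟶ n))
    refine h.trans ?_
    exact congrArg _ (X.isAbsoluteFrobenius.apply_eq z)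

/-! ### Sections over affine open subsets of `p`-adic formal schemes -/

namespace AlgebraicGeometry.Scheme.Hom

variable {X Y : Scheme.{u}}

lemma appLE_congr_hom {f g : X ⟶ Y} (hfg : f = g) {V : Y.Opens} {U : X.Opens}
    (h : U ≤ f ⁻¹ᵁ V) (a : Γ(Y, V)) : f.appLE V U h a = g.appLE V U (hfg ▸ h) a := by
  subst hfg; rfl

lemma appLE_surjective (f : X ⟶ Y) [IsClosedImmersion f] {V : Y.Opens} (hV : IsAffineOpen V)
    {U : X.Opens} (h : f ⁻¹ᵁ V = U) : Function.Surjective (f.appLE V U h.ge) := by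
  subst h
  rw [Scheme.Hom.appLE_eq_app]
  exact f.app_surjective V hV

lemma app_eq_zero_of_appLE_eq_zero (f : X ⟶ Y) {V : Y.Opens} {U : X.Opens} (h : f ⁻¹ᵁ V = U)
    (a : Γ(Y, V)) (ha : f.appLE V U h.ge a = 0) : f.app V a = 0 := by
  subst h
  rwa [Scheme.Hom.appLE_eq_app] at ha

lemma appLE_appLE {Z : Scheme.{u}} (f : X ⟶ Y) (g : Y ⟶ Z) {W : Z.Opens} {V : Y.Opens}
    {U : X.Opens} (h₁ : V ≤ g ⁻¹ᵁ W) (h₂ : U ≤ f ⁻¹ᵁ V) (a : Γ(Z, W)) :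
    f.appLE V U h₂ (g.appLE W V h₁ a) =
      (f ≫ g).appLE W U (h₂.trans (f.preimage_mono h₁)) a :=
  congrArg (fun m ↦ m.hom a) (appLE_comp_appLE f g W V U h₁ h₂)

end AlgebraicGeometry.Scheme.Hom

namespace PadicFormalScheme

variable {p : ℕ} {X Y : PadicFormalScheme.{u} p}

/-- The reduction of sections modulo `p ^ n`. -/
def proj (U : X.Opens) (n : ℕ) : X.sections U →+* Γ(X.red n, U.toOpens n) :=
  (Pi.evalRingHom _ n).comp (X.sections U).subtype

/-- The transition maps of the sections of the reductions. -/
def res (U : X.Opens) {m n : ℕ} (h : m ≤ n) :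
    Γ(X.red n, U.toOpens n) →+* Γ(X.red m, U.toOpens m) :=
  ((X.system.map (homOfLE h)).appLE (U.toOpens n) (U.toOpens m) (U.preimage_eq _).ge).hom

lemma res_proj (U : X.Opens) {m n : ℕ} (h : m ≤ n) (s : X.sections U) :
    res U h (proj U n s) = proj U m s := s.2 m n (homOfLE h)

lemma res_res (U : X.Opens) {k m n : ℕ} (h₁ : k ≤ m) (h₂ : m ≤ n) (a : Γ(X.red n, U.toOpens n)) :
    res U h₁ (res U h₂ a) = res U (h₁.trans h₂) a := by
  refine (Scheme.Hom.appLE_appLE _ _ _ _ a).trans ?_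
  exact Scheme.Hom.appLE_congr_hom (X.system.map_comp _ _).symm _ _

lemma res_self (U : X.Opens) (n : ℕ) (a : Γ(X.red n, U.toOpens n)) :
    res U (le_refl n) a = a := by
  refine (Scheme.Hom.appLE_congr_hom (X.system.map_id n) _ _).trans ?_
  exact congrArg (fun m ↦ m.hom a) (Scheme.Hom.appLE_eq_app (f := 𝟙 (X.red n)) (U := U.toOpens n))

lemma res_surjective {U : X.Opens} (hU : U.IsAffine) {m n : ℕ} (h : m ≤ n) :
    Function.Surjective (res U h) := by
  have := X.isClosedImmersion (homOfLE h)
  exact (X.system.map (homOfLE h)).appLE_surjective (hU n) (U.preimage_eq _)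

lemma exists_eq_mul_of_res_eq_zero {U : X.Opens} (hU : U.IsAffine) {m n : ℕ} (h : m ≤ n)
    {a : Γ(X.red n, U.toOpens n)} (ha : res U h a = 0) : ∃ b, a = p ^ m * b := by
  have : a ∈ RingHom.ker ((X.system.map (homOfLE h)).app (U.toOpens n)).hom :=
    (X.system.map (homOfLE h)).app_eq_zero_of_appLE_eq_zero (U.preimage_eq _) a ha
  rwa [X.ker_eq _ _ (hU n), Ideal.mem_span_singleton] at this

lemma sections_ext {U : X.Opens} {s t : X.sections U} (h : ∀ n, proj U n s = proj U n t) : s = t :=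
  Subtype.ext (funext h)

/-- The limit of a `p`-adic Cauchy sequence of sections. -/
lemma exists_limit {U : X.Opens} (t : ℕ → X.sections U)
    (ht : ∀ n, ∃ c, t (n + 1) = t n + p ^ n * c) : ∃ s, ∀ n, proj U n s = proj U n (t n) := by
  have h (m k : ℕ) : proj U m (t (m + k)) = proj U m (t m) := by
    induction k with
    | zero => rfl
    | succ k ih =>
      obtain ⟨c, hc⟩ := ht (m + k)
      rw [← add_assoc, hc, map_add, ih, map_mul, map_pow, map_natCast, pow_add,
        X.natCast_pow_eq_zero, zero_mul, zero_mul, add_zero]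
  refine ⟨⟨fun n ↦ proj U n (t n), fun m n hmn ↦ ?_⟩, fun n ↦ rfl⟩
  obtain ⟨k, rfl⟩ := Nat.exists_eq_add_of_le (leOfHom hmn)
  exact (res_proj U (leOfHom hmn) _).trans (h m k)

lemma proj_surjective {U : X.Opens} (hU : U.IsAffine) (m : ℕ) :
    Function.Surjective (proj U m) := by
  intro a
  choose l hl using fun n ↦ res_surjective hU (m + n).le_succ
  let x (n : ℕ) : Γ(X.red (m + n), U.toOpens (m + n)) := Nat.rec a (fun n b ↦ l n b) n
  have hx (n k : ℕ) (h : n ≤ k) : res U (Nat.add_le_add_left h m) (x k) = x n := by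
    induction k, h using Nat.le_induction with
    | base => exact res_self U _ _
    | succ k hnk ih =>
      rw [← ih]
      conv_rhs => rw [← hl k (x k), res_res]
  refine ⟨⟨fun n ↦ res U (Nat.le_add_left n m) (x n), fun k n hkn ↦ ?_⟩, ?_⟩
  · obtain ⟨d, rfl⟩ := Nat.exists_eq_add_of_le (leOfHom hkn)
    refine (res_res U (leOfHom hkn) _ _).trans ?_
    change _ = res U _ (x k)
    rw [← hx k (k + d) (Nat.le_add_right k d), res_res]
  · exact hx 0 m (Nat.zero_le m)

/-- The quotients of the components of `s` by `p ^ m` are not unique, hence need not be compatible.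
Instead a Cauchy sequence `t` is built with `s - p ^ m * t k` zero at level `m + k`, and its limit
is taken. -/
lemma exists_eq_mul_of_proj_eq_zero {U : X.Opens} (hU : U.IsAffine) (m : ℕ) {s : X.sections U}
    (hs : proj U m s = 0) : ∃ t, s = p ^ m * t := by
  have step (k : ℕ) (t : X.sections U) (ht : proj U (m + k) (s - p ^ m * t) = 0) :
      ∃ t' c, proj U (m + (k + 1)) (s - p ^ m * t') = 0 ∧ t' = t + p ^ k * c := by
    obtain ⟨b, hb⟩ := exists_eq_mul_of_res_eq_zero hU (m + k).le_succ ((res_proj U _ _).trans ht)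
    obtain ⟨c, rfl⟩ := proj_surjective hU (m + k + 1) b
    refine ⟨t + p ^ k * c, c, ?_, rfl⟩
    have : s - p ^ m * (t + p ^ k * c) = s - p ^ m * t - p ^ (m + k) * c := by ring
    have hpc : proj U (m + k + 1) ((p : X.sections U) ^ (m + k) * c) =
        p ^ (m + k) * proj U (m + k + 1) c := by rw [map_mul, map_pow, map_natCast]
    rw [this, map_sub]
    exact sub_eq_zero.2 (hb.trans hpc.symm)
  choose f c hf hfc using step
  let t (n : ℕ) : {t // proj U (m + n) (s - p ^ m * t) = 0} :=
    Nat.rec ⟨0, by simpa using hs⟩ (fun n t ↦ ⟨f n t.1 t.2, hf n t.1 t.2⟩) n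
  obtain ⟨l, hl⟩ := exists_limit (fun n ↦ (t n).1) fun n ↦ ⟨c n _ (t n).2, hfc n _ (t n).2⟩
  refine ⟨l, sections_ext fun n ↦ ?_⟩
  have h := congrArg (res U (Nat.le_add_left n m)) (t n).2
  rw [res_proj, map_zero, map_sub, sub_eq_zero] at h
  rw [h, map_mul, map_mul, hl]

/-- The map on sections induced by a morphism of formal schemes. -/
def sectionsMap (f : X ⟶ Y) (V : Y.Opens) (U : X.Opens)
    (h : ∀ n, U.toOpens n ≤ redMap f n ⁻¹ᵁ V.toOpens n) : Y.sections V →+* X.sections U :=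
  RingHom.codRestrict (RingHom.pi fun n ↦
    ((redMap f n).appLE (V.toOpens n) (U.toOpens n) (h n)).hom.comp (proj V n)) _ (by
  intro s m n hmn
  refine (Scheme.Hom.appLE_appLE _ _ _ _ _).trans ?_
  refine (Scheme.Hom.appLE_congr_hom ((InducedCategory.Hom.hom f).naturality hmn) _ _).trans ?_
  refine (Scheme.Hom.appLE_appLE _ _ (V.preimage_eq hmn).ge (h m) _).symm.trans ?_
  exact congrArg _ (s.2 m n hmn))

lemma proj_sectionsMap (f : X ⟶ Y) (V : Y.Opens) (U : X.Opens)
    (h : ∀ n, U.toOpens n ≤ redMap f n ⁻¹ᵁ V.toOpens n) (n : ℕ) (s : Y.sections V) :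
    proj U n (sectionsMap f V U h s) =
      (redMap f n).appLE (V.toOpens n) (U.toOpens n) (h n) (proj V n s) := rfl

/-- Surjectivity modulo `p` suffices: solve modulo `p`, divide the error by `p`, repeat, and pass to
the limit. -/
lemma sectionsMap_surjective (f : X ⟶ Y) (V : Y.Opens) (U : X.Opens) (hU : U.IsAffine)
    (hV : V.IsAffine) (h : ∀ n, U.toOpens n ≤ redMap f n ⁻¹ᵁ V.toOpens n)
    (hs : Function.Surjective ((redMap f 1).appLE (V.toOpens 1) (U.toOpens 1) (h 1))) :
    Function.Surjective (sectionsMap f V U h) := by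
  intro z
  have step (k : ℕ) (t : Y.sections V) (w : X.sections U)
      (ht : z = sectionsMap f V U h t + p ^ k * w) :
      ∃ t' w' c, z = sectionsMap f V U h t' + p ^ (k + 1) * w' ∧ t' = t + p ^ k * c := by
    obtain ⟨b, hb⟩ := hs (proj U 1 w)
    obtain ⟨c, rfl⟩ := proj_surjective hV 1 b
    obtain ⟨w', hw'⟩ := exists_eq_mul_of_proj_eq_zero hU 1 (s := w - sectionsMap f V U h c) (by
      rw [map_sub, proj_sectionsMap, hb, sub_self])
    refine ⟨t + p ^ k * c, w', c, ?_, rfl⟩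
    rw [map_add, map_mul, map_pow, map_natCast]
    linear_combination ht + (p : X.sections U) ^ k * hw'
  choose f' w c hf hfc using step
  let t (n : ℕ) : {t : Y.sections V × X.sections U // z = sectionsMap f V U h t.1 + p ^ n * t.2} :=
    Nat.rec ⟨⟨0, z⟩, by simp⟩ (fun n t ↦ ⟨⟨_, _⟩, hf n t.1.1 t.1.2 t.2⟩) n
  obtain ⟨l, hl⟩ := exists_limit (fun n ↦ (t n).1.1) fun n ↦ ⟨_, hfc n _ _ (t n).2⟩
  refine ⟨l, sections_ext fun n ↦ ?_⟩
  rw [proj_sectionsMap, hl, ← proj_sectionsMap]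
  conv_rhs => rw [(t n).2]
  rw [map_add, map_mul, map_pow, map_natCast, X.natCast_pow_eq_zero, zero_mul, add_zero]

/-- The morphism to the `n`-th reduction with values in an affine open subset given by a
homomorphism from the ring of sections. -/
noncomputable def redLift {U : X.Opens} (hU : U.IsAffine) (n : ℕ) {E : Type u} [CommRing E]
    (F : X.sections U →+* E) (hE : (p : E) ^ n = 0) : Γ(X.red n, U.toOpens n) →+* E :=
  (proj U n).liftOfSurjective (proj_surjective hU n) ⟨F, fun s hs ↦ by
    obtain ⟨t, rfl⟩ := exists_eq_mul_of_proj_eq_zero hU n hs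
    rw [RingHom.mem_ker, map_mul, map_pow, map_natCast, hE, zero_mul]⟩

lemma redLift_proj {U : X.Opens} (hU : U.IsAffine) (n : ℕ) {E : Type u} [CommRing E]
    (F : X.sections U →+* E) (hE : (p : E) ^ n = 0) (s : X.sections U) :
    redLift hU n F hE (proj U n s) = F s :=
  (proj U n).liftOfRightInverse_comp_apply _ _ ⟨F, _⟩ s

/-- The morphism to the `n`-th reduction with values in an affine open subset given by a
homomorphism from the ring of sections. -/
noncomputable def toRed {U : X.Opens} (hU : U.IsAffine) (n : ℕ) {E : Type u} [CommRing E]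
    (F : X.sections U →+* E) (hE : (p : E) ^ n = 0) : Spec (.of E) ⟶ X.red n :=
  Spec.map (CommRingCat.ofHom (redLift hU n F hE)) ≫ (hU n).fromSpec

/-- The criterion for a square of affine pieces to commute. -/
lemma toRed_comp {U : X.Opens} {V : Y.Opens} (hU : U.IsAffine) (hV : V.IsAffine) {m n : ℕ}
    {E : Type u} [CommRing E] (F : X.sections U →+* E) (hm : (p : E) ^ m = 0)
    (G : Y.sections V →+* E) (hn : (p : E) ^ n = 0) (g : X.red m ⟶ Y.red n)
    (hg : U.toOpens m ≤ g ⁻¹ᵁ V.toOpens n)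
    (h : ∀ b a, g.appLE _ _ hg (proj V n b) = proj U m a → F a = G b) :
    toRed hU m F hm ≫ g = toRed hV n G hn := by
  rw [toRed, Category.assoc, ← IsAffineOpen.SpecMap_appLE_fromSpec g (hV n) (hU m) hg,
    ← Category.assoc, ← Spec.map_comp, toRed]
  congr 2
  ext b
  obtain ⟨b, rfl⟩ := proj_surjective hV n b
  obtain ⟨a, ha⟩ := proj_surjective hU m (g.appLE _ _ hg (proj V n b))
  change redLift hU m F hm (g.appLE _ _ hg (proj V n b)) = redLift hV n G hn (proj V n b)
  rw [← ha, redLift_proj, redLift_proj]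
  exact h b a ha.symm

lemma apply_eq_of_proj_eq {U : X.Opens} (hU : U.IsAffine) {n : ℕ} {E : Type u} [CommRing E]
    (F : X.sections U →+* E) (hE : (p : E) ^ n = 0) {a b : X.sections U}
    (h : proj U n a = proj U n b) : F a = F b := by
  rw [← redLift_proj hU n F hE, h, redLift_proj]

lemma toRed_system_map {U : X.Opens} (hU : U.IsAffine) {m n : ℕ} {E : Type u} [CommRing E]
    (F : X.sections U →+* E) (hm : (p : E) ^ m = 0) (hn : (p : E) ^ n = 0) (h : m ⟶ n) :
    toRed hU m F hm ≫ X.system.map h = toRed hU n F hn :=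
  toRed_comp hU hU F hm F hn _ (U.preimage_eq h).ge fun _ _ hab ↦
    (apply_eq_of_proj_eq hU F hm ((res_proj U (leOfHom h) _).symm.trans hab)).symm

lemma toRed_redMap {U : X.Opens} {V : Y.Opens} (hU : U.IsAffine) (hV : V.IsAffine) {m : ℕ}
    {E : Type u} [CommRing E] (F : X.sections U →+* E) (hm : (p : E) ^ m = 0) (g : X ⟶ Y)
    (hg : ∀ n, U.toOpens n ≤ redMap g n ⁻¹ᵁ V.toOpens n) :
    toRed hU m F hm ≫ redMap g m = toRed hV m (F.comp (sectionsMap g V U hg)) hm :=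
  toRed_comp hU hV F hm _ hm _ (hg m) fun _ _ hab ↦ (apply_eq_of_proj_eq hU F hm hab).symm

lemma specMap_toRed {U : X.Opens} (hU : U.IsAffine) {m : ℕ} {E E' : Type u} [CommRing E]
    [CommRing E'] (F : X.sections U →+* E) (hm : (p : E) ^ m = 0) (e : E →+* E')
    (hm' : (p : E') ^ m = 0) :
    Spec.map (CommRingCat.ofHom e) ≫ toRed hU m F hm = toRed hU m (e.comp F) hm' := by
  rw [toRed, ← Category.assoc, ← Spec.map_comp, toRed]
  congr 2

/-- The sections of the reductions over an affine open subset. -/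
noncomputable def quoEquiv {U : X.Opens} (hU : U.IsAffine) (n : ℕ) :
    Quo (p ^ n) (X.sections U) ≃+* Γ(X.red n, U.toOpens n) :=
  (Ideal.quotEquivOfEq (by
    ext s
    rw [Ideal.mem_span_singleton, RingHom.mem_ker, Nat.cast_pow]
    constructor
    · rintro ⟨t, rfl⟩
      rw [map_mul, map_pow, map_natCast, X.natCast_pow_eq_zero, zero_mul]
    · exact exists_eq_mul_of_proj_eq_zero hU n)).trans
    (RingHom.quotientKerEquivOfSurjective (proj_surjective hU n))

lemma quoEquiv_mk {U : X.Opens} (hU : U.IsAffine) (n : ℕ) (s : X.sections U) :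
    quoEquiv hU n (Ideal.Quotient.mk _ s) = proj U n s := rfl

lemma formallySmooth_quo_map_sectionsMap (g : X ⟶ Y) {V : Y.Opens} {U : X.Opens} (hV : V.IsAffine)
    (hU : U.IsAffine) (h : ∀ n, U.toOpens n ≤ redMap g n ⁻¹ᵁ V.toOpens n) (n : ℕ)
    (hg : Smooth (redMap g n)) :
    (Quo.map (dvd_refl (p ^ n)) (sectionsMap g V U h)).FormallySmooth := by
  have h1 := ((redMap g n).smooth_appLE (hV n) (hU n) (h n)).formallySmooth
  have : Quo.map (dvd_refl (p ^ n)) (sectionsMap g V U h) = ((quoEquiv hU n).symm.toRingHom.comp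
      ((redMap g n).appLE _ _ (h n)).hom).comp (quoEquiv hV n).toRingHom := by
    ext s
    refine (quoEquiv hU n).injective ?_
    refine Eq.trans ?_ ((quoEquiv hU n).apply_symm_apply _).symm
    rfl
  rw [this]
  exact RingHom.FormallySmooth.respectsIso.2 _ _ (RingHom.FormallySmooth.respectsIso.1 _ _ h1)

end PadicFormalScheme

namespace FormalPhiScheme

open PadicFormalScheme

variable {p : ℕ} (X : FormalPhiScheme.{u} p)

lemma le_phi_preimage (U : X.toFormal.Opens) (n : ℕ) :
    U.toOpens n ≤ PadicFormalScheme.redMap X.phi n ⁻¹ᵁ U.toOpens n := fun x hx ↦ by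
  change X.phiRed n x ∈ U.toOpens n
  rwa [X.phiRed_apply]

/-- The Frobenius lifting on sections. -/
def frob (U : X.toFormal.Opens) : X.toFormal.sections U →+* X.toFormal.sections U :=
  sectionsMap X.phi U U (X.le_phi_preimage U)

lemma isFrobLift_frob {U : X.toFormal.Opens} (hU : U.IsAffine) : IsFrobLift p (X.frob U) := by
  intro a
  obtain ⟨b, hb⟩ := exists_eq_mul_of_proj_eq_zero hU 1 (s := X.frob U a - a ^ p) (by
    rw [map_sub, map_pow, sub_eq_zero]
    exact X.isAbsoluteFrobenius.appLE_eq _ _ _)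
  exact ⟨b, by rw [← sub_eq_iff_eq_add', hb, pow_one]⟩

variable {X} {Y : FormalPhiScheme.{u} p}

lemma sectionsMap_frob (g : X ⟶ Y) (V : Y.toFormal.Opens) (U : X.toFormal.Opens)
    (h : ∀ n, U.toOpens n ≤ redMap g n ⁻¹ᵁ V.toOpens n) (s : Y.toFormal.sections V) :
    sectionsMap g.toFormal V U h (Y.frob V s) = X.frob U (sectionsMap g.toFormal V U h s) := by
  refine sections_ext fun n ↦ ?_
  refine (Scheme.Hom.appLE_appLE _ _ _ (h n) _).trans ?_
  refine Eq.trans ?_ (Scheme.Hom.appLE_appLE _ _ (h n) _ _).symm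
  exact Scheme.Hom.appLE_congr_hom (congrArg (fun m ↦ PadicFormalScheme.redMap m n) g.comm.symm) _ _

end FormalPhiScheme

/-! ### Disjoint unions of affine formal `φ`-schemes -/

section SigmaMap

open Limits

variable {ι : Type u} {X Y : ι → Scheme.{u}}

lemma exists_sigmaι_eq (x : (∐ X : Scheme.{u})) : ∃ i z, Sigma.ι X i z = x :=
  ⟨(sigmaOpenCover X).idx x, (sigmaOpenCover X).covers x⟩

lemma isPullback_sigmaMap (f : ∀ i, X i ⟶ Y i) (i : ι) :
    IsPullback (f i) (Sigma.ι X i) (Sigma.ι Y i) (Limits.Sigma.map f) := by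
  refine IsOpenImmersion.isPullback _ _ _ _ (Sigma.ι_map f i) ?_
  apply le_antisymm
  · rintro x ⟨y, hxy⟩
    obtain ⟨j, z, rfl⟩ := exists_sigmaι_eq x
    rw [← Scheme.Hom.comp_apply, Sigma.ι_map, Scheme.Hom.comp_apply] at hxy
    have := congrArg Sigma.fst ((sigmaι_eq_iff _ _ _ _ _).1 hxy)
    obtain rfl : i = j := this
    exact ⟨z, rfl⟩
  · rintro _ ⟨z, rfl⟩
    exact ⟨f i z, by rw [← Scheme.Hom.comp_apply, ← Scheme.Hom.comp_apply, Sigma.ι_map]⟩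

lemma isClosedImmersion_sigmaMap (f : ∀ i, X i ⟶ Y i) (hf : ∀ i, IsClosedImmersion (f i)) :
    IsClosedImmersion (Limits.Sigma.map f) := by
  rw [IsZariskiLocalAtTarget.iff_of_openCover (P := @IsClosedImmersion) (sigmaOpenCover Y)]
  intro i
  have h := (isPullback_sigmaMap f i).flip
  have := h.isoPullback_hom_snd
  change IsClosedImmersion (pullback.snd (Limits.Sigma.map f) (Sigma.ι Y i))
  rw [← h.isoPullback_inv_snd]
  have := hf i
  infer_instance

lemma sigma_section_ext {U : (∐ X : Scheme.{u}).Opens} {s t : Γ(∐ X, U)}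
    (h : ∀ i, (Sigma.ι X i).app U s = (Sigma.ι X i).app U t) : s = t := by
  refine TopCat.Presheaf.section_ext (∐ X : Scheme.{u}).sheaf U s t fun x hx ↦ ?_
  obtain ⟨i, z, rfl⟩ := exists_sigmaι_eq x
  refine (ConcreteCategory.bijective_of_isIso ((Sigma.ι X i).stalkMap z)).1 ?_
  have h1 := congrArg ((X i).presheaf.germ (Sigma.ι X i ⁻¹ᵁ U) z hx) (h i)
  rw [← Scheme.Hom.germ_stalkMap_apply, ← Scheme.Hom.germ_stalkMap_apply] at h1
  exact h1

end SigmaMap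

/-- The kernel of `f` and the ideal sheaf generated by the global section `k` can be compared on the
affine cover `V`. An arbitrary affine open `W` then follows, even when it meets many pieces. -/
lemma ker_app_eq_span_natCast {ι : Type u} {X Y : Scheme.{u}} {U V : ι → Scheme.{u}} (f : X ⟶ Y)
    [IsClosedImmersion f] (f' : ∀ i, U i ⟶ V i) (iU : ∀ i, U i ⟶ X) (iV : ∀ i, V i ⟶ Y)
    [∀ i, IsAffine (V i)] [∀ i, IsOpenImmersion (iV i)] (H : ∀ i, IsPullback (f' i) (iU i) (iV i) f)
    (hc : ∀ y, ∃ i z, iV i z = y) (k : ℕ)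
    (hk : ∀ i, RingHom.ker (f' i).appTop.hom = Ideal.span {(k : Γ(V i, ⊤))})
    (W : Y.Opens) (hW : IsAffineOpen W) :
    RingHom.ker (f.app W).hom = Ideal.span {(k : Γ(Y, W))} := by
  have h : f.ker = Scheme.IdealSheafData.ofIdealTop (Ideal.span {(k : Γ(Y, ⊤))}) := by
    refine Scheme.IdealSheafData.ext_of_iSup_eq_top
      (fun i ↦ ⟨iV i ''ᵁ ⊤, (isAffineOpen_top (V i)).image_of_isOpenImmersion (iV i)⟩)
      (top_le_iff.1 fun y _ ↦ ?_) fun i ↦ ?_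
    · obtain ⟨i, z, rfl⟩ := hc y
      exact TopologicalSpace.Opens.mem_iSup.2 ⟨i, z, trivial, rfl⟩
    · have hb := ConcreteCategory.bijective_of_isIso ((iV i).appIso ⊤).inv
      refine Ideal.comap_injective_of_surjective ((iV i).appIso ⊤).inv.hom hb.2 ?_
      have : IsClosedImmersion (f' i) := MorphismProperty.of_isPullback (H i).flip inferInstance
      have h1 := Scheme.ker_ideal_of_isPullback_of_isOpenImmersion f (f' i) (iU i) (iV i) (H i)
        ⟨⊤, isAffineOpen_top _⟩
      refine h1.symm.trans ?_
      rw [Scheme.Hom.ker_apply]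
      refine (hk i).trans ?_
      rw [Scheme.IdealSheafData.ofIdealTop_ideal, Ideal.map_span, Set.image_singleton, map_natCast]
      ext a
      rw [Ideal.mem_comap, Ideal.mem_span_singleton, Ideal.mem_span_singleton]
      rw [← map_dvd_iff ((iV i).appIso ⊤).symm.commRingCatIsoToRingEquiv, map_natCast]
      rfl
  have h1 := f.ker_apply ⟨W, hW⟩
  rw [h] at h1
  refine h1.symm.trans ?_
  rw [Scheme.IdealSheafData.ofIdealTop_ideal, Ideal.map_span, Set.image_singleton, map_natCast]


lemma ker_specMap_appTop {R S : Type u} [CommRing R] [CommRing S] (f : R →+* S) (k : ℕ)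
    (hf : RingHom.ker f = Ideal.span {(k : R)}) :
    RingHom.ker (Spec.map (CommRingCat.ofHom f)).appTop.hom =
      Ideal.span {(k : Γ(Spec (.of R), ⊤))} := by
  have h := Scheme.ΓSpecIso_naturality (CommRingCat.ofHom f)
  have hb := ConcreteCategory.bijective_of_isIso (Scheme.ΓSpecIso (.of S)).hom
  ext a
  rw [Ideal.mem_span_singleton,
    ← map_dvd_iff (Scheme.ΓSpecIso (.of R)).commRingCatIsoToRingEquiv, map_natCast,
    ← Ideal.mem_span_singleton]
  change _ ↔ _ ∈ Ideal.span {(k : R)}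
  rw [← hf, RingHom.mem_ker, RingHom.mem_ker]
  have h1 := congrArg (fun m ↦ m.hom a) h
  constructor
  · intro ha
    refine h1.symm.trans ?_
    change (Scheme.ΓSpecIso (.of S)).hom ((Spec.map (CommRingCat.ofHom f)).appTop.hom a) = 0
    rw [ha, map_zero]
  · intro ha
    exact hb.1 ((h1.trans ha).trans (map_zero (Scheme.ΓSpecIso (.of S)).hom.hom).symm)

/-- The transition maps between the reductions of a ring. -/
abbrev Quo.res (p : ℕ) (A : Type*) [CommRing A] {m n : ℕ} (h : m ≤ n) :
    Quo (p ^ n) A →+* Quo (p ^ m) A := Quo.map (pow_dvd_pow p h) (RingHom.id A)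

lemma Quo.ker_res (p : ℕ) (A : Type*) [CommRing A] {m n : ℕ} (h : m ≤ n) :
    RingHom.ker (Quo.res p A h) = Ideal.span {((p ^ m : ℕ) : Quo (p ^ n) A)} := by
  ext a
  obtain ⟨a, rfl⟩ := Ideal.Quotient.mk_surjective a
  rw [RingHom.mem_ker, Quo.map_mk, Ideal.mem_span_singleton]
  constructor
  · intro ha
    obtain ⟨b, rfl⟩ := Quo.mk_eq_zero.1 ha
    exact ⟨Ideal.Quotient.mk _ b, by rw [map_mul, map_natCast]⟩
  · rintro ⟨b, hb⟩
    obtain ⟨b, rfl⟩ := Ideal.Quotient.mk_surjective b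
    rw [← Quo.map_mk (pow_dvd_pow p h) (RingHom.id A), hb, map_mul, map_natCast, Quo.map_mk,
      ← map_natCast (Ideal.Quotient.mk _), ← map_mul]
    exact Quo.mk_eq_zero.2 ⟨_, rfl⟩

/-- The reduction of `Spf A` modulo `p ^ m`. -/
noncomputable abbrev Quo.spec (p : ℕ) (A : Type u) [CommRing A] (m : ℕ) : Scheme.{u} :=
  Spec (.of (Quo (p ^ m) A))

/-- The transition maps between the reductions of `Spf A`. -/
noncomputable def Quo.specRes (p : ℕ) (A : Type u) [CommRing A] {m n : ℕ} (h : m ≤ n) :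
    Quo.spec p A m ⟶ Quo.spec p A n := Spec.map (CommRingCat.ofHom (Quo.res p A h))

lemma Quo.specRes_self (p : ℕ) (A : Type u) [CommRing A] (m : ℕ) :
    Quo.specRes p A (le_refl m) = 𝟙 _ := by
  rw [specRes, Quo.res, Quo.map_id, CommRingCat.ofHom_id, Spec.map_id]

lemma Quo.specRes_comp (p : ℕ) (A : Type u) [CommRing A] {k m n : ℕ} (h : k ≤ m) (h' : m ≤ n) :
    Quo.specRes p A h ≫ Quo.specRes p A h' = Quo.specRes p A (h.trans h') := by
  rw [specRes, specRes, specRes, ← Spec.map_comp, ← CommRingCat.ofHom_comp, Quo.res, Quo.res,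
    Quo.map_comp]

lemma Quo.isClosedImmersion_specRes (p : ℕ) (A : Type u) [CommRing A] {m n : ℕ} (h : m ≤ n) :
    IsClosedImmersion (Quo.specRes p A h) :=
  IsClosedImmersion.spec_of_surjective _ fun a ↦ by
    obtain ⟨a, rfl⟩ := Ideal.Quotient.mk_surjective a
    exact ⟨Ideal.Quotient.mk _ a, rfl⟩

open Limits in
/-- The system of reductions of `∐ Spf A i`. -/
noncomputable def sigmaSpfSystem (p : ℕ) {ι : Type u} (A : ι → Type u) [∀ i, CommRing (A i)] :
    ℕ ⥤ Scheme.{u} where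
  obj m := ∐ fun i ↦ Quo.spec p (A i) m
  map h := Limits.Sigma.map fun i ↦ Quo.specRes p (A i) (leOfHom h)
  map_id m := by
    refine Sigma.hom_ext _ _ fun i ↦ ?_
    rw [Sigma.ι_map, Quo.specRes_self, Category.id_comp, Category.comp_id]
  map_comp h h' := by
    refine Sigma.hom_ext _ _ fun i ↦ ?_
    rw [Sigma.ι_map, Sigma.ι_map_assoc, Sigma.ι_map, ← Category.assoc, Quo.specRes_comp]

/-- The formal scheme `∐ Spf A i`. -/
noncomputable def PadicFormalScheme.sigmaSpf (p : ℕ) {ι : Type u} (A : ι → Type u)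
    [∀ i, CommRing (A i)] : PadicFormalScheme.{u} p where
  system := sigmaSpfSystem p A
  isClosedImmersion h := isClosedImmersion_sigmaMap _ fun i ↦
    Quo.isClosedImmersion_specRes p (A i) (leOfHom h)
  ker_eq {m n} h U hU := by
    have := isClosedImmersion_sigmaMap _ fun i ↦
      Quo.isClosedImmersion_specRes p (A i) (leOfHom h)
    refine (ker_app_eq_span_natCast (Limits.Sigma.map fun i ↦ Quo.specRes p (A i) (leOfHom h)) _ _ _
      (fun i ↦ isPullback_sigmaMap _ i) exists_sigmaι_eq
      (p ^ m) (fun i ↦ ker_specMap_appTop _ _ (Quo.ker_res p (A i) (leOfHom h))) U hU).trans ?_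
    rw [Nat.cast_pow]
    rfl

/-! ### Torsion freeness of disjoint unions of affine formal schemes -/

lemma IsLocalization.exists_eq_natCast_mul {R : Type*} [CommRing R] (M : Submonoid R) (S : Type*)
    [CommRing S] [Algebra R S] [IsLocalization M S] {p c : ℕ}
    (h : ∀ x : R, p * x = 0 → ∃ y, x = c * y) (x : S) (hx : p * x = 0) : ∃ y, x = c * y := by
  obtain ⟨a, t, rfl⟩ := IsLocalization.exists_mk'_eq M x
  have h0 : IsLocalization.mk' S (p * a) t = 0 := by
    rw [← hx, ← map_natCast (algebraMap R S), IsLocalization.mul_mk'_eq_mk'_of_mul]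
  obtain ⟨u, hu⟩ := (IsLocalization.mk'_eq_zero_iff _ _).1 h0
  obtain ⟨y, hy⟩ := h (u * a) (by rw [← hu]; ring)
  refine ⟨IsLocalization.mk' S y (u * t), ?_⟩
  rw [← map_natCast (algebraMap R S), IsLocalization.mul_mk'_eq_mk'_of_mul, ← hy,
    mul_comm (u : R) a, mul_comm u t, IsLocalization.mk'_cancel]

lemma exists_eq_natCast_mul_of_stalk {R : Type u} [CommRing R] {p c : ℕ}
    (h : ∀ x : R, p * x = 0 → ∃ y, x = c * y) (x : Spec (.of R))
    (g : (Spec (.of R)).presheaf.stalk x) (hg : p * g = 0) : ∃ y, g = c * y := by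
  have key (x : PrimeSpectrum R) (g : (Spec.structureSheaf R).presheaf.stalk x) (hg : p * g = 0) :
      ∃ y, g = c * y := IsLocalization.exists_eq_natCast_mul x.asIdeal.primeCompl _ h g hg
  exact key x g hg

/-- Checked on stalks: the hypothesis on `p`-torsion passes to localizations, so each germ of `s` is
a multiple of `c`, which vanishes in `S`. -/
lemma specMap_app_eq_zero {R S : Type u} [CommRing R] [CommRing S] (f : R →+* S) {p c : ℕ}
    (h : ∀ x : R, p * x = 0 → ∃ y, x = c * y) (hc : (c : S) = 0) (W : (Spec (.of R)).Opens)
    (s : Γ(Spec (.of R), W)) (hs : p * s = 0) :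
    (Spec.map (CommRingCat.ofHom f)).app W s = 0 := by
  refine TopCat.Presheaf.section_ext (Spec (.of S)).sheaf _ _ _ fun x hx ↦ ?_
  have h1 := exists_eq_natCast_mul_of_stalk h (Spec.map (CommRingCat.ofHom f) x)
    ((Spec (.of R)).presheaf.germ W (Spec.map (CommRingCat.ofHom f) x) hx s) (by
      have := congrArg ((Spec (.of R)).presheaf.germ W (Spec.map (CommRingCat.ofHom f) x) hx) hs
      rwa [map_mul, map_natCast, map_zero] at this)
  obtain ⟨y, hy⟩ := h1
  have h2 : (c : (Spec (.of S)).presheaf.stalk x) = 0 := by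
    have := congrArg (StructureSheaf.toStalk S x).hom hc
    rwa [map_natCast, map_zero] at this
  refine ((Spec.map (CommRingCat.ofHom f)).germ_stalkMap_apply W x hx s).symm.trans ?_
  refine (congrArg _ hy).trans ?_
  rw [map_mul, map_natCast, h2, zero_mul]
  exact (map_zero ((Spec (.of S)).presheaf.germ _ x hx).hom).symm

namespace PadicFormalScheme

open Limits

variable {p : ℕ} {ι : Type u} {A : ι → Type u} [∀ i, CommRing (A i)]

/-- The reductions of the inclusions into a disjoint union. -/
noncomputable def sigmaι (p : ℕ) (A : ι → Type u) [∀ i, CommRing (A i)] (i : ι) (m : ℕ) :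
    Quo.spec p (A i) m ⟶ (sigmaSpf p A).red m := Sigma.ι (fun i ↦ Quo.spec p (A i) m) i

lemma sigmaι_system_map (i : ι) {m n : ℕ} (h : m ⟶ n) :
    sigmaι p A i m ≫ (sigmaSpf p A).system.map h = Quo.specRes p (A i) (leOfHom h) ≫ sigmaι p A i n :=
  Sigma.ι_map (fun i ↦ Quo.specRes p (A i) (leOfHom h)) i

/-- A morphism from a reduction of a disjoint union. -/
noncomputable def sigmaDescRed {m : ℕ} {Z : Scheme.{u}} (f : ∀ i, Quo.spec p (A i) m ⟶ Z) :
    (sigmaSpf p A).red m ⟶ Z := Sigma.desc f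

lemma sigmaι_descRed {m : ℕ} {Z : Scheme.{u}} (f : ∀ i, Quo.spec p (A i) m ⟶ Z) (i : ι) :
    sigmaι p A i m ≫ sigmaDescRed f = f i := Sigma.ι_desc f i

lemma sigma_red_hom_ext {m : ℕ} {X : Scheme.{u}} {f g : (sigmaSpf p A).red m ⟶ X}
    (h : ∀ i, sigmaι p A i m ≫ f = sigmaι p A i m ≫ g) : f = g := Sigma.hom_ext _ _ h

lemma exists_sigmaι_apply_eq {m : ℕ} (x : (sigmaSpf p A).red m) : ∃ i z, sigmaι p A i m z = x :=
  exists_sigmaι_eq x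

lemma sigma_red_section_ext {m : ℕ} {U : ((sigmaSpf p A).red m).Opens}
    {s t : Γ((sigmaSpf p A).red m, U)}
    (h : ∀ i, (sigmaι p A i m).app U s = (sigmaι p A i m).app U t) : s = t := sigma_section_ext h

variable {X : PadicFormalScheme.{u} p}

/-- A morphism from a disjoint union. -/
noncomputable def sigmaDesc (f : ∀ i m, Quo.spec p (A i) m ⟶ X.red m)
    (hf : ∀ i m n (h : m ⟶ n), f i m ≫ X.system.map h = Quo.specRes p (A i) (leOfHom h) ≫ f i n) :
    sigmaSpf p A ⟶ X :=
  InducedCategory.homMk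
    { app m := sigmaDescRed fun i ↦ f i m
      naturality m n h := sigma_red_hom_ext fun i ↦ by
        refine (Category.assoc _ _ _).symm.trans ?_
        refine (congrArg (· ≫ _) (sigmaι_system_map i h)).trans ?_
        refine (Category.assoc _ _ _).trans ?_
        rw [sigmaι_descRed, ← hf, ← Category.assoc, sigmaι_descRed] }

lemma sigmaι_redMap_sigmaDesc (f : ∀ i m, Quo.spec p (A i) m ⟶ X.red m)
    (hf : ∀ i m n (h : m ⟶ n), f i m ≫ X.system.map h = Quo.specRes p (A i) (leOfHom h) ≫ f i n)
    (i : ι) (m : ℕ) : sigmaι p A i m ≫ redMap (sigmaDesc f hf) m = f i m :=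
  sigmaι_descRed _ _

lemma sigmaSpf_hom_ext {f g : sigmaSpf p A ⟶ X}
    (h : ∀ i m, sigmaι p A i m ≫ redMap f m = sigmaι p A i m ≫ redMap g m) : f = g :=
  InducedCategory.hom_ext (NatTrans.ext (funext fun m ↦ sigma_red_hom_ext fun i ↦ h i m))

lemma specRes_app_eq_zero {A : Type u} [CommRing A] (hA : TorsionFreeMod p A) (n : ℕ)
    (W : (Quo.spec p A (n + 1)).Opens) (s : Γ(Quo.spec p A (n + 1), W)) (hs : p * s = 0) :
    (Quo.specRes p A n.le_succ).app W s = 0 := by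
  refine specMap_app_eq_zero (Quo.res p A n.le_succ) (p := p) (c := p ^ n) (fun x hx ↦ ?_) ?_ W s hs
  · obtain ⟨x, rfl⟩ := Ideal.Quotient.mk_surjective x
    rw [← map_natCast (Ideal.Quotient.mk _), ← map_mul, Quo.mk_eq_zero] at hx
    obtain ⟨b, hb⟩ := hx
    rw [Nat.cast_pow] at hb
    obtain ⟨z, rfl⟩ := hA n x b hb
    exact ⟨Ideal.Quotient.mk _ z, by simp⟩
  · rw [← map_natCast (Ideal.Quotient.mk _), Quo.mk_eq_zero]
    exact ⟨1, (mul_one _).symm⟩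

lemma app_proj_eq_zero {S T : Scheme.{u}} (U : X.Opens) {m n : ℕ} (h : m ≤ n) (a : S ⟶ X.red m)
    (b : T ⟶ X.red n) (r : S ⟶ T) (hr : a ≫ X.system.map (homOfLE h) = r ≫ b) (s : X.sections U)
    (hs : r.app (b ⁻¹ᵁ U.toOpens n) (b.app (U.toOpens n) (proj U n s)) = 0) :
    a.app (U.toOpens m) (proj U m s) = 0 := by
  have hle : a ⁻¹ᵁ U.toOpens m ≤ r ⁻¹ᵁ b ⁻¹ᵁ U.toOpens n := by
    rw [← U.preimage_eq (homOfLE h), ← Scheme.Hom.comp_preimage, ← Scheme.Hom.comp_preimage, hr]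
  have h1 : a.app (U.toOpens m) (proj U m s) =
      r.appLE (b ⁻¹ᵁ U.toOpens n) (a ⁻¹ᵁ U.toOpens m) hle (b.app (U.toOpens n) (proj U n s)) := by
    rw [← Scheme.Hom.appLE_eq_app, ← Scheme.Hom.appLE_eq_app, ← res_proj U h s]
    refine (Scheme.Hom.appLE_appLE a _ _ _ _).trans ?_
    refine (Scheme.Hom.appLE_congr_hom hr _ _).trans ?_
    exact (Scheme.Hom.appLE_appLE r _ le_rfl hle _).symm
  rw [h1]
  refine (congrArg (S.presheaf.map (homOfLE hle).op) hs).trans ?_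
  exact map_zero (S.presheaf.map _).hom

/-- The reductions do have `p`-torsion, but on level `n + 1` it consists of multiples of `p ^ n` and
dies on level `n`. Every component of a section is the restriction of the next one. -/
lemma isTorsionFree_sigmaSpf (hA : ∀ i, TorsionFreeMod p (A i)) :
    (sigmaSpf p A).IsTorsionFree := by
  intro U s hs
  refine sections_ext fun n ↦ ?_
  rw [map_zero]
  refine sigma_red_section_ext fun i ↦ ?_
  refine (app_proj_eq_zero U n.le_succ (sigmaι p A i n) (sigmaι p A i (n + 1))
    (Quo.specRes p (A i) n.le_succ) (sigmaι_system_map i _) s ?_).trans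
    (map_zero ((sigmaι p A i n).app (U.toOpens n)).hom).symm
  refine specRes_app_eq_zero (hA i) n _ _ ?_
  have h1 := congrArg (proj U (n + 1)) hs
  have h2 := congrArg ((sigmaι p A i (n + 1)).app (U.toOpens (n + 1))) h1
  rwa [map_mul, map_mul, map_zero, map_zero, map_natCast, map_natCast] at h2

end PadicFormalScheme

/-- On a basic open a section is a fraction of global ones, so the formula follows by clearing the
denominator. Basic opens are stable under `G` because `f` and `f ^ p` define the same one. -/
lemma appLE_eq_pow_of_appTop_eq_pow {X : Scheme.{u}} [IsAffine X] {G : X ⟶ X} {p : ℕ} (hp : p.Prime)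
    (hG : ∀ a, G.appTop a = a ^ p) (U : X.Opens) (h : U ≤ G ⁻¹ᵁ U) (s : Γ(X, U)) :
    G.appLE U U h s = s ^ p := by
  have key (f : Γ(X, ⊤)) (hf : X.basicOpen f ≤ G ⁻¹ᵁ X.basicOpen f) (t : Γ(X, X.basicOpen f)) :
      G.appLE _ _ hf t = t ^ p := by
    have := (isAffineOpen_top X).isLocalization_basicOpen f
    have hr (a : Γ(X, ⊤)) : G.appLE _ _ hf (algebraMap _ Γ(X, X.basicOpen f) a) =
        algebraMap _ Γ(X, X.basicOpen f) a ^ p := by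
      rw [← map_pow, ← hG]
      exact congrArg (fun m ↦ m.hom a) (G.map_appLE hf (homOfLE le_top).op)
    obtain ⟨⟨a, b⟩, hab⟩ := IsLocalization.surj (Submonoid.powers f) t
    have hu := (IsLocalization.map_units Γ(X, X.basicOpen f) b).pow p
    refine hu.mul_left_injective ?_
    change _ * _ = _ * _
    rw [← mul_pow, hab, ← hr, ← hr, ← map_mul, hab]
  choose f hfU hxf using fun x : U ↦ (isAffineOpen_top X).exists_basicOpen_le x trivial
  have hle (x) : X.basicOpen (f x) ≤ G ⁻¹ᵁ X.basicOpen (f x) := by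
    rw [Scheme.preimage_basicOpen]
    exact ((congrArg X.basicOpen (hG (f x))).trans (X.basicOpen_pow (f x) hp.pos)).ge
  refine X.sheaf.eq_of_locally_eq' (fun x ↦ X.basicOpen (f x)) U (fun x ↦ homOfLE (hfU x))
    (fun x hx ↦ TopologicalSpace.Opens.mem_iSup.2 ⟨⟨x, hx⟩, hxf _⟩) _ _ fun x ↦ ?_
  have h1 := key (f x) (hle x) (X.presheaf.map (homOfLE (hfU x)).op s)
  rw [← map_pow] at h1
  refine Eq.trans ?_ h1
  exact (congrArg (fun m ↦ m.hom s) (G.appLE_map h (homOfLE (hfU x)).op)).trans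
    (congrArg (fun m ↦ m.hom s) (G.map_appLE (hle x) (homOfLE (hfU x)).op)).symm

lemma isAbsoluteFrobenius_specMap {R : Type u} [CommRing R] {p : ℕ} (hp : p.Prime) (φ : R →+* R)
    (hφ : ∀ a, φ a = a ^ p) : IsAbsoluteFrobenius p (Spec.map (CommRingCat.ofHom φ)) where
  apply_eq x := by
    refine PrimeSpectrum.ext (Ideal.ext fun a ↦ ?_)
    change φ a ∈ x.asIdeal ↔ _
    rw [hφ]
    exact x.2.pow_mem_iff_mem p hp.pos
  appLE_eq U h s := by
    have hG (a : Γ(Spec (.of R), ⊤)) : (Spec.map (CommRingCat.ofHom φ)).appTop a = a ^ p := by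
      have h := Scheme.ΓSpecIso_naturality (CommRingCat.ofHom φ)
      refine (ConcreteCategory.bijective_of_isIso (Scheme.ΓSpecIso (.of R)).hom).1 ?_
      refine (congrArg (fun m ↦ m.hom a) h).trans ?_
      rw [map_pow]
      exact hφ _
    exact appLE_eq_pow_of_appTop_eq_pow hp hG U h s

lemma IsAbsoluteFrobenius.sigmaMap {ι : Type u} {X : ι → Scheme.{u}} {p : ℕ} {F : ∀ i, X i ⟶ X i}
    (hF : ∀ i, IsAbsoluteFrobenius p (F i)) : IsAbsoluteFrobenius p (Limits.Sigma.map F) where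
  apply_eq x := by
    obtain ⟨i, z, rfl⟩ := exists_sigmaι_eq x
    rw [← Scheme.Hom.comp_apply, Limits.Sigma.ι_map, Scheme.Hom.comp_apply, (hF i).apply_eq]
  appLE_eq U h s := sigma_section_ext fun i ↦ by
    have hle : Limits.Sigma.ι X i ⁻¹ᵁ U ≤ F i ⁻¹ᵁ Limits.Sigma.ι X i ⁻¹ᵁ U := fun x hx ↦ by
      change F i x ∈ Limits.Sigma.ι X i ⁻¹ᵁ U
      rwa [(hF i).apply_eq]
    rw [← Scheme.Hom.appLE_eq_app, Scheme.Hom.appLE_appLE,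
      Scheme.Hom.appLE_congr_hom (Limits.Sigma.ι_map F i), map_pow,
      ← Scheme.Hom.appLE_appLE (F i) _ le_rfl hle, (hF i).appLE_eq]

/-- The morphism between reductions induced by a homomorphism. -/
noncomputable def Quo.specMap (p : ℕ) {A B : Type u} [CommRing A] [CommRing B] (f : A →+* B)
    (m : ℕ) : Quo.spec p B m ⟶ Quo.spec p A m :=
  Spec.map (CommRingCat.ofHom (Quo.map (dvd_refl (p ^ m)) f))

lemma Quo.specMap_comp (p : ℕ) {A B C : Type u} [CommRing A] [CommRing B] [CommRing C] (f : A →+* B)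
    (g : B →+* C) (m : ℕ) :
    Quo.specMap p g m ≫ Quo.specMap p f m = Quo.specMap p (g.comp f) m := by
  rw [specMap, specMap, specMap, ← Spec.map_comp, ← CommRingCat.ofHom_comp, Quo.map_comp]

lemma Quo.specMap_specRes (p : ℕ) {A B : Type u} [CommRing A] [CommRing B] (f : A →+* B)
    {m n : ℕ} (h : m ≤ n) :
    Quo.specMap p f m ≫ Quo.specRes p A h = Quo.specRes p B h ≫ Quo.specMap p f n := by
  rw [specMap, specMap, specRes, specRes, ← Spec.map_comp, ← Spec.map_comp,
    ← CommRingCat.ofHom_comp, ← CommRingCat.ofHom_comp, Quo.map_comp, Quo.map_comp]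

namespace PadicFormalScheme

variable {p : ℕ} {ι : Type u} {A B C : ι → Type u} [∀ i, CommRing (A i)] [∀ i, CommRing (B i)]

/-- The morphism of disjoint unions induced by a family of homomorphisms. -/
noncomputable def sigmaSpfMap (p : ℕ) (f : ∀ i, A i →+* B i) : sigmaSpf p B ⟶ sigmaSpf p A :=
  sigmaDesc (fun i m ↦ Quo.specMap p (f i) m ≫ sigmaι p A i m) fun i m n h ↦ by
    rw [Category.assoc, sigmaι_system_map, ← Category.assoc, ← Category.assoc, Quo.specMap_specRes]

lemma sigmaι_redMap_sigmaSpfMap (f : ∀ i, A i →+* B i) (i : ι) (m : ℕ) :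
    sigmaι p B i m ≫ redMap (sigmaSpfMap p f) m = Quo.specMap p (f i) m ≫ sigmaι p A i m :=
  sigmaι_redMap_sigmaDesc _ _ i m

end PadicFormalScheme

namespace FormalPhiScheme

open PadicFormalScheme

variable {p : ℕ} (hp : p.Prime) {ι : Type u} {A B : ι → Type u} [∀ i, CommRing (A i)]
  [∀ i, CommRing (B i)] (φ : ∀ i, A i →+* A i) (hφ : ∀ i, IsFrobLift p (φ i))
  (hA : ∀ i, TorsionFreeMod p (A i)) (ψ : ∀ i, B i →+* B i) (hψ : ∀ i, IsFrobLift p (ψ i))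
  (hB : ∀ i, TorsionFreeMod p (B i))

/-- The formal `φ`-scheme `∐ Spf A i`. -/
noncomputable def sigmaSpf : FormalPhiScheme.{u} p where
  toFormal := .sigmaSpf p A
  torsionFree := isTorsionFree_sigmaSpf hA
  phi := sigmaSpfMap p φ
  isAbsoluteFrobenius := by
    have h : PadicFormalScheme.redMap (sigmaSpfMap p φ) 1 = Limits.Sigma.map fun i ↦ Quo.specMap p (φ i) 1 :=
      sigma_red_hom_ext fun i ↦ (sigmaι_redMap_sigmaSpfMap φ i 1).trans
        (Limits.Sigma.ι_map (fun i ↦ Quo.specMap p (φ i) 1) i).symm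
    rw [h]
    refine IsAbsoluteFrobenius.sigmaMap fun i ↦ isAbsoluteFrobenius_specMap hp _ fun a ↦ ?_
    obtain ⟨a, rfl⟩ := Ideal.Quotient.mk_surjective a
    rw [Quo.map_mk, ← map_pow, Quo.mk_eq_mk, pow_one]
    exact hφ i a

variable {X : FormalPhiScheme.{u} p}

/-- A morphism from a disjoint union of affine formal `φ`-schemes. -/
noncomputable def sigmaDesc (f : ∀ i m, Quo.spec p (A i) m ⟶ X.red m)
    (hf : ∀ i m n (h : m ⟶ n), f i m ≫ X.toFormal.system.map h =
      Quo.specRes p (A i) (leOfHom h) ≫ f i n)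
    (hf' : ∀ i m, f i m ≫ X.phiRed m = Quo.specMap p (φ i) m ≫ f i m) :
    sigmaSpf hp φ hφ hA ⟶ X where
  toFormal := PadicFormalScheme.sigmaDesc f hf
  comm := sigmaSpf_hom_ext fun i m ↦ by
    change sigmaι p A i m ≫ PadicFormalScheme.redMap (sigmaSpfMap p φ) m ≫
      PadicFormalScheme.redMap (PadicFormalScheme.sigmaDesc f hf) m = sigmaι p A i m ≫
      PadicFormalScheme.redMap (PadicFormalScheme.sigmaDesc f hf) m ≫ X.phiRed m
    rw [← Category.assoc, sigmaι_redMap_sigmaSpfMap, Category.assoc, ← Category.assoc (sigmaι p A i m),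
      sigmaι_redMap_sigmaDesc, hf']

/-- The morphism of disjoint unions induced by a family of homomorphisms. -/
noncomputable def sigmaMap (f : ∀ i, A i →+* B i) (hf : ∀ i a, f i (φ i a) = ψ i (f i a)) :
    sigmaSpf hp ψ hψ hB ⟶ sigmaSpf hp φ hφ hA where
  toFormal := sigmaSpfMap p f
  comm := sigmaSpf_hom_ext fun i m ↦ by
    change sigmaι p B i m ≫ PadicFormalScheme.redMap (sigmaSpfMap p ψ) m ≫
      PadicFormalScheme.redMap (sigmaSpfMap p f) m = sigmaι p B i m ≫
      PadicFormalScheme.redMap (sigmaSpfMap p f) m ≫ PadicFormalScheme.redMap (sigmaSpfMap p φ) m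
    rw [← Category.assoc, sigmaι_redMap_sigmaSpfMap, Category.assoc, sigmaι_redMap_sigmaSpfMap,
      ← Category.assoc (sigmaι p B i m), sigmaι_redMap_sigmaSpfMap, Category.assoc,
      sigmaι_redMap_sigmaSpfMap, ← Category.assoc, ← Category.assoc, Quo.specMap_comp,
      Quo.specMap_comp]
    congr 2
    ext a
    exact (hf i a).symm

end FormalPhiScheme

/-! ### Faithfully flat covers and the lifting theorem -/

lemma Quo.natCast_pow_eq_zero (p m : ℕ) (A : Type*) [CommRing A] :
    (p : Quo (p ^ m) A) ^ m = 0 := by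
  rw [← Nat.cast_pow, ← map_natCast (Ideal.Quotient.mk _), Quo.mk_eq_zero]
  exact ⟨1, (mul_one _).symm⟩

namespace PadicFormalScheme

variable {p : ℕ} {X : PadicFormalScheme.{u} p} {U : X.Opens} (hU : U.IsAffine) {A : Type u}
  [CommRing A] (j : X.sections U →+* A)

/-- The morphism from an affine formal scheme given by a homomorphism from the ring of sections
over an affine open subset. -/
noncomputable def toSpf (m : ℕ) : Quo.spec p A m ⟶ X.red m :=
  toRed hU m ((Ideal.Quotient.mk _).comp j) (Quo.natCast_pow_eq_zero p m A)

variable {j} (hj : IsFaithfullyFlatMod p j)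

include hj

lemma flat_toSpf (m : ℕ) : Flat (toSpf hU j m) := by
  have h : redLift hU m ((Ideal.Quotient.mk _).comp j) (Quo.natCast_pow_eq_zero p m A) =
      (Quo.map (dvd_refl (p ^ m)) j).comp (quoEquiv hU m).symm.toRingHom := by
    ext s
    obtain ⟨s, rfl⟩ := proj_surjective hU m s
    rw [redLift_proj]
    have h1 := (quoEquiv hU m).symm_apply_apply (Ideal.Quotient.mk _ s)
    exact (congrArg (Quo.map (dvd_refl (p ^ m)) j) h1).symm
  have h1 : Flat (Spec.map (CommRingCat.ofHom (redLift hU m ((Ideal.Quotient.mk _).comp j)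
      (Quo.natCast_pow_eq_zero p m A)))) := by
    rw [HasRingHomProperty.Spec_iff (P := @Flat), h]
    exact (RingHom.Flat.of_bijective (quoEquiv hU m).symm.bijective).comp (hj.flat m)
  rw [toSpf, toRed]
  infer_instance

/-- A point of `U` at level `m` is a prime of the ring of sections containing `p`. A prime of `A`
above it contains `p`, hence `p ^ m`, and so descends to the quotient. -/
lemma exists_toSpf_apply_eq (m : ℕ) (x : X.red m) (hx : x ∈ U.toOpens m) :
    ∃ z, toSpf hU j m z = x := by
  rw [← SetLike.mem_coe, ← (hU m).range_fromSpec] at hx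
  obtain ⟨q, rfl⟩ := hx
  have hq : (p : X.sections U) ∈ q.asIdeal.comap (proj U m) := by
    refine (q.2.comap (proj U m)).mem_of_pow_mem m ?_
    rw [Ideal.mem_comap, map_pow, map_natCast, X.natCast_pow_eq_zero]
    exact zero_mem _
  have := q.2
  -- Needed because `p ^ 0 = 1` lies in no prime; level `0` is empty.
  have hm0 : m ≠ 0 := fun h ↦ by
    subst h
    exact isEmptyElim ((hU 0).fromSpec q)
  obtain ⟨r, hr, hrq⟩ := hj.exists_comap_eq _ hq
  have hpr : (p : A) ∈ r := by
    rw [← map_natCast j, ← Ideal.mem_comap, hrq]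
    exact hq
  have hle : RingHom.ker (Ideal.Quotient.mk (Ideal.span {((p ^ m : ℕ) : A)})) ≤ r := by
    rw [Ideal.mk_ker, Ideal.span_singleton_le_iff_mem, Nat.cast_pow]
    exact Ideal.pow_mem_of_mem r hpr m (Nat.pos_of_ne_zero hm0)
  have hr' := Ideal.map_isPrime_of_surjective Ideal.Quotient.mk_surjective hle
  refine ⟨⟨_, hr'⟩, ?_⟩
  refine congrArg (hU m).fromSpec (PrimeSpectrum.ext (Ideal.ext fun a ↦ ?_))
  obtain ⟨a, rfl⟩ := proj_surjective hU m a
  change redLift hU m ((Ideal.Quotient.mk (Ideal.span {((p ^ m : ℕ) : A)})).comp j)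
    (Quo.natCast_pow_eq_zero p m A) (proj U m a) ∈ r.map _ ↔ _
  rw [redLift_proj, RingHom.comp_apply, ← Ideal.mem_comap,
    Ideal.comap_map_of_surjective _ Ideal.Quotient.mk_surjective, ← RingHom.ker_eq_comap_bot,
    sup_eq_left.2 hle, ← Ideal.mem_comap, hrq]
  rfl

end PadicFormalScheme

namespace FormalPhiScheme

open PadicFormalScheme

section Lift

variable {p : ℕ} (hp : p.Prime) {ι : Type u} {A : ι → Type u} [∀ i, CommRing (A i)]
  (φ : ∀ i, A i →+* A i) (hφ : ∀ i, IsFrobLift p (φ i)) (hA : ∀ i, TorsionFreeMod p (A i))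
  {X : FormalPhiScheme.{u} p} {U : ι → X.toFormal.Opens} (hU : ∀ i, (U i).IsAffine)

/-- The morphism from a disjoint union of affine formal `φ`-schemes given by compatible families of
homomorphisms from rings of sections over affine open subsets. -/
noncomputable def sigmaLift (F : ∀ i m, X.toFormal.sections (U i) →+* Quo (p ^ m) (A i))
    (hF : ∀ i m n (h : m ≤ n), (Quo.res p (A i) h).comp (F i n) = F i m)
    (hF' : ∀ i m b, F i m (X.frob (U i) b) = Quo.map (dvd_refl _) (φ i) (F i m b)) :
    sigmaSpf hp φ hφ hA ⟶ X :=
  sigmaDesc hp φ hφ hA (fun i m ↦ toRed (hU i) m (F i m) (Quo.natCast_pow_eq_zero p m _))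
    (fun i m n h ↦ by
      have hn : (p : Quo (p ^ m) (A i)) ^ n = 0 := by
        rw [← map_natCast (Quo.res p (A i) (leOfHom h)), ← map_pow, Quo.natCast_pow_eq_zero, map_zero]
      rw [toRed_system_map _ _ _ hn, Quo.specRes, specMap_toRed _ _ _ _ hn]
      congr 1
      exact (hF i m n (leOfHom h)).symm)
    (fun i m ↦ by
      rw [Quo.specMap, specMap_toRed _ _ _ _ (Quo.natCast_pow_eq_zero p m _)]
      refine (toRed_redMap (hU i) (hU i) _ _ _ (X.le_phi_preimage (U i))).trans ?_
      congr 1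
      exact RingHom.ext (hF' i m))

lemma sigmaι_redMap_sigmaLift (F : ∀ i m, X.toFormal.sections (U i) →+* Quo (p ^ m) (A i))
    (hF : ∀ i m n (h : m ≤ n), (Quo.res p (A i) h).comp (F i n) = F i m)
    (hF' : ∀ i m b, F i m (X.frob (U i) b) = Quo.map (dvd_refl _) (φ i) (F i m b)) (i : ι) (m : ℕ) :
    sigmaι p A i m ≫ redMap (sigmaLift hp φ hφ hA hU F hF hF') m =
      toRed (hU i) m (F i m) (Quo.natCast_pow_eq_zero p m _) :=
  sigmaι_descRed _ i

/-- The morphism from a disjoint union of affine formal `φ`-schemes given by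
homomorphisms from rings of sections over affine open subsets. -/
noncomputable def sigmaToSpf (j : ∀ i, X.toFormal.sections (U i) →+* A i)
    (hj : ∀ i b, j i (X.frob (U i) b) = φ i (j i b)) : sigmaSpf hp φ hφ hA ⟶ X :=
  sigmaLift hp φ hφ hA hU (fun i m ↦ (Ideal.Quotient.mk _).comp (j i)) (fun i m n h ↦ rfl)
    fun i m b ↦ by rw [RingHom.comp_apply, hj]; rfl

lemma sigmaι_redMap_sigmaToSpf (j : ∀ i, X.toFormal.sections (U i) →+* A i)
    (hj : ∀ i b, j i (X.frob (U i) b) = φ i (j i b)) (i : ι) (m : ℕ) :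
    sigmaι p A i m ≫ redMap (sigmaToSpf hp φ hφ hA hU j hj) m = toSpf (hU i) (j i) m :=
  sigmaι_descRed _ i

lemma isPCompletelyFaithfullyFlat_sigmaToSpf (j : ∀ i, X.toFormal.sections (U i) →+* A i)
    (hj : ∀ i b, j i (X.frob (U i) b) = φ i (j i b)) (hff : ∀ i, IsFaithfullyFlatMod p (j i))
    (hcov : ∀ m (x : X.red m), ∃ i, x ∈ (U i).toOpens m) :
    IsPCompletelyFaithfullyFlat (sigmaToSpf hp φ hφ hA hU j hj) := by
  intro m
  constructor
  · have h (i) := flat_toSpf (hU i) (hff i) m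
    exact inferInstanceAs (Flat (Limits.Sigma.desc fun i ↦ toSpf (hU i) (j i) m))
  · refine ⟨fun x ↦ ?_⟩
    obtain ⟨i, hi⟩ := hcov m x
    obtain ⟨z, hz⟩ := exists_toSpf_apply_eq (hU i) (hff i) m x hi
    rw [← sigmaι_redMap_sigmaToSpf hp φ hφ hA hU j hj] at hz
    exact ⟨sigmaι p A i m z, hz⟩

end Lift

end FormalPhiScheme

/-! ### The lifting theorem -/

namespace FrobCover

variable {p : ℕ} {A B C R : Type u} [CommRing A] [CommRing B] [CommRing C] [CommRing R]
  {φA : A →+* A} {φB : B →+* B} {φC : C →+* C} {φR : R →+* R}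

/-- Lifting to all powers of `p` after passage to the Frobenius cover. -/
lemma exists_lift_system (hp : p.Prime) (hφA : IsFrobLift p φA) (hφB : IsFrobLift p φB)
    (hφC : IsFrobLift p φC) {c : A →+* C} (hc : Function.Surjective c)
    (hC : ∀ x : C, p * x = 0 → x = 0) (hcφ : ∀ a, c (φA a) = φC (c a)) {ρ : R →+* B}
    (hsmooth : ∀ m, (Quo.map (dvd_refl (p ^ m)) ρ).FormallySmooth)
    (hρφ : ∀ r, ρ (φR r) = φB (ρ r)) {s : R →+* A} (hs : ∀ r, s (φR r) = φA (s r)) {g : B →+* C}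
    (hgρ : ∀ r, g (ρ r) = c (s r)) (hgφ : ∀ b, g (φB b) = φC (g b)) {n : ℕ} (hn : 0 < n)
    {f : B →+* Quo (p ^ n) A} (hf : IsCompatibleMod p n φA c ρ φB s g f) :
    ∃ F : ∀ m, B →+* Quo (p ^ m) (ring hφA id),
      (∀ m, IsCompatibleMod p m (frob hφA id) (map hφA hφC c hp hC hcφ) ρ φB
        ((inl hφA id).comp s) ((inl hφC (family c)).comp g) (F m)) ∧
      F n = (Quo.map (dvd_refl _) (inl hφA id)).comp f ∧
      ∀ m k (h : m ≤ k), (Quo.map (pow_dvd_pow p h) (RingHom.id _)).comp (F k) = F m := by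
  refine IsCompatibleMod.exists_system hp (map_surjective _ _ _ _ _ _ hc) (map_frob _ _ _ _ _ _)
    (torsionFreeMod hp _ _ hC) (exists_root _ _ _ _ _ _ hc) hsmooth hφB hρφ (fun r ↦ ?_)
    (fun r ↦ ?_) (fun b ↦ ?_) hn ⟨fun r ↦ ?_, fun b ↦ ?_, fun b ↦ ?_⟩
  · rw [RingHom.comp_apply, hs, RingHom.comp_apply, frob_inl]
  · rw [RingHom.comp_apply, RingHom.comp_apply, map_inl, hgρ]
  · rw [RingHom.comp_apply, RingHom.comp_apply, hgφ, frob_inl]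
  · rw [RingHom.comp_apply, hf.apply_base, RingHom.comp_apply, Quo.map_mk]
  · rw [RingHom.comp_apply, RingHom.comp_apply, hf.apply_frob]
    obtain ⟨a, ha⟩ := Ideal.Quotient.mk_surjective (f b)
    rw [← ha, Quo.map_mk, Quo.map_mk, Quo.map_mk, Quo.map_mk, frob_inl]
  · have h := hf.map_apply b
    obtain ⟨a, ha⟩ := Ideal.Quotient.mk_surjective (f b)
    rw [← ha, Quo.map_mk] at h
    rw [RingHom.comp_apply, RingHom.comp_apply, ← ha, Quo.map_mk, Quo.map_mk, map_inl]
    exact congrArg (Quo.map (dvd_refl _) (inl hφC (family c))) h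

end FrobCover

namespace PadicFormalScheme

variable {p : ℕ}

lemma exists_mem_of_cover {X : PadicFormalScheme.{u} p} {n : ℕ} (hn : 0 < n) {ι : Type*}
    {U : ι → X.Opens} (hU : ∀ x : X.red n, ∃ i, x ∈ (U i).toOpens n) (m : ℕ) (x : X.red m) :
    ∃ i, x ∈ (U i).toOpens m := by
  obtain ⟨z, hz⟩ := X.system_map_surjective hn (homOfLE (le_max_right m n))
    (X.system.map (homOfLE (le_max_left m n)) x)
  obtain ⟨i, hi⟩ := hU z
  refine ⟨i, ?_⟩
  rw [← (U i).preimage_eq (homOfLE (le_max_left m n))]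
  change X.system.map _ x ∈ (U i).toOpens (max m n)
  rw [← hz]
  exact ((U i).preimage_eq (homOfLE (le_max_right m n))).ge hi

lemma sectionsMap_sectionsMap {X Y Y' Z : PadicFormalScheme.{u} p} {f : X ⟶ Y} {g : Y ⟶ Z}
    {f' : X ⟶ Y'} {g' : Y' ⟶ Z} (h : f ≫ g = f' ≫ g') {U : X.Opens} {V : Y.Opens} {V' : Y'.Opens}
    {W : Z.Opens} (hf : ∀ n, U.toOpens n ≤ redMap f n ⁻¹ᵁ V.toOpens n)
    (hg : ∀ n, V.toOpens n ≤ redMap g n ⁻¹ᵁ W.toOpens n)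
    (hf' : ∀ n, U.toOpens n ≤ redMap f' n ⁻¹ᵁ V'.toOpens n)
    (hg' : ∀ n, V'.toOpens n ≤ redMap g' n ⁻¹ᵁ W.toOpens n) (s : Z.sections W) :
    sectionsMap f V U hf (sectionsMap g W V hg s) =
      sectionsMap f' V' U hf' (sectionsMap g' W V' hg' s) := by
  refine sections_ext fun n ↦ ?_
  refine (Scheme.Hom.appLE_appLE _ _ (hg n) (hf n) _).trans ?_
  refine Eq.trans ?_ (Scheme.Hom.appLE_appLE _ _ (hg' n) (hf' n) _).symm
  exact Scheme.Hom.appLE_congr_hom (congrArg (fun m ↦ redMap m n) h) _ _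

end PadicFormalScheme

namespace FormalPhiScheme

open PadicFormalScheme

variable {p : ℕ}

variable {S Y T Z : FormalPhiScheme.{u} p} {y : Y ⟶ S} {t : T ⟶ S} {i : Z ⟶ T} {g : Z ⟶ Y} {n : ℕ}
  {f : T.red n ⟶ Y.red n} {W : S.toFormal.Opens} {V : Y.toFormal.Opens} {U : T.toFormal.Opens}

/-- The homomorphism induced by a morphism between reductions. -/
noncomputable def redRingHom (f : T.red n ⟶ Y.red n) (hU : U.IsAffine)
    (hUV : U.toOpens n ≤ f ⁻¹ᵁ V.toOpens n) :
    Y.toFormal.sections V →+* Quo (p ^ n) (T.toFormal.sections U) :=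
  (quoEquiv hU n).symm.toRingHom.comp ((f.appLE _ _ hUV).hom.comp (proj V n))

lemma redRingHom_eq (hU : U.IsAffine) (hUV : U.toOpens n ≤ f ⁻¹ᵁ V.toOpens n) {a b}
    (h : f.appLE _ _ hUV (proj V n b) = proj U n a) :
    redRingHom f hU hUV b = Ideal.Quotient.mk _ a := by
  have h1 := (quoEquiv hU n).symm_apply_apply (Ideal.Quotient.mk _ a)
  rw [quoEquiv_mk, ← h] at h1
  exact h1

lemma isCompatibleMod_redRingHom
    (hfS : f ≫ redMap y n = redMap t n) (hfphi : T.phiRed n ≫ f = f ≫ Y.phiRed n)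
    (hfg : redMap i n ≫ f = redMap g n) (hU : U.IsAffine)
    (hVW : ∀ m, V.toOpens m ≤ redMap y m ⁻¹ᵁ W.toOpens m)
    (hUW : ∀ m, U.toOpens m ≤ redMap t m ⁻¹ᵁ W.toOpens m)
    (hUV : U.toOpens n ≤ f ⁻¹ᵁ V.toOpens n) {U' : Z.toFormal.Opens} (hU' : U'.IsAffine)
    (hU'U : ∀ m, U'.toOpens m ≤ redMap i m ⁻¹ᵁ U.toOpens m)
    (hU'V : ∀ m, U'.toOpens m ≤ redMap g m ⁻¹ᵁ V.toOpens m) :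
    IsCompatibleMod p n (T.frob U) (sectionsMap i.toFormal U U' hU'U)
      (sectionsMap y.toFormal W V hVW) (Y.frob V) (sectionsMap t.toFormal W U hUW)
      (sectionsMap g.toFormal V U' hU'V) (redRingHom f hU hUV) where
  apply_base r := by
    refine redRingHom_eq hU hUV ?_
    refine (Scheme.Hom.appLE_appLE f _ (hVW n) hUV _).trans ?_
    exact Scheme.Hom.appLE_congr_hom hfS _ _
  apply_frob b := by
    obtain ⟨a, ha⟩ := proj_surjective hU n (f.appLE _ _ hUV (proj V n b))
    rw [redRingHom_eq hU hUV ha.symm, Quo.map_mk]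
    refine redRingHom_eq hU hUV ?_
    refine (Scheme.Hom.appLE_appLE f _ (Y.le_phi_preimage V n) hUV _).trans ?_
    refine (Scheme.Hom.appLE_congr_hom hfphi.symm _ _).trans ?_
    refine (Scheme.Hom.appLE_appLE (T.phiRed n) f hUV (T.le_phi_preimage U n) _).symm.trans ?_
    rw [← ha]
    rfl
  map_apply b := by
    obtain ⟨a, ha⟩ := proj_surjective hU n (f.appLE _ _ hUV (proj V n b))
    rw [redRingHom_eq hU hUV ha.symm, Quo.map_mk]
    refine (quoEquiv hU' n).injective ?_
    rw [quoEquiv_mk, quoEquiv_mk, proj_sectionsMap, ha]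
    refine (Scheme.Hom.appLE_appLE _ f hUV (hU'U n) _).trans ?_
    exact Scheme.Hom.appLE_congr_hom hfg _ _

/-- The lifting theorem for affine pieces. -/
lemma exists_lift_system (hp : p.Prime) (hy : IsPCompletelySmooth y) (hn : 0 < n)
    (hfS : f ≫ redMap y n = redMap t n) (hfphi : T.phiRed n ≫ f = f ≫ Y.phiRed n)
    (hi : IsClosedImm i) (hg : g ≫ y = i ≫ t) (hfg : redMap i n ≫ f = redMap g n)
    (hW : W.IsAffine) (hV : V.IsAffine) (hU : U.IsAffine)
    (hVW : ∀ m, V.toOpens m ≤ redMap y m ⁻¹ᵁ W.toOpens m)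
    (hUW : ∀ m, U.toOpens m ≤ redMap t m ⁻¹ᵁ W.toOpens m)
    (hUV : U.toOpens n ≤ f ⁻¹ᵁ V.toOpens n) {U' : Z.toFormal.Opens} (hU' : U'.IsAffine)
    (hUU' : ∀ m, redMap i m ⁻¹ᵁ U.toOpens m = U'.toOpens m)
    (hU'V : ∀ m, U'.toOpens m ≤ redMap g m ⁻¹ᵁ V.toOpens m) :
    ∃ F : ∀ m, Y.toFormal.sections V →+*
        Quo (p ^ m) (FrobCover.ring (T.isFrobLift_frob hU) id),
      (∀ m, IsCompatibleMod p m (FrobCover.frob (T.isFrobLift_frob hU) id)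
        (FrobCover.map (T.isFrobLift_frob hU) (Z.isFrobLift_frob hU')
          (sectionsMap i.toFormal U U' fun m ↦ (hUU' m).ge) hp (Z.torsionFree U')
          (sectionsMap_frob i U U' _)) (sectionsMap y.toFormal W V hVW) (Y.frob V)
        ((FrobCover.inl _ _).comp (sectionsMap t.toFormal W U hUW))
        ((FrobCover.inl _ _).comp (sectionsMap g.toFormal V U' hU'V)) (F m)) ∧
      F n = (Quo.map (dvd_refl _) (FrobCover.inl _ _)).comp (redRingHom f hU hUV) ∧
      ∀ m k (h : m ≤ k), (Quo.res p _ h).comp (F k) = F m := by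
  have := hi 1
  have hs : Function.Surjective (sectionsMap i.toFormal U U' fun m ↦ (hUU' m).ge) :=
    sectionsMap_surjective _ _ _ hU' hU _
      (Scheme.Hom.appLE_surjective (redMap i 1) (hU 1) (hUU' 1))
  refine FrobCover.exists_lift_system hp _ (Y.isFrobLift_frob hV) _ hs _ _
    (fun m ↦ formallySmooth_quo_map_sectionsMap _ hW hV _ m (hy m)) (sectionsMap_frob y W V hVW)
    (sectionsMap_frob t W U hUW) (fun r ↦ ?_) (sectionsMap_frob g V U' hU'V) hn
    (isCompatibleMod_redRingHom hfS hfphi hfg hU hVW hUW hUV hU' _ hU'V)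
  exact sectionsMap_sectionsMap (congrArg Hom.toFormal hg) _ _ _ _ _

end FormalPhiScheme

namespace FormalPhiScheme

open PadicFormalScheme

variable {p : ℕ} {S Y T Z : FormalPhiScheme.{u} p} {y : Y ⟶ S} {t : T ⟶ S} {i : Z ⟶ T}
  {g : Z ⟶ Y} {n : ℕ} {f : T.red n ⟶ Y.red n}

section Sigma

variable (hp : p.Prime) {ι : Type u} {A B : ι → Type u} [∀ i, CommRing (A i)]
  [∀ i, CommRing (B i)] {φ : ∀ i, A i →+* A i} {hφ : ∀ i, IsFrobLift p (φ i)}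
  {hA : ∀ i, TorsionFreeMod p (A i)} {ψ : ∀ i, B i →+* B i} {hψ : ∀ i, IsFrobLift p (ψ i)}
  {hB : ∀ i, TorsionFreeMod p (B i)} {X Y : FormalPhiScheme.{u} p}
  {U : ι → X.toFormal.Opens} {hU : ∀ i, (U i).IsAffine}

lemma sigmaSpf_hom_ext {f g : sigmaSpf hp φ hφ hA ⟶ X}
    (h : ∀ i m, sigmaι p A i m ≫ redMap f m = sigmaι p A i m ≫ redMap g m) : f = g :=
  Hom.ext (PadicFormalScheme.sigmaSpf_hom_ext h)

/-- The composite of a morphism of disjoint unions with a morphism given by homomorphisms. -/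
lemma sigmaι_redMap_sigmaMap_comp (c : ∀ i, A i →+* B i) (hc : ∀ i a, c i (φ i a) = ψ i (c i a))
    (F : ∀ i m, X.toFormal.sections (U i) →+* Quo (p ^ m) (A i))
    (hF : ∀ i m n (h : m ≤ n), (Quo.res p (A i) h).comp (F i n) = F i m)
    (hF' : ∀ i m b, F i m (X.frob (U i) b) = Quo.map (dvd_refl _) (φ i) (F i m b)) (i : ι) (m : ℕ) :
    sigmaι p B i m ≫ redMap (sigmaMap hp φ hφ hA ψ hψ hB c hc ≫
      sigmaLift hp φ hφ hA hU F hF hF') m =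
    toRed (hU i) m ((Quo.map (dvd_refl (p ^ m)) (c i)).comp (F i m))
      (Quo.natCast_pow_eq_zero p m _) := by
  refine (Category.assoc _ _ _).symm.trans ?_
  refine (congrArg (· ≫ _) (sigmaι_redMap_sigmaSpfMap c i m)).trans ?_
  refine (Category.assoc _ _ _).trans ?_
  rw [sigmaι_redMap_sigmaLift, Quo.specMap, specMap_toRed _ _ _ _ (Quo.natCast_pow_eq_zero p m _)]

/-- The composite of a morphism given by homomorphisms with a morphism. -/
lemma sigmaι_redMap_sigmaLift_comp (F : ∀ i m, X.toFormal.sections (U i) →+* Quo (p ^ m) (A i))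
    (hF : ∀ i m n (h : m ≤ n), (Quo.res p (A i) h).comp (F i n) = F i m)
    (hF' : ∀ i m b, F i m (X.frob (U i) b) = Quo.map (dvd_refl _) (φ i) (F i m b)) (g : X ⟶ Y)
    (i : ι) (m : ℕ) {V : Y.toFormal.Opens} (hV : V.IsAffine)
    (h : ∀ m, (U i).toOpens m ≤ redMap g m ⁻¹ᵁ V.toOpens m) :
    sigmaι p A i m ≫ redMap (sigmaLift hp φ hφ hA hU F hF hF' ≫ g) m =
    toRed hV m ((F i m).comp (sectionsMap g.toFormal V (U i) h))
      (Quo.natCast_pow_eq_zero p m _) := by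
  refine (Category.assoc _ _ _).symm.trans ?_
  refine (congrArg (· ≫ redMap g m) (sigmaι_redMap_sigmaLift hp φ hφ hA hU F hF hF' i m)).trans ?_
  exact toRed_redMap (hU i) hV _ _ _ h

variable {F : ∀ i m, X.toFormal.sections (U i) →+* Quo (p ^ m) (A i)}
  {hF : ∀ i m n (h : m ≤ n), (Quo.res p (A i) h).comp (F i n) = F i m}
  {hF' : ∀ i m b, F i m (X.frob (U i) b) = Quo.map (dvd_refl _) (φ i) (F i m b)}
  {V : ι → Y.toFormal.Opens} {hV : ∀ i, (V i).IsAffine}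

lemma sigmaMap_sigmaLift_eq {c : ∀ i, A i →+* B i} {hc : ∀ i a, c i (φ i a) = ψ i (c i a)}
    {G : ∀ i m, Y.toFormal.sections (V i) →+* Quo (p ^ m) (B i)}
    {hG : ∀ i m n (h : m ≤ n), (Quo.res p (B i) h).comp (G i n) = G i m}
    {hG' : ∀ i m b, G i m (Y.frob (V i) b) = Quo.map (dvd_refl _) (ψ i) (G i m b)} (g : Y ⟶ X)
    (h : ∀ i m, (V i).toOpens m ≤ redMap g m ⁻¹ᵁ (U i).toOpens m)
    (H : ∀ i m b, Quo.map (dvd_refl _) (c i) (F i m b) =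
      G i m (sectionsMap g.toFormal (U i) (V i) (h i) b)) :
    sigmaMap hp φ hφ hA ψ hψ hB c hc ≫ sigmaLift hp φ hφ hA hU F hF hF' =
      sigmaLift hp ψ hψ hB hV G hG hG' ≫ g := by
  refine sigmaSpf_hom_ext hp fun i m ↦ ?_
  refine (sigmaι_redMap_sigmaMap_comp hp c hc F hF hF' i m).trans ?_
  refine Eq.trans ?_ (sigmaι_redMap_sigmaLift_comp hp G hG hG' g i m (hU i) (h i)).symm
  congr 1
  exact RingHom.ext (H i m)

lemma sigmaLift_comp_eq {X' : FormalPhiScheme.{u} p} {W : ι → X'.toFormal.Opens}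
    (hW : ∀ i, (W i).IsAffine) {G : ∀ i m, Y.toFormal.sections (V i) →+* Quo (p ^ m) (A i)}
    {hG : ∀ i m n (h : m ≤ n), (Quo.res p (A i) h).comp (G i n) = G i m}
    {hG' : ∀ i m b, G i m (Y.frob (V i) b) = Quo.map (dvd_refl _) (φ i) (G i m b)}
    (f : X ⟶ X') (g : Y ⟶ X')
    (hf : ∀ i m, (U i).toOpens m ≤ redMap f m ⁻¹ᵁ (W i).toOpens m)
    (hg : ∀ i m, (V i).toOpens m ≤ redMap g m ⁻¹ᵁ (W i).toOpens m)
    (H : ∀ i m b, F i m (sectionsMap f.toFormal (W i) (U i) (hf i) b) =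
      G i m (sectionsMap g.toFormal (W i) (V i) (hg i) b)) :
    sigmaLift hp φ hφ hA hU F hF hF' ≫ f = sigmaLift hp φ hφ hA hV G hG hG' ≫ g := by
  refine sigmaSpf_hom_ext hp fun i m ↦ ?_
  refine (sigmaι_redMap_sigmaLift_comp hp F hF hF' f i m (hW i) (hf i)).trans ?_
  refine Eq.trans ?_ (sigmaι_redMap_sigmaLift_comp hp G hG hG' g i m (hW i) (hg i)).symm
  congr 1
  exact RingHom.ext (H i m)

lemma redMap_sigmaLift_eq {G : ∀ i m, Y.toFormal.sections (V i) →+* Quo (p ^ m) (A i)}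
    {hG : ∀ i m n (h : m ≤ n), (Quo.res p (A i) h).comp (G i n) = G i m}
    {hG' : ∀ i m b, G i m (Y.frob (V i) b) = Quo.map (dvd_refl _) (φ i) (G i m b)} {n : ℕ}
    (f : X.red n ⟶ Y.red n) (hf : ∀ i, (U i).toOpens n ≤ f ⁻¹ᵁ (V i).toOpens n)
    (H : ∀ i b a, f.appLE _ _ (hf i) (proj (V i) n b) = proj (U i) n a → F i n a = G i n b) :
    redMap (sigmaLift hp φ hφ hA hV G hG hG') n =
      redMap (sigmaLift hp φ hφ hA hU F hF hF') n ≫ f := by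
  refine sigma_red_hom_ext fun i ↦ ?_
  refine (sigmaι_redMap_sigmaLift hp φ hφ hA hV G hG hG' i n).trans ?_
  refine Eq.trans ?_ (Category.assoc _ _ _)
  refine Eq.trans ?_ (congrArg (· ≫ f) (sigmaι_redMap_sigmaLift hp φ hφ hA hU F hF hF' i n).symm)
  exact (toRed_comp (hU i) (hV i) _ _ _ _ f (hf i) (H i)).symm

end Sigma

/-- The opens are chosen at level `n`, the only level where `f` exists. The inclusions involving `y`
and `t` then propagate to all levels, since an open is determined by any positive level. -/
lemma exists_isAffine_neighborhoods (hp : p.Prime) (hn : 0 < n)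
    (hfS : f ≫ redMap y n = redMap t n) (x : T.red n) :
    ∃ (W : S.toFormal.Opens) (V : Y.toFormal.Opens) (U : T.toFormal.Opens),
      W.IsAffine ∧ V.IsAffine ∧ U.IsAffine ∧ x ∈ U.toOpens n ∧
      (∀ m, V.toOpens m ≤ redMap y m ⁻¹ᵁ W.toOpens m) ∧
      (∀ m, U.toOpens m ≤ redMap t m ⁻¹ᵁ W.toOpens m) ∧ U.toOpens n ≤ f ⁻¹ᵁ V.toOpens n := by
  obtain ⟨W, hW, hxW, -⟩ := exists_isAffine_mem hp hn
    (TopologicalSpace.Opens.mem_top (redMap y n (f x)))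
  obtain ⟨V, hV, hxV, hVW⟩ := exists_isAffine_mem hp hn (O := redMap y n ⁻¹ᵁ W.toOpens n)
    (x := f x) hxW
  obtain ⟨U, hU, hxU, hUV⟩ := exists_isAffine_mem hp hn (O := f ⁻¹ᵁ V.toOpens n) (x := x) hxV
  refine ⟨W, V, U, hW, hV, hU, hxU,
    Opens.le_of_le (V := preimage y.toFormal W) hn hVW,
    Opens.le_of_le (V := preimage t.toFormal W) hn ?_, hUV⟩
  refine (hUV.trans (f.preimage_mono hVW)).trans ?_
  rw [← Scheme.Hom.comp_preimage, hfS]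
  rfl

/-- The lifting theorem relative to a closed formal `φ`-subscheme. -/
theorem exists_lift (hp : p.Prime) (hy : IsPCompletelySmooth y) (hn : 0 < n)
    (hfS : f ≫ redMap y n = redMap t n) (hfphi : T.phiRed n ≫ f = f ≫ Y.phiRed n)
    (hi : IsClosedImm i) (hg : g ≫ y = i ≫ t) (hfg : redMap i n ≫ f = redMap g n) :
    ∃ (T' Z' : FormalPhiScheme.{u} p) (u : T' ⟶ T) (v : Z' ⟶ Z) (i' : Z' ⟶ T') (f' : T' ⟶ Y),
      IsPCompletelyFaithfullyFlat u ∧ IsPCompletelyFaithfullyFlat v ∧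
      i' ≫ u = v ≫ i ∧ i' ≫ f' = v ≫ g ∧ f' ≫ y = u ≫ t ∧ redMap f' n = redMap u n ≫ f := by
  -- One affine piece for every point of `T_n`. These cover all levels of `T`, and their preimages
  -- under `i` cover `Z`.
  choose W V U hW hV hU hxU hVW hUW hUV using exists_isAffine_neighborhoods hp hn hfS
  let U' (x : T.red n) : Z.toFormal.Opens := preimage i.toFormal (U x)
  have hU' (x) : (U' x).IsAffine := fun m ↦ by
    have := hi m
    exact (hU x m).preimage _
  have hU'V (x) : ∀ m, (U' x).toOpens m ≤ redMap g m ⁻¹ᵁ (V x).toOpens m := by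
    refine Opens.le_of_le (V := preimage g.toFormal (V x)) hn ?_
    refine ((redMap i n).preimage_mono (hUV x)).trans ?_
    rw [← Scheme.Hom.comp_preimage, hfg]
    rfl
  choose F hF hFn hFres using fun x ↦ exists_lift_system hp hy hn hfS hfphi hi hg hfg (hW x) (hV x)
    (hU x) (hVW x) (hUW x) (hUV x) (hU' x) (fun _ ↦ rfl) (hU'V x)
  have hcov := exists_mem_of_cover hn fun x ↦ ⟨x, hxU x⟩
  have hA (x) := FrobCover.torsionFreeMod hp (T.isFrobLift_frob (hU x)) id (T.torsionFree (U x))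
  have hfA (x) := FrobCover.isFrobLift_frob (T.isFrobLift_frob (hU x)) id hp
  let c (x) := sectionsMap i.toFormal (U x) (U' x) fun _ ↦ le_rfl
  have hC (x) := FrobCover.torsionFreeMod hp (Z.isFrobLift_frob (hU' x)) (FrobCover.family (c x))
    (Z.torsionFree (U' x))
  have hfC (x) := FrobCover.isFrobLift_frob (Z.isFrobLift_frob (hU' x)) (FrobCover.family (c x)) hp
  -- Both covers are disjoint unions over the same index set, so all morphisms are defined piece by
  -- piece and the local lifts need not agree on overlaps.
  refine ⟨sigmaSpf hp _ hfA hA, sigmaSpf hp _ hfC hC,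
    sigmaToSpf hp _ hfA hA hU (fun x ↦ FrobCover.inl _ _) fun x b ↦ (FrobCover.frob_inl _ _ b).symm,
    sigmaToSpf hp _ hfC hC hU' (fun x ↦ FrobCover.inl _ _) fun x b ↦ (FrobCover.frob_inl _ _ b).symm,
    sigmaMap hp _ hfA hA _ hfC hC (fun x ↦ FrobCover.map _ _ (c x) hp (Z.torsionFree (U' x))
      (sectionsMap_frob i _ _ _)) fun x ↦ FrobCover.map_frob _ _ _ _ _ _,
    sigmaLift hp _ hfA hA hV F hFres fun x m b ↦ (hF x m).apply_frob b,
    isPCompletelyFaithfullyFlat_sigmaToSpf hp _ _ _ _ _ _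
      (fun x ↦ FrobCover.isFaithfullyFlatMod hp _ _) hcov,
    isPCompletelyFaithfullyFlat_sigmaToSpf hp _ _ _ _ _ _
      (fun x ↦ FrobCover.isFaithfullyFlatMod hp _ _) fun m z ↦ hcov m (redMap i m z), ?_, ?_, ?_, ?_⟩
  · exact sigmaMap_sigmaLift_eq hp i (fun x m ↦ le_rfl)
      fun x m a ↦ congrArg (Ideal.Quotient.mk _) (FrobCover.map_inl _ _ _ _ _ _ a)
  · exact sigmaMap_sigmaLift_eq hp g hU'V fun x m ↦ (hF x m).map_apply
  · exact sigmaLift_comp_eq hp hW y t hVW hUW fun x m ↦ (hF x m).apply_base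
  · refine redMap_sigmaLift_eq hp f hUV fun x b a hab ↦ ?_
    rw [hFn]
    exact (congrArg (Quo.map (dvd_refl _) (FrobCover.inl _ _))
      (redRingHom_eq (hU x) (hUV x) hab)).symm

/-- The empty formal `φ`-scheme. -/
noncomputable def empty (hp : p.Prime) : FormalPhiScheme.{u} p :=
  sigmaSpf hp (ι := PEmpty) (A := fun _ ↦ PUnit) (fun _ ↦ RingHom.id _) (fun x ↦ x.elim)
    fun x ↦ x.elim

instance (hp : p.Prime) (m : ℕ) : IsEmpty ((empty.{u} hp).red m) :=
  ⟨fun x ↦ by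
    obtain ⟨⟨⟩, -⟩ := exists_sigmaι_apply_eq x⟩

/-- The morphism from the empty formal `φ`-scheme. -/
noncomputable def fromEmpty (hp : p.Prime) (X : FormalPhiScheme.{u} p) : empty hp ⟶ X :=
  sigmaDesc hp _ _ _ (fun x ↦ x.elim) (fun x ↦ x.elim) fun x ↦ x.elim

lemma fromEmpty_ext {hp : p.Prime} {X : FormalPhiScheme.{u} p} (f g : empty hp ⟶ X) : f = g :=
  FormalPhiScheme.sigmaSpf_hom_ext hp fun x ↦ x.elim

end FormalPhiScheme

theorem mainTheorem5 {p : ℕ} (hp : p.Prime) {S Y T : FormalPhiScheme.{u} p}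
    (y : Y ⟶ S) (t : T ⟶ S) (hy : FormalPhiScheme.IsPCompletelySmooth y)
    (n : ℕ) (hn : 0 < n) (f : T.red n ⟶ Y.red n)
    (hfS : f ≫ FormalPhiScheme.redMap y n = FormalPhiScheme.redMap t n)
    (hfphi : T.phiRed n ≫ f = f ≫ Y.phiRed n) :
    (∃ (T' : FormalPhiScheme.{u} p) (u : T' ⟶ T) (f' : T' ⟶ Y),
      FormalPhiScheme.IsPCompletelyFaithfullyFlat u ∧
      f' ≫ y = u ≫ t ∧
      FormalPhiScheme.redMap f' n = FormalPhiScheme.redMap u n ≫ f) ∧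
    (∀ (Z : FormalPhiScheme.{u} p) (i : Z ⟶ T) (g : Z ⟶ Y),
      FormalPhiScheme.IsClosedImm i →
      g ≫ y = i ≫ t →
      FormalPhiScheme.redMap i n ≫ f = FormalPhiScheme.redMap g n →
      ∃ (T' Z' : FormalPhiScheme.{u} p) (u : T' ⟶ T) (v : Z' ⟶ Z) (i' : Z' ⟶ T') (f' : T' ⟶ Y),
        FormalPhiScheme.IsPCompletelyFaithfullyFlat u ∧
        FormalPhiScheme.IsPCompletelyFaithfullyFlat v ∧
        i' ≫ u = v ≫ i ∧
        i' ≫ f' = v ≫ g ∧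
        f' ≫ y = u ≫ t ∧
        FormalPhiScheme.redMap f' n = FormalPhiScheme.redMap u n ≫ f) := by
  refine ⟨?_, fun Z i g hi hg hfg ↦
    FormalPhiScheme.exists_lift hp hy hn hfS hfphi hi hg hfg⟩
  -- The absolute case is the relative one for the empty closed subscheme, for which all
  -- compatibilities are vacuous.
  obtain ⟨T', -, u, -, -, f', hu, -, -, -, h₁, h₂⟩ :=
    FormalPhiScheme.exists_lift hp hy hn hfS hfphi (i := FormalPhiScheme.fromEmpty hp T)
      (g := FormalPhiScheme.fromEmpty hp Y) (fun m ↦ inferInstance)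
      (FormalPhiScheme.fromEmpty_ext _ _)
      (PadicFormalScheme.sigma_red_hom_ext fun x ↦ x.elim)
  exact ⟨T', u, f', hu, h₁, h₂⟩
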